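/- Let $k$ be an arbitrary field, let $a\ge 1$ and $n\ge 2$ be integers, and put $d=an$, $S=k[x_1,\dots,x_d]$. Let $R=S^{(n)}\subseteq S$ be the $n$-th Veronese subring, i.e. the subring spanned by the monomials whose degree is divisible by $n$. As an $R$-module $S=\bigoplus_{i=0}^{n-1}M_i$, where $M_i$ is spanned by the monomials of degree congruent to $i$ modulo $n$. For $R$-modules $X,Y$ let $\underline{\mathrm{Hom}}_R(X,Y)$ be the quotient of $\mathrm{Hom}_R(X,Y)$ by the maps which factor through a projective $R$-module. Let $\Omega X$ be the kernel of a (chosen) surjection from a projective module onto $X$, regarded as a functor on the stable category. Consider the graded $k$-algebra $$\Gamma=\bigoplus_{i\ge 0}\underline{\mathrm{Hom}}_R(S,\Omega^iS),\qquad g\cdot f=\Omega^i(g)\circ f\quad\text{for } f\in\underline{\mathrm{Hom}}_R(S,\Omega^iS),\ g\in\underline{\mathrm{Hom}}_R(S,\Omega^jS).$$ **Theorem.** For every choice of projective presentations used to define $\Omega$, the algebra $\Gamma$ is presented by the following quiver $Q$ with relations (products of arrows are read from right to left). (a) Vertices: $1,2,\dots,n-1$ (the vertex $i$ corresponds to $M_i$).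 (b) Arrows: * $d$ arrows $x_s=x_s^i\colon i\to i+1$ $(1\le s\le d)$ for each $1\le i<n-1$; * $\binom d2$ arrows $x_{st}\colon n-1\to 1$ $(1\le s<t\le d)$. (c) Relations: * for each $1\le i<n-2$, the $\binom d2$ relations $x_s^{i+1}x_t^i=x_t^{i+1}x_s^i$ $(1\le s<t\le d)$; * if $n\ge 3$, the $\binom d3$ relations $x_s^1x_{tu}-x_t^1x_{su}+x_u^1x_{st}=0$ and the $\binom d3$ relations $x_{st}x_u^{n-2}-x_{su}x_t^{n-2}+x_{tu}x_s^{n-2}=0$ $(1\le s<t<u\le d)$; * if $n=2$, the $\binom d4$ relations $x_{uv}x_{st}-x_{tv}x_{su}+x_{tu}x_{sv}+x_{sv}x_{tu}-x_{su}x_{tv}+x_{st}x_{uv}=0$ $(1\le s<t<u<v\le d)$. More precisely, there is an isomorphism of $k$-algebras from the path algebra $kQ$ modulo the two-sided ideal generated by these relations onto $\Gamma$ which sends the trivial path at $i$ to the class in $\underline{\mathrm{End}}_R(S)=\Gamma_0$ of the projection of $S$ onto $M_i$, sends $x_s^i$ to the class in $\Gamma_0$ of multiplication by $x_s$ from $M_i$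 to $M_{i+1}$ (and zero on $M_j$, $j\neq i$), and sends each $x_{st}$ into the degree one part $\Gamma_1=\underline{\mathrm{Hom}}_R(S,\Omega S)$. -/

import Mathlib

universe u

/-! ## The path algebra of a quiver with finitely many vertices -/

/-- All paths of a quiver, with arbitrary source `p.1` and target `p.2.1`
(including a trivial path at each vertex). -/
abbrev AnyPath (V : Type*) [Quiver V] := Σ a b : V, Quiver.Path a b

/-- The path algebra `kQ`: the free `k`-module on all paths. -/
def PathAlgebra (k : Type*) (V : Type*) [Quiver V] [CommRing k] := AnyPath V →₀ k

namespace PathAlgebra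

section

variable {k : Type*} {V : Type*} [Quiver V] [CommRing k]

noncomputable instance : AddCommGroup (PathAlgebra k V) :=
  inferInstanceAs (AddCommGroup (AnyPath V →₀ k))

noncomputable instance : Module k (PathAlgebra k V) :=
  inferInstanceAs (Module k (AnyPath V →₀ k))

/-- A path, as a basis element of the path algebra. -/
noncomputable def ofPath (p : AnyPath V) : PathAlgebra k V := Finsupp.single p (1 : k)

theorem hom_ext {M : Type*} [AddCommGroup M] [Module k M] {f g : PathAlgebra k V →ₗ[k] M}
    (h : ∀ p, f (ofPath p) = g (ofPath p)) : f = g :=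
  Finsupp.lhom_ext' fun p => LinearMap.ext_ring (h p)

/-- The linear map prescribed on the basis of paths. -/
noncomputable def lift {M : Type*} [AddCommGroup M] [Module k M] (f : AnyPath V → M) :
    PathAlgebra k V →ₗ[k] M := Finsupp.linearCombination k f

@[simp] theorem lift_ofPath {M : Type*} [AddCommGroup M] [Module k M] (f : AnyPath V → M)
    (p : AnyPath V) : lift f (ofPath (k := k) p) = f p := by
  exact (Finsupp.linearCombination_single k 1 p).trans (one_smul k (f p))

/-- The product `p * q` of two paths is the path "first `q`, then `p`" if `q` ends where `p`
starts, and is zero otherwise. -/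
noncomputable def pathMul (p q : AnyPath V) : PathAlgebra k V :=
  open scoped Classical in
  if h : q.2.1 = p.1 then ofPath ⟨q.1, p.2.1, q.2.2.comp (p.2.2.cast h.symm rfl)⟩ else 0

theorem pathMul_comp {a b c : V} (q : Quiver.Path a b) (p : Quiver.Path b c) :
    pathMul (k := k) ⟨b, c, p⟩ ⟨a, b, q⟩ = ofPath ⟨a, c, q.comp p⟩ := by
  simp [pathMul]

theorem pathMul_ne {p q : AnyPath V} (h : q.2.1 ≠ p.1) : pathMul (k := k) p q = 0 := by
  simp [pathMul, h]

/-- Multiplication of the path algebra as a bilinear map. -/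
noncomputable def mulₗ : PathAlgebra k V →ₗ[k] PathAlgebra k V →ₗ[k] PathAlgebra k V :=
  lift fun p => lift fun q => pathMul p q

noncomputable instance : Mul (PathAlgebra k V) := ⟨fun x y => mulₗ x y⟩

theorem mul_eq (x y : PathAlgebra k V) : x * y = mulₗ x y := rfl

@[simp] theorem ofPath_mul_ofPath (p q : AnyPath V) :
    (ofPath p * ofPath q : PathAlgebra k V) = pathMul p q := by
  simp [mul_eq, mulₗ]

theorem mul_assoc_aux (x y z : PathAlgebra k V) : x * y * z = x * (y * z) := by
  have key : ∀ p q r : AnyPath V, (ofPath p * ofPath q * ofPath r : PathAlgebra k V)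
      = ofPath p * (ofPath q * ofPath r) := by
    rintro ⟨c', d, p⟩ ⟨b', c, q⟩ ⟨a, b, r⟩
    by_cases h1 : c = c'
    · subst h1
      by_cases h2 : b = b'
      · subst h2
        simp [pathMul_comp]
      · rw [ofPath_mul_ofPath, ofPath_mul_ofPath, pathMul_comp, ofPath_mul_ofPath,
          pathMul_ne h2, pathMul_ne h2]
        simp [mul_eq]
    · rw [ofPath_mul_ofPath, pathMul_ne h1]
      by_cases h2 : b = b'
      · subst h2
        rw [ofPath_mul_ofPath, pathMul_comp, ofPath_mul_ofPath, pathMul_ne h1]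
        simp [mul_eq]
      · rw [ofPath_mul_ofPath, pathMul_ne h2]
        simp [mul_eq]
  have h3 : ∀ p q : AnyPath V, ∀ z : PathAlgebra k V,
      (ofPath p * ofPath q * z : PathAlgebra k V) = ofPath p * (ofPath q * z) := fun p q z =>
    LinearMap.congr_fun (f := mulₗ (mulₗ (ofPath p) (ofPath q)))
      (g := (mulₗ (ofPath p)).comp (mulₗ (ofPath q))) (hom_ext fun r => key p q r) z
  have h2 : ∀ p : AnyPath V, ∀ y z : PathAlgebra k V,
      (ofPath p * y * z : PathAlgebra k V) = ofPath p * (y * z) := fun p y z =>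
    LinearMap.congr_fun (f := (mulₗ.flip z).comp (mulₗ (ofPath p)))
      (g := (mulₗ (ofPath p)).comp (mulₗ.flip z)) (hom_ext fun q => h3 p q z) y
  exact LinearMap.congr_fun (f := (mulₗ.flip z).comp (mulₗ.flip y))
    (g := mulₗ.flip (mulₗ y z)) (hom_ext fun p => h2 p y z) x

variable [Fintype V]

/-- The unit is the sum of the trivial paths. -/
noncomputable instance : One (PathAlgebra k V) :=
  ⟨∑ a : V, ofPath ⟨a, a, Quiver.Path.nil⟩⟩

theorem one_eq : (1 : PathAlgebra k V) = ∑ a : V, ofPath ⟨a, a, Quiver.Path.nil⟩ := rfl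

theorem one_mul_aux (x : PathAlgebra k V) : 1 * x = x := by
  refine LinearMap.congr_fun (f := mulₗ 1) (g := LinearMap.id) (hom_ext ?_) x
  rintro ⟨a, b, p⟩
  rw [one_eq, map_sum, LinearMap.sum_apply, Finset.sum_eq_single b]
  · rw [← mul_eq, ofPath_mul_ofPath, pathMul_comp]; rfl
  · intro c _ hc
    rw [← mul_eq, ofPath_mul_ofPath, pathMul_ne]
    exact Ne.symm hc
  · simp

theorem mul_one_aux (x : PathAlgebra k V) : x * 1 = x := by
  refine LinearMap.congr_fun (f := mulₗ.flip 1) (g := LinearMap.id) (hom_ext ?_) x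
  rintro ⟨a, b, p⟩
  rw [LinearMap.flip_apply, one_eq, map_sum, Finset.sum_eq_single a]
  · rw [← mul_eq, ofPath_mul_ofPath, pathMul_comp, Quiver.Path.nil_comp]; rfl
  · intro c _ hc
    rw [← mul_eq, ofPath_mul_ofPath, pathMul_ne hc]
  · simp

noncomputable instance : Ring (PathAlgebra k V) where
  __ := (inferInstance : AddCommGroup (PathAlgebra k V))
  mul_assoc := mul_assoc_aux
  one_mul := one_mul_aux
  mul_one := mul_one_aux
  left_distrib x y z := map_add (mulₗ x) y z
  right_distrib x y z := LinearMap.map_add₂ mulₗ x y z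
  zero_mul x := LinearMap.map_zero₂ mulₗ x
  mul_zero x := map_zero (mulₗ x)

noncomputable instance : Algebra k (PathAlgebra k V) :=
  Algebra.ofModule (fun r x y => LinearMap.map_smul₂ mulₗ r x y)
    (fun r x y => map_smul (mulₗ x) r y)

end

/-- The idempotent `e_a`: the trivial path at the vertex `a`. -/
noncomputable def vertex (k : Type*) [CommRing k] {V : Type*} [Quiver V] (a : V) :
    PathAlgebra k V := ofPath ⟨a, a, Quiver.Path.nil⟩

/-- An arrow, as an element of the path algebra. -/
noncomputable def arrow (k : Type*) [CommRing k] {V : Type*} [Quiver V] {a b : V} (e : a ⟶ b) :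
    PathAlgebra k V := ofPath ⟨a, b, e.toPath⟩

end PathAlgebra

/-! ## Stable homomorphisms and syzygies -/

section Stable

variable {R : Type u} [CommRing R]

/-- The submodule of those linear maps which factor through a projective module. -/
def projectiveMaps (M N : ModuleCat.{u} R) : Submodule R (M →ₗ[R] N) where
  carrier := {f | ∃ P : ModuleCat.{u} R, Module.Projective R P ∧
    ∃ (a : M →ₗ[R] P) (b : P →ₗ[R] N), f = b ∘ₗ a}
  zero_mem' := ⟨ModuleCat.of R PUnit.{u + 1},
    inferInstanceAs (Module.Projective R PUnit.{u + 1}), 0, 0, (LinearMap.comp_zero _).symm⟩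
  add_mem' := by
    rintro f g ⟨P, hP, a, b, rfl⟩ ⟨Q, hQ, a', b', rfl⟩
    refine ⟨ModuleCat.of R (P × Q), inferInstanceAs (Module.Projective R (P × Q)),
      a.prod a', b.coprod b', ?_⟩
    rw [LinearMap.coprod_comp_prod]
  smul_mem' := by
    rintro r f ⟨P, hP, a, b, rfl⟩
    exact ⟨P, hP, r • a, b, by rw [LinearMap.comp_smul]⟩

/-- The stable Hom module: linear maps modulo those which factor through a projective module. -/
abbrev StableHom (M N : ModuleCat.{u} R) := (M →ₗ[R] N) ⧸ projectiveMaps M N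

/-- The class of a linear map in the stable category. -/
def StableHom.mk {M N : ModuleCat.{u} R} (f : M →ₗ[R] N) : StableHom M N :=
  (projectiveMaps M N).mkQ f

theorem projectiveMaps.comp_left {L M N : ModuleCat.{u} R} (g : M →ₗ[R] N) {f : L →ₗ[R] M}
    (hf : f ∈ projectiveMaps L M) : g ∘ₗ f ∈ projectiveMaps L N := by
  obtain ⟨P, hP, a, b, rfl⟩ := hf
  exact ⟨P, hP, a, g ∘ₗ b, rfl⟩

theorem projectiveMaps.comp_right {L M N : ModuleCat.{u} R} {g : M →ₗ[R] N} (f : L →ₗ[R] M)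
    (hg : g ∈ projectiveMaps M N) : g ∘ₗ f ∈ projectiveMaps L N := by
  obtain ⟨P, hP, a, b, rfl⟩ := hg
  exact ⟨P, hP, a ∘ₗ f, b, rfl⟩

/-- Composition in the stable category, `StableHom.comp g f = g ∘ f`. -/
def StableHom.comp {L M N : ModuleCat.{u} R} :
    StableHom M N →ₗ[R] StableHom L M →ₗ[R] StableHom L N :=
  (projectiveMaps M N).liftQ
    (LinearMap.flip ((projectiveMaps L M).liftQ
      (LinearMap.flip ((LinearMap.llcomp R L M N).compr₂ (projectiveMaps L N).mkQ))
      (by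
        intro f hf
        rw [LinearMap.mem_ker]
        ext g
        exact (Submodule.Quotient.mk_eq_zero _).2 (projectiveMaps.comp_left g hf))))
    (by
      intro g hg
      rw [LinearMap.mem_ker]
      refine LinearMap.ext fun f => ?_
      obtain ⟨f, rfl⟩ := Submodule.mkQ_surjective _ f
      exact (Submodule.Quotient.mk_eq_zero _).2 (projectiveMaps.comp_right f hg))

@[simp] theorem StableHom.comp_mk {L M N : ModuleCat.{u} R} (g : M →ₗ[R] N) (f : L →ₗ[R] M) :
    StableHom.comp (StableHom.mk g) (StableHom.mk f) = StableHom.mk (g ∘ₗ f) := rfl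

theorem StableHom.mk_surjective {M N : ModuleCat.{u} R} :
    Function.Surjective (StableHom.mk (M := M) (N := N)) :=
  Submodule.mkQ_surjective _

theorem StableHom.mk_add {M N : ModuleCat.{u} R} (f g : M →ₗ[R] N) :
    StableHom.mk (f + g) = StableHom.mk f + StableHom.mk g := rfl

theorem StableHom.mk_smul {M N : ModuleCat.{u} R} (r : R) (f : M →ₗ[R] N) :
    StableHom.mk (r • f) = r • StableHom.mk f := rfl

theorem StableHom.mk_eq {M N : ModuleCat.{u} R} {f g : M →ₗ[R] N} :
    StableHom.mk f = StableHom.mk g ↔ f - g ∈ projectiveMaps M N :=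
  Submodule.Quotient.eq _

/-- The identity in the stable category. -/
def StableHom.id (M : ModuleCat.{u} R) : StableHom M M := StableHom.mk LinearMap.id

theorem StableHom.id_comp {M N : ModuleCat.{u} R} (f : StableHom M N) :
    StableHom.comp (StableHom.id N) f = f := by
  obtain ⟨f, rfl⟩ := StableHom.mk_surjective f
  rfl

theorem StableHom.comp_id {M N : ModuleCat.{u} R} (f : StableHom M N) :
    StableHom.comp f (StableHom.id M) = f := by
  obtain ⟨f, rfl⟩ := StableHom.mk_surjective f
  rfl

theorem StableHom.comp_assoc {K L M N : ModuleCat.{u} R} (h : StableHom M N)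
    (g : StableHom L M) (f : StableHom K L) :
    StableHom.comp (StableHom.comp h g) f = StableHom.comp h (StableHom.comp g f) := by
  obtain ⟨f, rfl⟩ := StableHom.mk_surjective f
  obtain ⟨g, rfl⟩ := StableHom.mk_surjective g
  obtain ⟨h, rfl⟩ := StableHom.mk_surjective h
  rfl

/-- A choice, for every module `X`, of a surjection `π X : P X → X` from a projective module
(for instance a projective cover whenever there is one). -/
structure ProjectivePresentations (R : Type u) [CommRing R] where
  P : ModuleCat.{u} R → ModuleCat.{u} R
  π : ∀ X : ModuleCat.{u} R, P X →ₗ[R] X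
  projective : ∀ X, Module.Projective R (P X)
  surjective : ∀ X, Function.Surjective (π X)

namespace ProjectivePresentations

variable (p : ProjectivePresentations R)

/-- The syzygy `Ω X`: the kernel of the chosen surjection onto `X`. -/
def Ω (X : ModuleCat.{u} R) : ModuleCat.{u} R := ModuleCat.of R (LinearMap.ker (p.π X))

/-- The inclusion of the syzygy. -/
def ι (X : ModuleCat.{u} R) : p.Ω X →ₗ[R] p.P X := (LinearMap.ker (p.π X)).subtype

/-- `h : Ω X → Ω Y` is a syzygy of `f : X → Y` if it is induced by a lift `g` of `f` to the
chosen projective modules. -/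
def IsSyzygyMap {X Y : ModuleCat.{u} R} (f : X →ₗ[R] Y) (h : p.Ω X →ₗ[R] p.Ω Y) : Prop :=
  ∃ g : p.P X →ₗ[R] p.P Y, p.π Y ∘ₗ g = f ∘ₗ p.π X ∧ p.ι Y ∘ₗ h = g ∘ₗ p.ι X

variable {p}

theorem ι_injective (X : ModuleCat.{u} R) : Function.Injective (p.ι X) :=
  Subtype.val_injective

theorem π_ι {X : ModuleCat.{u} R} (x : p.Ω X) : p.π X (p.ι X x) = 0 := x.2

theorem exists_restrict {Y Z : ModuleCat.{u} R} (g : Z →ₗ[R] p.P Y)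
    (hg : ∀ z, p.π Y (g z) = 0) : ∃ h : Z →ₗ[R] p.Ω Y, p.ι Y ∘ₗ h = g :=
  ⟨LinearMap.codRestrict (LinearMap.ker (p.π Y)) g hg, rfl⟩

theorem exists_isSyzygyMap {X Y : ModuleCat.{u} R} (f : X →ₗ[R] Y) :
    ∃ h, p.IsSyzygyMap f h := by
  have := p.projective X
  obtain ⟨g, hg⟩ := Module.projective_lifting_property (p.π Y) (f ∘ₗ p.π X) (p.surjective Y)
  obtain ⟨h, hh⟩ := exists_restrict (g ∘ₗ p.ι X) (fun x => by
    have := LinearMap.congr_fun hg (p.ι X x)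
    simpa [π_ι] using this)
  exact ⟨h, g, hg, hh⟩

theorem IsSyzygyMap.add {X Y : ModuleCat.{u} R} {f f' : X →ₗ[R] Y} {h h'}
    (H : p.IsSyzygyMap f h) (H' : p.IsSyzygyMap f' h') : p.IsSyzygyMap (f + f') (h + h') := by
  obtain ⟨g, h1, h2⟩ := H
  obtain ⟨g', h1', h2'⟩ := H'
  exact ⟨g + g', by rw [LinearMap.comp_add, LinearMap.add_comp, h1, h1'],
    by rw [LinearMap.comp_add, LinearMap.add_comp, h2, h2']⟩

theorem IsSyzygyMap.smul {X Y : ModuleCat.{u} R} {f : X →ₗ[R] Y} {h} (r : R)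
    (H : p.IsSyzygyMap f h) : p.IsSyzygyMap (r • f) (r • h) := by
  obtain ⟨g, h1, h2⟩ := H
  exact ⟨r • g, by rw [LinearMap.comp_smul, LinearMap.smul_comp, h1],
    by rw [LinearMap.comp_smul, LinearMap.smul_comp, h2]⟩

theorem IsSyzygyMap.comp {X Y Z : ModuleCat.{u} R} {f : X →ₗ[R] Y} {f' : Y →ₗ[R] Z} {h h'}
    (H' : p.IsSyzygyMap f' h') (H : p.IsSyzygyMap f h) :
    p.IsSyzygyMap (f' ∘ₗ f) (h' ∘ₗ h) := by
  obtain ⟨g, h1, h2⟩ := H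
  obtain ⟨g', h1', h2'⟩ := H'
  refine ⟨g' ∘ₗ g, ?_, ?_⟩
  · rw [← LinearMap.comp_assoc, h1', LinearMap.comp_assoc, h1, LinearMap.comp_assoc]
  · rw [← LinearMap.comp_assoc, h2', LinearMap.comp_assoc, h2, LinearMap.comp_assoc]

theorem IsSyzygyMap.id (X : ModuleCat.{u} R) :
    p.IsSyzygyMap (LinearMap.id : X →ₗ[R] X) LinearMap.id :=
  ⟨LinearMap.id, rfl, rfl⟩

theorem IsSyzygyMap.mem_projectiveMaps {X Y : ModuleCat.{u} R} {f : X →ₗ[R] Y} {h}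
    (H : p.IsSyzygyMap f h) (hf : f ∈ projectiveMaps X Y) :
    h ∈ projectiveMaps (p.Ω X) (p.Ω Y) := by
  obtain ⟨g, h1, h2⟩ := H
  obtain ⟨Q, hQ, a, b, rfl⟩ := hf
  obtain ⟨b', hb'⟩ := Module.projective_lifting_property (p.π Y) b (p.surjective Y)
  obtain ⟨s, hs⟩ := exists_restrict (g - b' ∘ₗ a ∘ₗ p.π X) (fun x => by
    have e1 := LinearMap.congr_fun h1 x
    have e2 := LinearMap.congr_fun hb' (a (p.π X x))
    simp only [LinearMap.comp_apply] at e1 e2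
    simp [e1, e2])
  refine ⟨p.P X, p.projective X, p.ι X, s, ?_⟩
  refine LinearMap.ext fun x => ι_injective Y ?_
  have e1 := LinearMap.congr_fun h2 x
  have e2 := LinearMap.congr_fun hs (p.ι X x)
  simp only [LinearMap.comp_apply, LinearMap.sub_apply] at e1 e2
  rw [LinearMap.comp_apply, e1, e2, π_ι]
  simp

theorem IsSyzygyMap.sub {X Y : ModuleCat.{u} R} {f f' : X →ₗ[R] Y} {h h'}
    (H : p.IsSyzygyMap f h) (H' : p.IsSyzygyMap f' h') : p.IsSyzygyMap (f - f') (h - h') := by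
  have := H.add (H'.smul (-1))
  simpa [sub_eq_add_neg] using this

theorem IsSyzygyMap.mk_eq {X Y : ModuleCat.{u} R} {f f' : X →ₗ[R] Y} {h h'}
    (H : p.IsSyzygyMap f h) (H' : p.IsSyzygyMap f' h')
    (hf : StableHom.mk f = StableHom.mk f') : StableHom.mk h = StableHom.mk h' :=
  StableHom.mk_eq.2 ((H.sub H').mem_projectiveMaps (StableHom.mk_eq.1 hf))

variable (p)

/-- The syzygy functor on stable Hom modules: the class of `f` is sent to the class of any
syzygy map of `f`. -/
noncomputable def ΩMap (X Y : ModuleCat.{u} R) :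
    StableHom X Y →ₗ[R] StableHom (p.Ω X) (p.Ω Y) :=
  (projectiveMaps X Y).liftQ
    { toFun := fun f => StableHom.mk (exists_isSyzygyMap (p := p) f).choose
      map_add' := fun f g =>
        (exists_isSyzygyMap (p := p) (f + g)).choose_spec.mk_eq
          ((exists_isSyzygyMap (p := p) f).choose_spec.add
            (exists_isSyzygyMap (p := p) g).choose_spec) rfl
      map_smul' := fun r f =>
        (exists_isSyzygyMap (p := p) (r • f)).choose_spec.mk_eq
          ((exists_isSyzygyMap (p := p) f).choose_spec.smul r) rfl }
    (fun f hf => (Submodule.Quotient.mk_eq_zero _).2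
      ((exists_isSyzygyMap (p := p) f).choose_spec.mem_projectiveMaps hf))

variable {p}

theorem ΩMap_mk {X Y : ModuleCat.{u} R} {f : X →ₗ[R] Y} {h} (H : p.IsSyzygyMap f h) :
    p.ΩMap X Y (StableHom.mk f) = StableHom.mk h :=
  (exists_isSyzygyMap (p := p) f).choose_spec.mk_eq H rfl

theorem ΩMap_id (X : ModuleCat.{u} R) : p.ΩMap X X (StableHom.id X) = StableHom.id (p.Ω X) :=
  ΩMap_mk (IsSyzygyMap.id X)

theorem ΩMap_comp {X Y Z : ModuleCat.{u} R} (g : StableHom Y Z) (f : StableHom X Y) :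
    p.ΩMap X Z (StableHom.comp g f) = StableHom.comp (p.ΩMap Y Z g) (p.ΩMap X Y f) := by
  obtain ⟨f, rfl⟩ := StableHom.mk_surjective f
  obtain ⟨g, rfl⟩ := StableHom.mk_surjective g
  obtain ⟨h, H⟩ := exists_isSyzygyMap (p := p) f
  obtain ⟨h', H'⟩ := exists_isSyzygyMap (p := p) g
  rw [ΩMap_mk H, ΩMap_mk H', StableHom.comp_mk, StableHom.comp_mk, ΩMap_mk (H'.comp H)]

variable (p)

/-- The iterated syzygy `Ω^i X`. -/
def Ωpow (X : ModuleCat.{u} R) : ℕ → ModuleCat.{u} R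
  | 0 => X
  | i + 1 => p.Ω (Ωpow X i)

/-- The `i`-th syzygy `Ω^i g : Ω^i X → Ω^(j+i) Y` of a stable map `g : X → Ω^j Y`. -/
noncomputable def ΩpowMap {X Y : ModuleCat.{u} R} {j : ℕ} :
    ∀ i : ℕ, StableHom X (p.Ωpow Y j) →ₗ[R] StableHom (p.Ωpow X i) (p.Ωpow Y (j + i))
  | 0 => LinearMap.id
  | i + 1 => p.ΩMap _ _ ∘ₗ ΩpowMap i

/-- The degree `i` component `StableHom(X, Ω^i X)` of the algebra `⨁ StableHom(X, Ω^i X)`. -/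
abbrev Component (X : ModuleCat.{u} R) (i : ℕ) := StableHom X (p.Ωpow X i)

variable {p}

/-- Multiplication is `g * f = Ω^i(g) ∘ f` for `f : X → Ω^i X` and `g : X → Ω^j X`. -/
noncomputable def mulMap {X : ModuleCat.{u} R} {j i : ℕ} :
    p.Component X j →ₗ[R] p.Component X i →ₗ[R] p.Component X (j + i) :=
  StableHom.comp ∘ₗ p.ΩpowMap i

variable (p) in
/-- The unit is the identity of `X`, in degree zero. -/
def oneMap (X : ModuleCat.{u} R) : p.Component X 0 := StableHom.id X

section HEqLemmas

variable {X : ModuleCat.{u} R}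

theorem comp_heq {a b c c' : ℕ} (hc : c = c')
    {g : StableHom (p.Ωpow X b) (p.Ωpow X c)} {g' : StableHom (p.Ωpow X b) (p.Ωpow X c')}
    (hg : g ≍ g') (f : StableHom (p.Ωpow X a) (p.Ωpow X b)) :
    StableHom.comp g f ≍ StableHom.comp g' f := by
  subst hc
  cases hg
  rfl

theorem ΩMap_heq {a b b' : ℕ} (hb : b = b')
    {g : StableHom (p.Ωpow X a) (p.Ωpow X b)} {g' : StableHom (p.Ωpow X a) (p.Ωpow X b')}
    (hg : g ≍ g') : p.ΩMap _ _ g ≍ p.ΩMap _ _ g' := by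
  subst hb
  cases hg
  rfl

theorem smul_heq (r : R) {a b : ℕ} (hab : a = b) {x : p.Component X a} {y : p.Component X b}
    (hxy : x ≍ y) : r • x ≍ r • y := by
  subst hab
  cases hxy
  rfl

theorem ΩpowMap_id (i : ℕ) : p.ΩpowMap i (p.oneMap X) ≍ StableHom.id (p.Ωpow X i) := by
  induction i with
  | zero => rfl
  | succ i ih => exact (ΩMap_heq (Nat.zero_add i) ih).trans (heq_of_eq (ΩMap_id _))

theorem ΩpowMap_mul {j l : ℕ} (h : p.Component X l) (g : p.Component X j) (i : ℕ) :
    p.ΩpowMap i (mulMap h g) ≍ StableHom.comp (p.ΩpowMap (j + i) h) (p.ΩpowMap i g) := by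
  induction i with
  | zero => rfl
  | succ i ih =>
    exact (ΩMap_heq (Nat.add_assoc l j i) ih).trans (heq_of_eq (ΩMap_comp _ _))

theorem one_mulMap {i : ℕ} (f : p.Component X i) : mulMap (p.oneMap X) f ≍ f :=
  (comp_heq (a := 0) (Nat.zero_add i) (ΩpowMap_id i) f).trans (heq_of_eq (StableHom.id_comp f))

theorem mulMap_one {i : ℕ} (f : p.Component X i) : mulMap f (p.oneMap X) = f :=
  StableHom.comp_id (M := X) f

theorem mulMap_assoc {l j i : ℕ} (h : p.Component X l) (g : p.Component X j)
    (f : p.Component X i) : mulMap (mulMap h g) f ≍ mulMap h (mulMap g f) :=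
  (comp_heq (a := 0) (Nat.add_assoc l j i) (ΩpowMap_mul h g i) f).trans
    (heq_of_eq (StableHom.comp_assoc _ _ _))

theorem smul_one_mulMap (r : R) {i : ℕ} (f : p.Component X i) :
    mulMap (r • p.oneMap X) f ≍ r • f := by
  rw [LinearMap.map_smul₂]
  exact smul_heq r (Nat.zero_add i) (one_mulMap f)

theorem mulMap_smul_one (r : R) {i : ℕ} (f : p.Component X i) :
    mulMap f (r • p.oneMap X) = r • f := by
  rw [map_smul, mulMap_one]

end HEqLemmas

noncomputable instance gMonoid (X : ModuleCat.{u} R) : GradedMonoid.GMonoid (p.Component X) :=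
  letI : GradedMonoid.GOne (p.Component X) := ⟨p.oneMap X⟩
  letI : GradedMonoid.GMul (p.Component X) := ⟨fun g f => mulMap g f⟩
  { one_mul := fun ⟨i, f⟩ => Sigma.ext (Nat.zero_add i) (one_mulMap f)
    mul_one := fun ⟨_, f⟩ => Sigma.ext rfl (heq_of_eq (mulMap_one f))
    mul_assoc := fun ⟨l, h⟩ ⟨j, g⟩ ⟨i, f⟩ =>
      Sigma.ext (Nat.add_assoc l j i) (mulMap_assoc h g f) }

noncomputable instance gRing (X : ModuleCat.{u} R) : DirectSum.GRing (p.Component X) where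
  __ := gMonoid X
  mul_zero a := map_zero (mulMap a)
  zero_mul b := LinearMap.map_zero₂ mulMap b
  mul_add a b c := map_add (mulMap a) b c
  add_mul a b c := LinearMap.map_add₂ mulMap a b c
  natCast n := n • p.oneMap X
  natCast_zero := zero_smul ℕ _
  natCast_succ n := (add_smul n 1 (p.oneMap X)).trans (congrArg _ (one_smul ℕ (p.oneMap X)))
  intCast n := n • p.oneMap X
  intCast_ofNat n := natCast_zsmul _ n
  intCast_negSucc_ofNat n := negSucc_zsmul _ n

noncomputable instance gAlgebra (X : ModuleCat.{u} R) :
    DirectSum.GAlgebra R (p.Component X) where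
  toFun := (LinearMap.toSpanSingleton R _ (p.oneMap X)).toAddMonoidHom
  map_one := one_smul R (p.oneMap X)
  map_mul r s := Sigma.ext rfl <| heq_of_eq <|
    (by rw [mul_comm, mul_smul] : (r * s) • p.oneMap X = s • r • p.oneMap X).trans (mulMap_smul_one s (r • p.oneMap X)).symm
  commutes := fun r ⟨i, f⟩ => Sigma.ext (Nat.add_comm 0 i)
    ((smul_one_mulMap r f).trans (heq_of_eq (mulMap_smul_one r f).symm))
  smul_def := fun r ⟨i, f⟩ => Sigma.ext (Nat.zero_add i).symm (smul_one_mulMap r f).symm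

/-- The `R`-algebra `⨁_{i ≥ 0} StableHom(X, Ω^i X)`. -/
abbrev SyzygyAlgebra (p : ProjectivePresentations R) (X : ModuleCat.{u} R) : Type u :=
  DirectSum ℕ (p.Component X)

end ProjectivePresentations

end Stable

/-! ## Veronese subrings -/

section Veronese

open MvPolynomial

/-- The weight on the variables which gives a monomial its total degree modulo `n`. -/
def degMod (d n : ℕ) : Fin d → ZMod n := fun _ => 1

/-- The `n`-th Veronese subring `R` of `k[x_1, …, x_d]`: the polynomials all of whose monomials
have total degree divisible by `n`. -/
def veronese (k : Type u) [Field k] (d n : ℕ) : Subalgebra k (MvPolynomial (Fin d) k) where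
  carrier := {f | IsWeightedHomogeneous (degMod d n) f 0}
  mul_mem' hf hg := by simpa using IsWeightedHomogeneous.mul hf hg
  add_mem' hf hg := IsWeightedHomogeneous.add hf hg
  algebraMap_mem' r := isWeightedHomogeneous_C (degMod d n) r

theorem weightedHomogeneousComponent_veronese_mul {k : Type u} [Field k] {d n : ℕ}
    (i : ZMod n) (r : veronese k d n) (f : MvPolynomial (Fin d) k) :
    weightedHomogeneousComponent (degMod d n) i (r.1 * f) =
      r.1 * weightedHomogeneousComponent (degMod d n) i f := by
  classical
  ext m
  rw [coeff_weightedHomogeneousComponent, coeff_mul, coeff_mul]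
  have key : ∀ x ∈ Finset.HasAntidiagonal.antidiagonal m,
      coeff x.1 r.1 * coeff x.2 (weightedHomogeneousComponent (degMod d n) i f) =
        if Finsupp.weight (degMod d n) m = i then coeff x.1 r.1 * coeff x.2 f else 0 := by
    rintro ⟨a, b⟩ hab
    rw [Finset.HasAntidiagonal.mem_antidiagonal] at hab
    rw [coeff_weightedHomogeneousComponent]
    by_cases ha : coeff a r.1 = 0
    · simp [ha]
    · have h0 : Finsupp.weight (degMod d n) a = 0 := r.2 ha
      have : Finsupp.weight (degMod d n) m = Finsupp.weight (degMod d n) b := by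
        rw [← hab, map_add, h0, zero_add]
      simp [this]
  rw [Finset.sum_congr rfl key]
  split_ifs <;> simp

/-- The polynomial ring `S`, as a module over its Veronese subring. -/
noncomputable abbrev polyModule (k : Type u) [Field k] (d n : ℕ) : ModuleCat.{u} (veronese k d n) :=
  ModuleCat.of (veronese k d n) (MvPolynomial (Fin d) k)

/-- The projection of `S = M_0 ⊕ ⋯ ⊕ M_{n-1}` onto `M_i`, as an endomorphism of the module `S`;
`M_i` is spanned by the monomials of degree congruent to `i` modulo `n`. -/
noncomputable def projM (k : Type u) [Field k] (d n i : ℕ) :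
    polyModule k d n →ₗ[veronese k d n] polyModule k d n where
  toFun f := weightedHomogeneousComponent (degMod d n) (i : ZMod n) (f : MvPolynomial (Fin d) k)
  map_add' f g := map_add (weightedHomogeneousComponent (degMod d n) (i : ZMod n)) f g
  map_smul' r f := weightedHomogeneousComponent_veronese_mul (i : ZMod n) r f

/-- The endomorphism of `S` which is zero on `M_j` for `j ≠ i` and which is multiplication by
the variable `x_s`, from `M_i` to `M_{i+1}`, on `M_i`. -/
noncomputable def mulXM (k : Type u) [Field k] (d n i : ℕ) (s : Fin d) :
    polyModule k d n →ₗ[veronese k d n] polyModule k d n :=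
  LinearMap.mulLeft (veronese k d n) (X s : MvPolynomial (Fin d) k) ∘ₗ projM k d n i

/-- The algebra `Γ = ⨁_{i ≥ 0} StableHom_R(S, Ω^i S)`. -/
def Gamma (k : Type u) [Field k] (d n : ℕ) (p : ProjectivePresentations (veronese k d n)) :
    Type u :=
  p.SyzygyAlgebra (polyModule k d n)

noncomputable instance (k : Type u) [Field k] (d n : ℕ)
    (p : ProjectivePresentations (veronese k d n)) : Ring (Gamma k d n p) :=
  inferInstanceAs (Ring (p.SyzygyAlgebra (polyModule k d n)))

/-- `Γ` is a `k`-algebra through `k → R`. -/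
noncomputable instance (k : Type u) [Field k] (d n : ℕ)
    (p : ProjectivePresentations (veronese k d n)) : Algebra k (Gamma k d n p) :=
  Algebra.compHom (p.SyzygyAlgebra (polyModule k d n)) (algebraMap k (veronese k d n))

/-- The inclusion of the degree `i` component `StableHom_R(S, Ω^i S)` into `Γ`. -/
noncomputable def Gamma.of {k : Type u} [Field k] {d n : ℕ}
    (p : ProjectivePresentations (veronese k d n)) (i : ℕ) :
    p.Component (polyModule k d n) i →+ Gamma k d n p :=
  DirectSum.of (p.Component (polyModule k d n)) i

/-- The element of degree zero of `Γ` given by an endomorphism of the module `S`. -/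
noncomputable def Gamma.ofEnd {k : Type u} [Field k] {d n : ℕ}
    (p : ProjectivePresentations (veronese k d n))
    (f : polyModule k d n →ₗ[veronese k d n] polyModule k d n) : Gamma k d n p :=
  Gamma.of p 0 (StableHom.mk f)

end Veronese

/-! ## The quiver and the relations -/

section Quiver

/-- The vertices `1, …, n - 1` of the quiver `Q` (whose arrows also depend on `d`). -/
def QVertex (_d n : ℕ) : Type := Finset.Ico 1 n

instance (d n : ℕ) : Fintype (QVertex d n) := inferInstanceAs (Fintype (Finset.Ico 1 n))

/-- The arrows of `Q`: the arrows `x_s : i → i + 1`, and the arrows `x_{st} : n - 1 → 1` for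
`s < t`. -/
inductive QArrow (d n : ℕ) : QVertex d n → QVertex d n → Type
  | x {i j : QVertex d n} (h : j.1 = i.1 + 1) (s : Fin d) : QArrow d n i j
  | xx {i j : QVertex d n} (hi : i.1 + 1 = n) (hj : j.1 = 1) (s t : Fin d) (hst : s < t) :
      QArrow d n i j

instance (d n : ℕ) : Quiver (QVertex d n) := ⟨QArrow d n⟩

variable (k : Type u) [Field k] {d n : ℕ}

/-- The arrow `x_s : i → j`, where `j = i + 1`, in the path algebra. -/
noncomputable def arrowX {i j : QVertex d n} (h : j.1 = i.1 + 1) (s : Fin d) :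
    PathAlgebra k (QVertex d n) :=
  PathAlgebra.arrow k (a := i) (b := j) (QArrow.x h s)

/-- The arrow `x_{st} : i → j`, where `i = n - 1` and `j = 1`, in the path algebra. -/
noncomputable def arrowXX {i j : QVertex d n} (hi : i.1 + 1 = n) (hj : j.1 = 1) {s t : Fin d}
    (hst : s < t) : PathAlgebra k (QVertex d n) :=
  PathAlgebra.arrow k (a := i) (b := j) (QArrow.xx hi hj s t hst)

/-- The relations of `Γ`. Products of arrows are read from right to left. -/
inductive QRel : PathAlgebra k (QVertex d n) → PathAlgebra k (QVertex d n) → Prop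
  /-- `x_s x_t = x_t x_s` from `i` to `i + 2` -/
  | comm {i j l : QVertex d n} (hij : j.1 = i.1 + 1) (hjl : l.1 = j.1 + 1) {s t : Fin d}
      (_hst : s < t) :
      QRel (arrowX k hjl s * arrowX k hij t) (arrowX k hjl t * arrowX k hij s)
  /-- `x_s x_{tu} - x_t x_{su} + x_u x_{st} = 0` from `n - 1` to `2` -/
  | left {m i j : QVertex d n} (hm : m.1 + 1 = n) (hi : i.1 = 1) (hij : j.1 = i.1 + 1)
      {s t u : Fin d} (hst : s < t) (htu : t < u) :
      QRel
        (arrowX k hij s * arrowXX k hm hi htu - arrowX k hij t * arrowXX k hm hi (hst.trans htu)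
          + arrowX k hij u * arrowXX k hm hi hst) 0
  /-- `x_{st} x_u - x_{su} x_t + x_{tu} x_s = 0` from `n - 2` to `1` -/
  | right {l m i : QVertex d n} (hlm : m.1 = l.1 + 1) (hm : m.1 + 1 = n) (hi : i.1 = 1)
      {s t u : Fin d} (hst : s < t) (htu : t < u) :
      QRel
        (arrowXX k hm hi hst * arrowX k hlm u - arrowXX k hm hi (hst.trans htu) * arrowX k hlm t
          + arrowXX k hm hi htu * arrowX k hlm s) 0
  /-- if `n = 2`:
  `x_{uv} x_{st} - x_{tv} x_{su} + x_{tu} x_{sv} + x_{sv} x_{tu} - x_{su} x_{tv} + x_{st} x_{uv} = 0`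
  at the only vertex `i = 1` -/
  | quad {i : QVertex d n} (_hn : n = 2) (hm : i.1 + 1 = n) (hi : i.1 = 1)
      {s t u v : Fin d} (hst : s < t) (htu : t < u) (huv : u < v) :
      QRel
        (arrowXX k hm hi huv * arrowXX k hm hi hst
          - arrowXX k hm hi (htu.trans huv) * arrowXX k hm hi (hst.trans htu)
          + arrowXX k hm hi htu * arrowXX k hm hi (hst.trans (htu.trans huv))
          + arrowXX k hm hi (hst.trans (htu.trans huv)) * arrowXX k hm hi htu
          - arrowXX k hm hi (hst.trans htu) * arrowXX k hm hi (htu.trans huv)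
          + arrowXX k hm hi hst * arrowXX k hm hi huv) 0

/-- The path algebra of `Q` modulo the two-sided ideal generated by the relations. -/
abbrev QuiverAlgebra (k : Type u) [Field k] (d n : ℕ) : Type u :=
  RingQuot (QRel k (d := d) (n := n))

/-- The image of an element of the path algebra in the quotient. -/
noncomputable def QuiverAlgebra.mk : PathAlgebra k (QVertex d n) →ₐ[k] QuiverAlgebra k d n :=
  RingQuot.mkAlgHom k (QRel k)

end Quiver

/-!
The degree `l` part of `Γ` is computed from a resolution of `S` over the Veronese subring `R` which
is realised inside one polynomial ring, with variables `X (a, s)`, where `a : ℕ` is a row and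
`s : Fin d` a letter. A polynomial in the rows `0, …, l` stands for an element of the `(l + 1)`-fold
tensor power of `S` over `k`, and `mergeRows a` multiplies the factors `a` and `a + 1`. For `l > 0`
the `l`-th syzygy of `S` (`syzygy k d n 0 l`) consists of the polynomials whose row `0` has degree
divisible by `n`, whose rows `1, …, l - 1` have degree `n`, whose row `l` has degree less than `n`,
and which are killed by all `mergeRows a` with `a < l`. If the last condition is dropped for `a =
0`, one gets `R` tensored over `k` with the space of generators of the previous syzygy, a free
module (`syzygy_one_projective`), and `mergeRows 0` is the covering map.

An arrow `x_s` acts on the last row by multiplication with `X (l, s)`, and an arrow `x_{st}` by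
multiplication with the minor `X (l, t) X (l + 1, s) - X (l, s) X (l + 1, t)`. These are chain maps
(`Multiplier.isLift`), so the product of `Γ` becomes the product of polynomials
(`resolutionClass_mul`), whatever presentations define `Ω`: the concrete resolution is stably
equivalent to the chosen one (`comparison`). A path thus gives the polynomial `pathPoly`, the
product of variables and minors, and the relations hold since they are identities between such
polynomials (`pathAlgHom_eq_of_rel`).

A path is standard if the word of its letters, where `x_{st}` contributes `t s`, descends only
inside the arrows `x_{st}`. Two facts carry the proof. The relations rewrite every path as a
combination of standard ones (`pathClass_mem_span_standard`). With respect to the weight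
`rowWeight`, the polynomial of a path has a leading monomial, from which a standard path can be read
off (`eq_of_leadingMon_eq`), so the polynomials of standard paths are linearly independent
(`eq_zero_of_sum_pathPoly_eq_zero`); and conversely a monomial of least weight of a cycle has a
descent between any two consecutive rows (`exists_descent`), hence is the leading monomial of a
path (`exists_leadingMon`). Therefore the cycles are spanned by polynomials of paths up to factors
in row zero (`cycles_le_span`). This gives surjectivity of the covering maps.

As `M_i` has rank one and `d ≥ 2`, each map from `M_i` to a syzygy is multiplication by a cycle
(`exists_eq_mul`), that is, by a combination of multiples of polynomials of paths. Proper multiples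
factor through `R` (`gammaMap_eq_zero`), which proves surjectivity. A map which factors through a
projective module sends `x_s ^ i` to polynomials whose degree in row zero is larger than for any
combination of paths (`le_row_zero_of_mem_projectiveMaps`), which proves injectivity.
-/

open MvPolynomial

/-! ### Polynomials in rows -/

section RowPolynomials

variable {k : Type u} [Field k] {d : ℕ}

/-- Polynomials in variables `X (a, s)`, arranged in rows `a : ℕ` of `d` letters each. A polynomial
which involves only the rows `0, …, l` is an element of the `(l + 1)`-fold tensor power over `k` of
the polynomial ring in `d` variables. -/
abbrev RowPoly (k : Type u) [Field k] (d : ℕ) : Type u := MvPolynomial (ℕ × Fin d) k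

theorem forall_mem_support_mul {σ : Type*} {A B C : (σ →₀ ℕ) → Prop} {f g : MvPolynomial σ k}
    (hf : ∀ w ∈ f.support, A w) (hg : ∀ w ∈ g.support, B w)
    (h : ∀ v w, A v → B w → C (v + w)) : ∀ w ∈ (f * g).support, C w := by
  classical
  intro w hw
  obtain ⟨v, hv, v', hv', rfl⟩ := Finset.mem_add.1 (support_mul f g hw)
  exact h v v' (hf v hv) (hg v' hv')

/-- The degree of a monomial in the variables of row `a`. -/
def row (a : ℕ) : (ℕ × Fin d →₀ ℕ) →+ ℕ where
  toFun w := ∑ s, w (a, s)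
  map_zero' := by simp
  map_add' v w := by simp [Finset.sum_add_distrib]

theorem row_apply (a : ℕ) (w : ℕ × Fin d →₀ ℕ) : row a w = ∑ s, w (a, s) := rfl

theorem row_single (a b : ℕ) (s : Fin d) (m : ℕ) :
    row a (Finsupp.single (b, s) m) = if b = a then m else 0 := by
  classical
  rw [row_apply]
  by_cases h : b = a
  · subst h
    rw [Finset.sum_eq_single s] <;> simp +contextual [eq_comm]
  · simp [h]

theorem apply_le_row (a : ℕ) (s : Fin d) (w : ℕ × Fin d →₀ ℕ) : w (a, s) ≤ row a w :=
  Finset.single_le_sum (f := fun s => w (a, s)) (fun _ _ => Nat.zero_le _) (Finset.mem_univ s)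

theorem exists_pos_of_row_pos {a : ℕ} {w : ℕ × Fin d →₀ ℕ} (h : 0 < row a w) :
    ∃ s, 0 < w (a, s) := by
  by_contra! h'
  rw [row_apply, Finset.sum_eq_zero (fun s _ => Nat.le_zero.1 (h' s))] at h
  exact lt_irrefl _ h

/-- The map of row indices which identifies the rows `a` and `a + 1`, and moves the later rows down
by one. -/
def merge (a b : ℕ) : ℕ := if b ≤ a then b else b - 1

/-- Multiplication of the tensor factors `a` and `a + 1`. -/
noncomputable def mergeRows (a : ℕ) : RowPoly k d →ₐ[k] RowPoly k d :=
  rename (Prod.map (merge a) id)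

/-- The substitution moving each row up by one. -/
noncomputable def shiftRows : RowPoly k d →ₐ[k] RowPoly k d :=
  rename (Prod.map Nat.succ id)

/-- The embedding of the polynomial ring as the polynomials in row zero. -/
noncomputable def toRowZero : MvPolynomial (Fin d) k →ₐ[k] RowPoly k d :=
  rename (Prod.mk 0)

theorem mergeRows_X (a b : ℕ) (s : Fin d) :
    mergeRows (k := k) a (X (b, s)) = X (merge a b, s) := by
  simp [mergeRows]

theorem mergeRows_mergeRows_zero (a : ℕ) (z : RowPoly k d) :
    mergeRows a (mergeRows 0 z) = mergeRows 0 (mergeRows (a + 1) z) := by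
  rw [mergeRows, mergeRows, mergeRows, rename_rename, rename_rename]
  congr 2
  funext ⟨b, s⟩
  simp only [Function.comp, Prod.map, id, merge, Prod.mk.injEq, and_true]
  split_ifs <;> omega

theorem mergeRows_zero_shiftRows (z : RowPoly k d) : mergeRows 0 (shiftRows z) = z := by
  rw [mergeRows, shiftRows, rename_rename]
  exact rename_id_apply z

theorem mergeRows_succ_shiftRows (a : ℕ) (z : RowPoly k d) :
    mergeRows (a + 1) (shiftRows z) = shiftRows (mergeRows a z) := by
  rw [mergeRows, mergeRows, shiftRows, rename_rename, rename_rename]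
  congr 2
  funext ⟨b, s⟩
  simp only [Function.comp, Prod.map, id, merge, Prod.mk.injEq, and_true]
  split_ifs <;> omega

theorem mergeRows_toRowZero (a : ℕ) (f : MvPolynomial (Fin d) k) :
    mergeRows a (toRowZero f) = toRowZero f := by
  rw [mergeRows, toRowZero, rename_rename]
  rfl

theorem toRowZero_injective : Function.Injective (toRowZero (k := k) (d := d)) :=
  rename_injective _ (Prod.mk_right_injective 0)

theorem mapDomain_merge_apply (a : ℕ) (w : ℕ × Fin d →₀ ℕ) (b : ℕ) (s : Fin d) :
    Finsupp.mapDomain (Prod.map (merge a) id) w (b, s) =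
      if b < a then w (b, s) else if b = a then w (a, s) + w (a + 1, s) else w (b + 1, s) := by
  classical
  induction w using Finsupp.induction_linear with
  | zero => simp
  | add f g hf hg =>
    rw [Finsupp.mapDomain_add, Finsupp.add_apply, hf, hg]
    split_ifs <;> simp only [Finsupp.add_apply]
    omega
  | single p m =>
    obtain ⟨c, t⟩ := p
    simp only [Finsupp.mapDomain_single, Finsupp.single_apply, Prod.map, id, merge, Prod.mk.injEq]
    by_cases ht : t = s
    · simp only [ht, and_true]
      split_ifs <;> omega
    · simp [ht]

theorem row_mapDomain_merge (a b : ℕ) (w : ℕ × Fin d →₀ ℕ) :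
    row b (Finsupp.mapDomain (Prod.map (merge a) id) w) =
      if b < a then row b w else if b = a then row a w + row (a + 1) w else row (b + 1) w := by
  simp only [row_apply, mapDomain_merge_apply]
  split_ifs <;> simp [Finset.sum_add_distrib]

theorem mapDomain_succ_apply (w : ℕ × Fin d →₀ ℕ) (b : ℕ) (s : Fin d) :
    Finsupp.mapDomain (Prod.map Nat.succ id) w (b, s) =
      if b = 0 then 0 else w (b - 1, s) := by
  classical
  induction w using Finsupp.induction_linear with
  | zero => simp
  | add f g hf hg =>
    rw [Finsupp.mapDomain_add, Finsupp.add_apply, hf, hg]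
    split_ifs <;> simp
  | single p m =>
    obtain ⟨c, t⟩ := p
    simp only [Finsupp.mapDomain_single, Finsupp.single_apply, Prod.map, id, Prod.mk.injEq,
      Nat.succ_eq_add_one]
    by_cases ht : t = s
    · simp only [ht, and_true]
      split_ifs <;> omega
    · simp [ht]

theorem row_mapDomain_succ (b : ℕ) (w : ℕ × Fin d →₀ ℕ) :
    row b (Finsupp.mapDomain (Prod.map Nat.succ id) w) = if b = 0 then 0 else row (b - 1) w := by
  simp only [row_apply, mapDomain_succ_apply]
  split_ifs <;> simp

theorem row_mapDomain_zero (b : ℕ) (w : Fin d →₀ ℕ) :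
    row b (Finsupp.mapDomain (Prod.mk 0) w) = if b = 0 then w.degree else 0 := by
  induction w using Finsupp.induction_linear with
  | zero => simp
  | add f g hf hg =>
    rw [Finsupp.mapDomain_add, map_add, hf, hg, map_add]
    split_ifs <;> rfl
  | single p m =>
    rw [Finsupp.mapDomain_single, row_single, Finsupp.degree_single]
    simp [eq_comm]

theorem exists_of_mem_support_rename {σ τ : Type*} {f : σ → τ} {z : MvPolynomial σ k} {w}
    (h : w ∈ (rename f z).support) : ∃ v ∈ z.support, Finsupp.mapDomain f v = w := by
  rw [mem_support_iff] at h
  obtain ⟨v, hv, h'⟩ := coeff_rename_ne_zero f z w h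
  exact ⟨v, mem_support_iff.2 h', hv⟩

/-- If a substitution of variables kills `z`, then each monomial of `z` has the same image as
another one. -/
theorem exists_ne_of_rename_eq_zero {σ τ : Type*} {f : σ → τ} {z : MvPolynomial σ k}
    (hz : rename f z = 0) {w} (hw : w ∈ z.support) :
    ∃ v ∈ z.support, v ≠ w ∧ Finsupp.mapDomain f v = Finsupp.mapDomain f w := by
  classical
  by_contra! h
  have h1 : coeff (Finsupp.mapDomain f w) (rename f z) = coeff w z := by
    conv_lhs => rw [z.as_sum]
    rw [map_sum, coeff_sum, Finset.sum_eq_single w]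
    · rw [rename_monomial, coeff_monomial, if_pos rfl]
    · intro v hv hvw
      rw [rename_monomial, coeff_monomial, if_neg (h v hv hvw)]
    · intro h'
      exact absurd hw h'
  rw [hz, coeff_zero] at h1
  exact mem_support_iff.1 hw h1.symm

/-- The weight of a monomial: a letter `s` in row `a` counts `a * s`. -/
noncomputable def rowWeight : (ℕ × Fin d →₀ ℕ) →+ ℕ :=
  Finsupp.weight fun p : ℕ × Fin d => p.1 * (p.2 : ℕ)

theorem rowWeight_single (a : ℕ) (s : Fin d) (m : ℕ) :
    rowWeight (Finsupp.single (a, s) m) = m * (a * (s : ℕ)) := by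
  rw [rowWeight, Finsupp.weight_single, smul_eq_mul]

/-- If the multiplication of the rows `a` and `a + 1` kills `z`, then a monomial of least weight of
`z` has a descent between these rows: among the monomials with the same image and the same degree in
row `a`, the one whose row `a` takes the smallest letters has the largest weight, strictly. -/
theorem exists_descent {z : RowPoly k d} {a : ℕ} (hz : mergeRows a z = 0) {w : ℕ × Fin d →₀ ℕ}
    (hw : w ∈ z.support) (hmin : ∀ v ∈ z.support, rowWeight w ≤ rowWeight v)
    (hrow : ∀ v ∈ z.support, Finsupp.mapDomain (Prod.map (merge a) id) v =
      Finsupp.mapDomain (Prod.map (merge a) id) w → row a v = row a w) :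
    ∃ s t : Fin d, s < t ∧ 0 < w (a, t) ∧ 0 < w (a + 1, s) := by
  classical
  by_contra! hno
  obtain ⟨v, hv, hvw, hm⟩ := exists_ne_of_rename_eq_zero hz hw
  have hr := hrow v hv hm
  have hle := hmin v hv
  have happ : ∀ b s, _ := fun b s => DFunLike.congr_fun hm (b, s)
  simp only [mapDomain_merge_apply] at happ
  have hsum : ∀ s, v (a, s) + v (a + 1, s) = w (a, s) + w (a + 1, s) := fun s => by
    simpa using happ a s
  have hother : ∀ b s, b ≠ a → b ≠ a + 1 → v (b, s) = w (b, s) := by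
    intro b s h1 h2
    rcases lt_or_gt_of_ne h1 with h | h
    · simpa [h] using happ b s
    · have := happ (b - 1) s
      rw [if_neg (by omega), if_neg (by omega), if_neg (by omega), if_neg (by omega)] at this
      rwa [show b - 1 + 1 = b by omega] at this
  -- the largest letter of `w` in row `a`, which is at most every letter of row `a + 1`
  let c : ℕ := (Finset.univ.filter fun t : Fin d => 0 < w (a, t)).sup fun t => (t : ℕ)
  have hc1 : ∀ t : Fin d, 0 < w (a, t) → (t : ℕ) ≤ c := fun t ht =>
    Finset.le_sup (f := fun t : Fin d => (t : ℕ)) (by simpa using ht)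
  have hc2 : ∀ s : Fin d, 0 < w (a + 1, s) → c ≤ s := fun s hs =>
    Finset.sup_le fun t ht => by
      by_contra hlt
      have := hno s t (by simpa using hlt) (by simpa using ht)
      omega
  -- the part of a monomial in one row
  let part : ℕ → (ℕ × Fin d →₀ ℕ) → (ℕ × Fin d →₀ ℕ) := fun b u =>
    ∑ s, Finsupp.single (b, s) (u (b, s))
  have hpart : ∀ b u b' s, part b u (b', s) = if b' = b then u (b, s) else 0 := by
    intro b u b' s
    simp only [part, Finsupp.finsetSum_apply, Finsupp.single_apply, Prod.mk.injEq]
    by_cases h : b' = b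
    · subst h; simp
    · simp [h, Ne.symm h]
  have hpw : ∀ b u, rowWeight (part b u) = ∑ s, u (b, s) * (b * (s : ℕ)) := by
    intro b u
    simp only [part, map_sum, rowWeight_single]
  have hdec : v + part a w + part (a + 1) w = w + part a v + part (a + 1) v := by
    ext ⟨b, s⟩
    simp only [Finsupp.add_apply, hpart]
    by_cases h1 : b = a
    · subst h1; simp; omega
    by_cases h2 : b = a + 1
    · subst h2; simp; omega
    · simp [h1, h2, hother b s h1 h2]
  have hdw := congrArg rowWeight hdec
  simp only [map_add, hpw] at hdw
  let D : Fin d → ℤ := fun s => (v (a, s) : ℤ) - w (a, s)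
  have hDsum : ∑ s, D s = 0 := by
    simp only [D, Finset.sum_sub_distrib]
    rw [row_apply, row_apply] at hr
    exact_mod_cast sub_eq_zero.2 (congrArg (Nat.cast : ℕ → ℤ) hr)
  have hDle : ∑ s, D s * (s : ℤ) ≤ 0 := by
    have e1 : (rowWeight v : ℤ) - rowWeight w = - ∑ s, D s * (s : ℤ) := by
      have e2 : (rowWeight v : ℤ) - rowWeight w =
          (∑ s, v (a, s) * (a * (s : ℕ)) : ℕ) + (∑ s, v (a + 1, s) * ((a + 1) * (s : ℕ)) : ℕ)
          - ((∑ s, w (a, s) * (a * (s : ℕ)) : ℕ) + (∑ s, w (a + 1, s) * ((a + 1) * (s : ℕ)) : ℕ))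
          := by
        omega
      rw [e2]
      push_cast
      rw [← Finset.sum_add_distrib, ← Finset.sum_add_distrib, ← Finset.sum_sub_distrib,
        ← Finset.sum_neg_distrib]
      refine Finset.sum_congr rfl fun s _ => ?_
      have : (v (a + 1, s) : ℤ) = w (a, s) + w (a + 1, s) - v (a, s) := by
        have := hsum s; omega
      rw [this]
      simp only [D]
      ring
    have : (rowWeight w : ℤ) ≤ rowWeight v := by exact_mod_cast hle
    linarith
  -- without a descent, `w` has no letter below `c` in row `a + 1` and none above `c` in row `a`
  have hterm : ∀ s ∈ Finset.univ, 0 ≤ D s * ((s : ℤ) - c) := by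
    intro s _
    rcases lt_trichotomy (s : ℕ) c with h | h | h
    · have h1 : w (a + 1, s) = 0 := by
        by_contra h'; have := hc2 s (by omega); omega
      have := hsum s
      exact mul_nonneg_of_nonpos_of_nonpos (by simp only [D]; omega) (by omega)
    · simp [h]
    · have h1 : w (a, s) = 0 := by
        by_contra h'; have := hc1 s (by omega); omega
      exact mul_nonneg (by simp only [D]; omega) (by omega)
  have hzero : ∑ s, D s * ((s : ℤ) - c) = 0 := by
    refine le_antisymm ?_ (Finset.sum_nonneg hterm)
    simp only [mul_sub, Finset.sum_sub_distrib, ← Finset.sum_mul, hDsum]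
    simpa using hDle
  have hD0 : ∀ s, D s = 0 := by
    have h1 : ∀ s : Fin d, (s : ℕ) ≠ c → D s = 0 := by
      intro s hs
      have := (Finset.sum_eq_zero_iff_of_nonneg hterm).1 hzero s (Finset.mem_univ s)
      rcases mul_eq_zero.1 this with h | h
      · exact h
      · omega
    intro s
    by_cases hs : (s : ℕ) = c
    · rw [← hDsum, Finset.sum_eq_single s]
      · intro t _ hts
        exact h1 t fun h => hts (Fin.ext (h.trans hs.symm))
      · simp
    · exact h1 s hs
  apply hvw
  ext ⟨b, s⟩
  have h1 := hD0 s
  have h2 := hsum s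
  simp only [D] at h1
  by_cases hb : b = a
  · subst hb; omega
  by_cases hb' : b = a + 1
  · subst hb'; omega
  exact hother b s hb hb'

end RowPolynomials

/-! ### Paths and their polynomials -/

section Paths

variable {d n : ℕ}

namespace QArrow

/-- The number of rows by which an arrow advances: this is also its degree in `Γ`. -/
def crossing {i j : QVertex d n} : QArrow d n i j → ℕ
  | x _ _ => 0
  | xx _ _ _ _ _ => 1

/-- The number of letters of an arrow. -/
def length {i j : QVertex d n} : QArrow d n i j → ℕ
  | x _ _ => 1
  | xx _ _ _ _ _ => 2

/-- The first letter of an arrow: the arrow `x_{st}` is read as the word `t s`. -/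
def first {i j : QVertex d n} : QArrow d n i j → ℕ
  | x _ s => s
  | xx _ _ _ t _ => t

/-- The last letter of an arrow. -/
def last {i j : QVertex d n} : QArrow d n i j → ℕ
  | x _ s => s
  | xx _ _ s _ _ => s

/-- The sum of the letters of an arrow, each multiplied by its position, where the first letter has
position `L`. -/
def positionWeight {i j : QVertex d n} (L : ℕ) : QArrow d n i j → ℕ
  | x _ s => L * s
  | xx _ _ s t _ => L * t + (L + 1) * s

/-- The leading monomial of an arrow which starts in row `l`. -/
noncomputable def leadingMon {i j : QVertex d n} (l : ℕ) : QArrow d n i j → (ℕ × Fin d →₀ ℕ)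
  | x _ s => Finsupp.single (l, s) 1
  | xx _ _ s t _ => Finsupp.single (l, t) 1 + Finsupp.single (l + 1, s) 1

/-- The polynomial of an arrow which starts in row `l`: a variable for `x_s`, and a `2 × 2` minor
of the rows `l` and `l + 1` for `x_{st}`. -/
noncomputable def poly (k : Type u) [Field k] {i j : QVertex d n} (l : ℕ) :
    QArrow d n i j → RowPoly k d
  | x _ s => X (l, s)
  | xx _ _ s t _ => X (l, t) * X (l + 1, s) - X (l, s) * X (l + 1, t)

end QArrow

/-- The number of arrows `x_{st}` in a path. -/
def crossings {i : QVertex d n} : ∀ {j : QVertex d n}, Quiver.Path i j → ℕ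
  | _, .nil => 0
  | _, .cons p e => crossings p + QArrow.crossing e

/-- The number of letters of a path. -/
def letters {i : QVertex d n} : ∀ {j : QVertex d n}, Quiver.Path i j → ℕ
  | _, .nil => 0
  | _, .cons p e => letters p + QArrow.length e

/-- The last letter of a path, with value zero for the trivial path, so that every
path of length one is standard. -/
def lastLetter {i : QVertex d n} : ∀ {j : QVertex d n}, Quiver.Path i j → ℕ
  | _, .nil => 0
  | _, .cons _ e => QArrow.last e

/-- The sum of all the letters of a path, each multiplied by its position. -/
def positionWeight {i : QVertex d n} : ∀ {j : QVertex d n}, Quiver.Path i j → ℕ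
  | _, .nil => 0
  | _, .cons p e => positionWeight p + QArrow.positionWeight (letters p) e

/-- A path is standard if for each pair of consecutive arrows the last letter of the first arrow is
at most the first letter of the second one. -/
def Standard {i : QVertex d n} : ∀ {j : QVertex d n}, Quiver.Path i j → Prop
  | _, .nil => True
  | _, .cons p e => Standard p ∧ lastLetter p ≤ QArrow.first e

/-- The leading monomial of the polynomial of a path. -/
noncomputable def leadingMon {i : QVertex d n} :
    ∀ {j : QVertex d n}, Quiver.Path i j → (ℕ × Fin d →₀ ℕ)
  | _, .nil => 0
  | _, .cons p e => leadingMon p + QArrow.leadingMon (crossings p) e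

/-- The polynomial of a path: the product of the polynomials of its arrows, where each arrow
`x_{st}` leads from one row to the next one. -/
noncomputable def pathPoly (k : Type u) [Field k] {i : QVertex d n} :
    ∀ {j : QVertex d n}, Quiver.Path i j → RowPoly k d
  | _, .nil => 1
  | _, .cons p e => pathPoly k p * QArrow.poly k (crossings p) e

theorem QVertex.pos (i : QVertex d n) : 1 ≤ i.1 := (Finset.mem_Ico.1 i.2).1

theorem QVertex.lt (i : QVertex d n) : i.1 < n := (Finset.mem_Ico.1 i.2).2

/-- The row degrees of a path from `i` to `j` with `l` crossings: `n - i` in row zero, `n` in the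
rows between, and `j` in row `l`; for `l = 0` the only row has degree `j - i`. -/
theorem row_leadingMon {i j : QVertex d n} (p : Quiver.Path i j) (a : ℕ) :
    row a (leadingMon p) + (if a = 0 then i.1 else 0) =
      if a < crossings p then n else if a = crossings p then j.1 else 0 := by
  induction p with
  | nil =>
    have key : 0 + (if a = 0 then i.1 else 0) = if a < 0 then n else if a = 0 then i.1 else 0 := by
      simp
    rw [leadingMon, map_zero]
    exact key
  | @cons b c p e ih =>
    have hc := c.pos
    rcases e with ⟨h, s⟩ | ⟨hi, hj, s, t, hst⟩
    · have key : ∀ l r : ℕ, r + (if a = 0 then i.1 else 0) =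
          (if a < l then n else if a = l then b.1 else 0) →
          r + (if l = a then 1 else 0) + (if a = 0 then i.1 else 0) =
          if a < l + 0 then n else if a = l + 0 then c.1 else 0 := by
        grind
      rw [leadingMon, QArrow.leadingMon, map_add, row_single]
      exact key _ _ ih
    · have key : ∀ l r : ℕ, r + (if a = 0 then i.1 else 0) =
          (if a < l then n else if a = l then b.1 else 0) →
          r + ((if l = a then 1 else 0) + if l + 1 = a then 1 else 0) +
            (if a = 0 then i.1 else 0) =
          if a < l + 1 then n else if a = l + 1 then c.1 else 0 := by
        grind
      rw [leadingMon, QArrow.leadingMon, map_add, map_add, row_single, row_single]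
      exact key _ _ ih

variable (k : Type u) [Field k]

theorem QArrow.row_of_mem_support_poly {i j : QVertex d n} (l : ℕ) (e : QArrow d n i j) :
    ∀ w ∈ (e.poly k l).support, ∀ a, row a w = row a (e.leadingMon l) := by
  classical
  rcases e with ⟨h, s⟩ | ⟨hi, hj, s, t, hst⟩
  · intro w hw a
    simp only [poly, support_X, Finset.mem_singleton] at hw
    simp [hw, leadingMon]
  · intro w hw a
    simp only [poly] at hw
    rw [X, X, X, X, monomial_mul, monomial_mul] at hw
    rcases Finset.mem_union.1 (support_sub _ _ _ hw) with h | h <;>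
    · rw [Finset.mem_singleton.1 (support_monomial_subset h)]
      simp only [leadingMon, map_add, row_single]

theorem row_of_mem_support_pathPoly {i j : QVertex d n} (p : Quiver.Path i j) :
    ∀ w ∈ (pathPoly k p).support, ∀ a, row a w = row a (leadingMon p) := by
  induction p with
  | nil =>
    intro w hw a
    rw [pathPoly, support_one, Finset.mem_singleton] at hw
    rw [hw, leadingMon]
  | cons p e ih =>
    refine forall_mem_support_mul ih (QArrow.row_of_mem_support_poly k _ e) fun v w hv hw a => ?_
    rw [map_add, hv, hw, leadingMon, map_add]

theorem mergeRows_minor (l : ℕ) (s t : Fin d) : mergeRows (k := k) l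
    (X (l, t) * X (l + 1, s) - X (l, s) * X (l + 1, t)) = 0 := by
  have h2 : merge l (l + 1) = l := by simp [merge]
  have h1 : merge l l = l := by simp [merge]
  simp only [map_sub, map_mul, mergeRows_X, h1, h2]
  ring

theorem mergeRows_pathPoly {i j : QVertex d n} (p : Quiver.Path i j) {a : ℕ}
    (ha : a < crossings p) : mergeRows a (pathPoly k p) = 0 := by
  induction p with
  | nil => exact absurd ha (Nat.not_lt_zero _)
  | cons p e ih =>
    rw [pathPoly, map_mul]
    rcases e with ⟨h, s⟩ | ⟨hi, hj, s, t, hst⟩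
    · rw [ih (by simpa [crossings, QArrow.crossing] using ha), zero_mul]
    · rw [crossings, QArrow.crossing] at ha
      rcases Nat.lt_succ_iff_lt_or_eq.1 ha with h | h
      · rw [ih h, zero_mul]
      · rw [h, QArrow.poly, mergeRows_minor, mul_zero]

variable {k}

/-- The monomial `m` occurs in `f` with coefficient one, and all other monomials of `f` have larger
weight. -/
def HasLeading (f : RowPoly k d) (m : ℕ × Fin d →₀ ℕ) : Prop :=
  ∀ w ∈ (f - monomial m 1).support, rowWeight m < rowWeight w

theorem HasLeading.le {f : RowPoly k d} {m : ℕ × Fin d →₀ ℕ} (h : HasLeading f m) :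
    ∀ w ∈ f.support, rowWeight m ≤ rowWeight w := by
  classical
  intro w hw
  rw [← sub_add_cancel f (monomial m 1)] at hw
  rcases Finset.mem_union.1 (support_add hw) with h' | h'
  · exact (h w h').le
  · rw [Finset.mem_singleton.1 (support_monomial_subset h')]

theorem HasLeading.coeff_eq {f : RowPoly k d} {m w : ℕ × Fin d →₀ ℕ} (h : HasLeading f m)
    (hw : rowWeight w ≤ rowWeight m) : coeff w f = if m = w then 1 else 0 := by
  classical
  rw [← coeff_monomial w m (1 : k), ← sub_eq_zero, ← coeff_sub]
  exact notMem_support_iff.1 fun h' => (h w h').not_ge hw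

theorem HasLeading.mul {f g : RowPoly k d} {m m' : ℕ × Fin d →₀ ℕ} (hf : HasLeading f m)
    (hg : HasLeading g m') : HasLeading (f * g) (m + m') := by
  classical
  have e : f * g - monomial (m + m') 1 =
      (f - monomial m 1) * g + monomial m 1 * (g - monomial m' 1) := by
    rw [mul_sub, monomial_mul, one_mul]
    ring
  intro w hw
  rw [e] at hw
  rcases Finset.mem_union.1 (support_add hw) with h | h
  · refine forall_mem_support_mul (C := fun w => rowWeight (m + m') < rowWeight w) hf hg.le
      (fun v v' h1 h2 => ?_) w h
    rw [map_add, map_add]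
    omega
  · refine forall_mem_support_mul (A := fun w => rowWeight w = rowWeight m)
      (C := fun w => rowWeight (m + m') < rowWeight w) (fun v hv => ?_) hg
      (fun v v' h1 h2 => ?_) w h
    · rw [Finset.mem_singleton.1 (support_monomial_subset hv)]
    · rw [map_add, map_add]
      omega

theorem hasLeading_monomial (m : ℕ × Fin d →₀ ℕ) : HasLeading (monomial m (1 : k)) m := by
  intro w hw
  simp at hw

theorem QArrow.hasLeading_poly {i j : QVertex d n} (l : ℕ) (e : QArrow d n i j) :
    HasLeading (e.poly k l) (e.leadingMon l) := by
  classical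
  rcases e with ⟨h, s⟩ | ⟨hi, hj, s, t, hst⟩
  · exact hasLeading_monomial _
  · intro w hw
    simp only [poly, leadingMon] at hw ⊢
    rw [X, X, X, X, monomial_mul, monomial_mul, one_mul, sub_sub_cancel_left, support_neg] at hw
    rw [Finset.mem_singleton.1 (support_monomial_subset hw)]
    simp only [map_add, rowWeight_single]
    have : (s : ℕ) < t := hst
    ring_nf
    omega

theorem hasLeading_pathPoly {i j : QVertex d n} (p : Quiver.Path i j) :
    HasLeading (pathPoly k p) (leadingMon p) := by
  induction p with
  | nil => exact hasLeading_monomial 0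
  | cons p e ih => exact ih.mul (QArrow.hasLeading_poly _ e)

/-- In a standard path, the last letter is the largest one of the last row. -/
theorem le_lastLetter {i j : QVertex d n} {p : Quiver.Path i j} (hp : Standard p) {s : Fin d}
    (hs : 0 < leadingMon p (crossings p, s)) : (s : ℕ) ≤ lastLetter p := by
  classical
  induction p with
  | nil => simp [leadingMon] at hs
  | cons p e ih =>
    rcases e with ⟨h, t⟩ | ⟨hi, hj, t, t', ht⟩
    · simp only [leadingMon, crossings, QArrow.crossing, QArrow.leadingMon, add_zero,
        Finsupp.add_apply, Finsupp.single_apply, Prod.mk.injEq, true_and] at hs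
      simp only [lastLetter, QArrow.last]
      split_ifs at hs with h'
      · exact h' ▸ le_rfl
      · exact (ih hp.1 hs).trans hp.2
    · have h0 : leadingMon p (crossings p + 1, s) = 0 := by
        have := row_leadingMon p (crossings p + 1)
        have h2 := apply_le_row (crossings p + 1) s (leadingMon p)
        simp at this
        omega
      simp only [leadingMon, crossings, QArrow.crossing, QArrow.leadingMon,
        Finsupp.add_apply, Finsupp.single_apply, Prod.mk.injEq, true_and, h0, zero_add] at hs
      simp only [lastLetter, QArrow.last]
      split_ifs at hs <;> omega

/-- A standard path is determined by its source and its leading monomial. -/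
theorem eq_of_leadingMon_eq {i : QVertex d n} {j j' : QVertex d n} (p : Quiver.Path i j)
    (q : Quiver.Path i j') (hp : Standard p) (hq : Standard q)
    (h : leadingMon p = leadingMon q) :
    (⟨i, j, p⟩ : AnyPath (QVertex d n)) = ⟨i, j', q⟩ := by
  classical
  -- the row degrees determine the number of crossings and the target
  have hend : ∀ {j j' : QVertex d n} (p : Quiver.Path i j) (q : Quiver.Path i j'),
      leadingMon p = leadingMon q → crossings p = crossings q ∧ j = j' := by
    intro j j' p q h
    have hj := j.pos
    have hj' := j'.pos
    have hc : crossings p = crossings q := by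
      have h1 := row_leadingMon p (crossings p)
      have h2 := row_leadingMon q (crossings p)
      have h3 := row_leadingMon p (crossings q)
      have h4 := row_leadingMon q (crossings q)
      rw [h] at h1 h3
      split_ifs at * <;> omega
    refine ⟨hc, Subtype.ext ?_⟩
    have h1 := row_leadingMon p (crossings p)
    have h2 := row_leadingMon q (crossings p)
    rw [h] at h1
    rw [h1] at h2
    simpa [hc] using h2
  induction p generalizing j' with
  | nil =>
    cases q with
    | nil => rfl
    | cons q f =>
      have := DFunLike.congr_fun h
      rcases f with ⟨_, t⟩ | ⟨_, _, t, t', _⟩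
      · simpa [leadingMon, QArrow.leadingMon] using this (crossings q, t)
      · simpa [leadingMon, QArrow.leadingMon] using this (crossings q, t')
  | @cons b c p e ih =>
    cases q with
    | nil =>
      have := DFunLike.congr_fun h
      rcases e with ⟨_, t⟩ | ⟨_, _, t, t', _⟩
      · simpa [leadingMon, QArrow.leadingMon] using this (crossings p, t)
      · simpa [leadingMon, QArrow.leadingMon] using this (crossings p, t')
    | @cons b' c' q f =>
      obtain ⟨hc, rfl⟩ := hend _ _ h
      have hb := b.pos
      have hb' := b'.pos
      rcases e with ⟨h1, s⟩ | ⟨h1, h2, s, t, hst⟩ <;> rcases f with ⟨h1', s'⟩ | ⟨h1', h2', s', t', hst'⟩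
      · obtain rfl : b = b' := Subtype.ext (by omega)
        have hc' : crossings p = crossings q := by simpa [crossings, QArrow.crossing] using hc
        have l1 := le_lastLetter (p := p.cons (QArrow.x h1 s)) hp (s := s')
          (by rw [h, hc]; simp [leadingMon, QArrow.leadingMon, crossings, QArrow.crossing])
        have l2 := le_lastLetter (p := q.cons (QArrow.x h1' s')) hq (s := s)
          (by rw [← h, ← hc]; simp [leadingMon, QArrow.leadingMon, crossings, QArrow.crossing])
        obtain rfl : s = s' := Fin.ext (le_antisymm l2 l1)
        have := ih q hp.1 hq.1 (by
          simp only [leadingMon, QArrow.leadingMon, hc'] at h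
          exact add_right_cancel h)
        cases this
        rfl
      · omega
      · omega
      · obtain rfl : b = b' := Subtype.ext (by omega)
        have hc' : crossings p = crossings q := by simpa [crossings, QArrow.crossing] using hc
        have l1 := le_lastLetter (p := p.cons (QArrow.xx h1 h2 s t hst)) hp (s := s')
          (by rw [h, hc]; simp [leadingMon, QArrow.leadingMon, crossings, QArrow.crossing])
        have l2 := le_lastLetter (p := q.cons (QArrow.xx h1' h2' s' t' hst')) hq (s := s)
          (by rw [← h, ← hc]; simp [leadingMon, QArrow.leadingMon, crossings, QArrow.crossing])
        obtain rfl : s = s' := Fin.ext (le_antisymm l2 l1)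
        -- the first letter of the last arrow is the largest one of the last row but one
        have key : ∀ {j : QVertex d n} (p : Quiver.Path i j) (hp : Standard p) (t t' : Fin d),
            lastLetter p ≤ t → 0 < (leadingMon p + Finsupp.single (crossings p, t) 1 :
              ℕ × Fin d →₀ ℕ) (crossings p, t') → t' ≤ t := by
          intro j p hp t t' hle hpos
          rw [Finsupp.add_apply, Finsupp.single_apply] at hpos
          split_ifs at hpos with h'
          · simp at h'
            exact h' ▸ le_rfl
          · exact (le_lastLetter hp hpos).trans hle
        have hcan : leadingMon p + Finsupp.single (crossings p, t) 1 =
            leadingMon q + Finsupp.single (crossings q, t') 1 := by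
          simp only [leadingMon, QArrow.leadingMon, ← add_assoc, hc'] at h
          rw [hc']
          exact add_right_cancel h
        have m1 := key p hp.1 t t' hp.2 (by rw [hcan, hc']; simp)
        have m2 := key q hq.1 t' t hq.2 (by rw [← hcan, ← hc']; simp)
        obtain rfl : t = t' := le_antisymm m2 m1
        have := ih q hp.1 hq.1 (by
          rw [hc'] at hcan
          exact add_right_cancel hcan)
        cases this
        rfl

/-- The polynomials of the standard paths with a given source are linearly independent. -/
theorem eq_zero_of_sum_pathPoly_eq_zero (i : QVertex d n) (F : Finset (AnyPath (QVertex d n)))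
    (c : AnyPath (QVertex d n) → k) (hF : ∀ p ∈ F, p.1 = i ∧ Standard p.2.2)
    (h : ∑ p ∈ F, c p • pathPoly k p.2.2 = 0) : ∀ p ∈ F, c p = 0 := by
  classical
  by_contra! hne
  obtain ⟨p₀, hp₀, hc₀⟩ := hne
  -- among the paths which occur, take one whose leading monomial has the least weight
  obtain ⟨p, hp, hmin⟩ := Finset.exists_min_image (F.filter fun p => c p ≠ 0)
    (fun p => rowWeight (leadingMon p.2.2)) ⟨p₀, by simp [hp₀, hc₀]⟩
  rw [Finset.mem_filter] at hp
  refine hp.2 ?_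
  have := congrArg (coeff (leadingMon p.2.2)) h
  rw [coeff_sum, coeff_zero, Finset.sum_eq_single p] at this
  · rw [coeff_smul, (hasLeading_pathPoly p.2.2).coeff_eq le_rfl] at this
    simpa using this
  · intro q hq hqp
    by_cases hcq : c q = 0
    · rw [hcq, zero_smul, coeff_zero]
    rw [coeff_smul, (hasLeading_pathPoly q.2.2).coeff_eq (hmin q (by simp [hq, hcq])),
      if_neg, smul_zero]
    intro heq
    apply hqp
    obtain ⟨i1, j1, p1⟩ := p
    obtain ⟨i2, j2, p2⟩ := q
    obtain ⟨rfl, h1⟩ := hF _ hp.1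
    obtain ⟨rfl, h2⟩ := hF _ hq
    exact eq_of_leadingMon_eq p2 p1 h2 h1 heq
  · intro h'
    exact absurd hp.1 h'

end Paths

/-! ### Standard paths span the quiver algebra -/

section Rewriting

variable {d n : ℕ} (k : Type u) [Field k]

/-- The class of a path in the algebra of the quiver with relations. -/
noncomputable def pathClass {i j : QVertex d n} (p : Quiver.Path i j) : QuiverAlgebra k d n :=
  QuiverAlgebra.mk k (PathAlgebra.ofPath ⟨i, j, p⟩)

/-- The class of an arrow in the algebra of the quiver with relations. -/
noncomputable def arrowClass {i j : QVertex d n} (e : QArrow d n i j) : QuiverAlgebra k d n :=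
  QuiverAlgebra.mk k (PathAlgebra.arrow k (V := QVertex d n) (a := i) (b := j) e)

theorem pathClass_cons {i b c : QVertex d n} (p : Quiver.Path i b) (e : QArrow d n b c) :
    pathClass k (p.cons e) = arrowClass k e * pathClass k p := by
  rw [pathClass, pathClass, arrowClass, ← map_mul, PathAlgebra.arrow,
    PathAlgebra.ofPath_mul_ofPath, PathAlgebra.pathMul_comp]
  rfl

/-- The classes of the paths with the same ends and the same number of letters as `p`, but with a
larger position weight, span this subspace. -/
noncomputable def higherSpan {i j : QVertex d n} (p : Quiver.Path i j) :
    Submodule k (QuiverAlgebra k d n) :=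
  Submodule.span k {y | ∃ q : Quiver.Path i j, letters q = letters p ∧
    positionWeight p < positionWeight q ∧ pathClass k q = y}

variable {k}

theorem arrowClass_mul_mem_higherSpan {i b c : QVertex d n} {p : Quiver.Path i b}
    (e : QArrow d n b c) {y : QuiverAlgebra k d n} (hy : y ∈ higherSpan k p) :
    arrowClass k e * y ∈ higherSpan k (p.cons e) := by
  refine Submodule.span_induction (p := fun y _ => arrowClass k e * y ∈ higherSpan k (p.cons e))
    ?_ ?_ ?_ ?_ hy
  · rintro _ ⟨q, h1, h2, rfl⟩
    rw [← pathClass_cons]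
    refine Submodule.subset_span ⟨q.cons e, ?_, ?_, rfl⟩
    · simp only [letters, h1]
    · simp only [positionWeight, h1]
      omega
  · rw [mul_zero]
    exact zero_mem _
  · intro x y _ _ hx hy
    rw [mul_add]
    exact add_mem hx hy
  · intro r x _ hx
    rw [mul_smul_comm]
    exact Submodule.smul_mem _ r hx

theorem cons_cons_mem_higherSpan {i a b c : QVertex d n} (p : Quiver.Path i a)
    (f f' : QArrow d n a b) (e e' : QArrow d n b c)
    (hl : f'.length + e'.length = f.length + e.length)
    (hw : ∀ L, f.positionWeight L + e.positionWeight (L + f.length) <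
      f'.positionWeight L + e'.positionWeight (L + f'.length)) :
    arrowClass k e' * arrowClass k f' * pathClass k p ∈
      higherSpan k ((p.cons f).cons e) := by
  refine Submodule.subset_span ⟨(p.cons f').cons e', ?_, ?_, ?_⟩
  · simp only [letters]
    omega
  · have := hw (letters p)
    simp only [positionWeight, letters]
    omega
  · rw [pathClass_cons, pathClass_cons, mul_assoc]

/-- The relations rewrite a pair of arrows which violates the standardness condition. -/
theorem cons_cons_rewrite {i a b c : QVertex d n} (p : Quiver.Path i a) (f : QArrow d n a b)
    (e : QArrow d n b c) (h : e.first < f.last) :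
    pathClass k ((p.cons f).cons e) ∈ higherSpan k ((p.cons f).cons e) := by
  have ha := a.pos
  have hb := b.pos
  have hc := c.pos
  have rel : ∀ {x y : PathAlgebra k (QVertex d n)}, QRel k x y →
      QuiverAlgebra.mk k x = QuiverAlgebra.mk k y := fun h => RingQuot.mkAlgHom_rel k h
  have hcc : pathClass k ((p.cons f).cons e) =
      arrowClass k e * arrowClass k f * pathClass k p := by
    rw [pathClass_cons, pathClass_cons, mul_assoc]
  rw [hcc]
  rcases f with ⟨hf, s⟩ | ⟨hf, hf', s, t, hst⟩ <;> rcases e with ⟨he, u⟩ | ⟨he, he', u, v, huv⟩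
  · have hus : u < s := h
    have := rel (QRel.comm (k := k) hf he hus)
    rw [map_mul, map_mul] at this
    have e1 : arrowClass k (QArrow.x he u) * arrowClass k (QArrow.x hf s) =
      arrowClass k (QArrow.x he s) * arrowClass k (QArrow.x hf u) := this
    rw [e1]
    refine cons_cons_mem_higherSpan p _ _ _ _ rfl fun L => ?_
    simp only [QArrow.positionWeight, QArrow.length]
    have : (u : ℕ) < s := h
    nlinarith
  · have hvs : v < s := h
    have := rel (QRel.right (k := k) hf he he' huv hvs)
    simp only [map_mul, map_add, map_sub, map_zero] at this
    have e1 : arrowClass k (QArrow.xx he he' u v huv) * arrowClass k (QArrow.x hf s) =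
      arrowClass k (QArrow.xx he he' u s (huv.trans hvs)) * arrowClass k (QArrow.x hf v) -
      arrowClass k (QArrow.xx he he' v s hvs) * arrowClass k (QArrow.x hf u) := by
      rw [eq_sub_iff_add_eq, ← sub_eq_zero]
      rw [← this]
      simp only [arrowClass, arrowX, arrowXX]
      abel
    have h1 : (v : ℕ) < s := h
    have h2 : (u : ℕ) < v := huv
    rw [e1, sub_mul]
    refine sub_mem ?_ ?_ <;>
    · refine cons_cons_mem_higherSpan p _ _ _ _ rfl fun L => ?_
      simp only [QArrow.positionWeight, QArrow.length]
      nlinarith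
  · have hus : u < s := h
    have := rel (QRel.left (k := k) hf hf' he hus hst)
    simp only [map_mul, map_add, map_sub, map_zero] at this
    have e1 : arrowClass k (QArrow.x he u) * arrowClass k (QArrow.xx hf hf' s t hst) =
      arrowClass k (QArrow.x he s) * arrowClass k (QArrow.xx hf hf' u t (hus.trans hst)) -
      arrowClass k (QArrow.x he t) * arrowClass k (QArrow.xx hf hf' u s hus) := by
      rw [eq_sub_iff_add_eq, ← sub_eq_zero]
      rw [← this]
      simp only [arrowClass, arrowX, arrowXX]
      abel
    have h1 : (u : ℕ) < s := h
    have h2 : (s : ℕ) < t := hst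
    rw [e1, sub_mul]
    refine sub_mem ?_ ?_ <;>
    · refine cons_cons_mem_higherSpan p _ _ _ _ rfl fun L => ?_
      simp only [QArrow.positionWeight, QArrow.length]
      nlinarith
  · have hvs : v < s := h
    have hn : n = 2 := by omega
    obtain rfl : a = b := Subtype.ext (by omega)
    obtain rfl : a = c := Subtype.ext (by omega)
    have := rel (QRel.quad (k := k) hn he hf' huv hvs hst)
    simp only [map_mul, map_add, map_sub, map_zero] at this
    have e1 : arrowClass k (QArrow.xx he he' u v huv) * arrowClass k (QArrow.xx hf hf' s t hst) =
      arrowClass k (QArrow.xx he he' u s (huv.trans hvs)) *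
        arrowClass k (QArrow.xx hf hf' v t (hvs.trans hst)) -
      arrowClass k (QArrow.xx he he' u t (huv.trans (hvs.trans hst))) *
        arrowClass k (QArrow.xx hf hf' v s hvs) -
      arrowClass k (QArrow.xx he he' v s hvs) *
        arrowClass k (QArrow.xx hf hf' u t (huv.trans (hvs.trans hst))) +
      arrowClass k (QArrow.xx he he' v t (hvs.trans hst)) *
        arrowClass k (QArrow.xx hf hf' u s (huv.trans hvs)) -
      arrowClass k (QArrow.xx he he' s t hst) *
        arrowClass k (QArrow.xx hf hf' u v huv) := by
      rw [← sub_eq_zero, ← this]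
      simp only [arrowClass, arrowXX]
      abel
    have h1 : (v : ℕ) < s := h
    have h2 : (s : ℕ) < t := hst
    have h3 : (u : ℕ) < v := huv
    rw [e1, sub_mul, add_mul, sub_mul, sub_mul]
    refine sub_mem (add_mem (sub_mem (sub_mem ?_ ?_) ?_) ?_) ?_ <;>
    · refine cons_cons_mem_higherSpan p _ _ _ _ rfl fun L => ?_
      simp only [QArrow.positionWeight, QArrow.length]
      nlinarith

/-- A path which is not standard contains a pair of arrows which can be rewritten. -/
theorem mem_higherSpan_of_not_standard {i j : QVertex d n} (p : Quiver.Path i j)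
    (hp : ¬ Standard p) : pathClass k p ∈ higherSpan k p := by
  induction p with
  | nil => exact absurd trivial hp
  | @cons b c p e ih =>
    by_cases hs : Standard p
    · have hlt : e.first < lastLetter p := by
        by_contra hle
        exact hp ⟨hs, not_lt.1 hle⟩
      cases p with
      | nil => exact absurd hlt (Nat.not_lt_zero _)
      | cons p f => exact cons_cons_rewrite p f e hlt
    · rw [pathClass_cons]
      exact arrowClass_mul_mem_higherSpan e (ih hs)

/-- The position weight of the paths with a given number of letters is bounded, so that the rewriting
terminates. -/
theorem positionWeight_le {i j : QVertex d n} (p : Quiver.Path i j) :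
    positionWeight p ≤ letters p * letters p * d := by
  induction p with
  | nil => exact Nat.zero_le _
  | cons p e ih =>
    rcases e with ⟨h, s⟩ | ⟨hi, hj, s, t, hst⟩
    · simp only [positionWeight, letters, QArrow.positionWeight, QArrow.length]
      have := s.2
      nlinarith
    · simp only [positionWeight, letters, QArrow.positionWeight, QArrow.length]
      have h1 := s.2
      have h2 := t.2
      nlinarith

/-- The classes of the standard paths span the algebra of the quiver with relations. -/
theorem pathClass_mem_span_standard {i j : QVertex d n} (p : Quiver.Path i j) :
    pathClass k p ∈ Submodule.span k
      {y | ∃ q : Quiver.Path i j, Standard q ∧ pathClass k q = y} := by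
  induction hm : letters p * letters p * d - positionWeight p using Nat.strong_induction_on
    generalizing p with
  | _ m ih =>
    by_cases hp : Standard p
    · exact Submodule.subset_span ⟨p, hp, rfl⟩
    · refine Submodule.span_le.2 ?_ (mem_higherSpan_of_not_standard p hp)
      rintro _ ⟨q, h1, h2, rfl⟩
      refine ih _ ?_ q rfl
      have := positionWeight_le q
      rw [h1] at this ⊢
      omega

end Rewriting

/-! ### Cycles are spanned by the polynomials of paths -/

section Cycles

variable {k : Type u} [Field k] {d n : ℕ}

/-- The possible row degrees of the monomials in the `l`-th syzygy: the rows `1, …, l - 1` have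
degree `n`, the last row `l` has degree less than `n`, and row zero has degree congruent to `-c`. -/
def Shape (n c l : ℕ) (w : ℕ × Fin d →₀ ℕ) : Prop :=
  (∀ a, l < a → row a w = 0) ∧
    (0 < l → n ∣ row 0 w + c ∧ (∀ a, 0 < a → a < l → row a w = n) ∧ row l w < n)

theorem Shape.of_row_eq {c l : ℕ} {v w : ℕ × Fin d →₀ ℕ} (h : Shape n c l v)
    (hr : ∀ a, row a w = row a v) : Shape n c l w := by
  simpa only [Shape, hr] using h

variable (k d) in
/-- The polynomials with monomials of the given shape which are killed by the multiplication of
the rows `a` and `a + 1` for all `a₀ ≤ a < l`. -/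
def cycles (n a₀ c l : ℕ) : Submodule k (RowPoly k d) where
  carrier := {z | (∀ w ∈ z.support, Shape n c l w) ∧ ∀ a, a₀ ≤ a → a < l → mergeRows a z = 0}
  zero_mem' := ⟨by simp, fun a _ _ => map_zero _⟩
  add_mem' := by
    classical
    rintro x y ⟨hx, hx'⟩ ⟨hy, hy'⟩
    refine ⟨fun w hw => ?_, fun a h h' => ?_⟩
    · rcases Finset.mem_union.1 (support_add hw) with h | h
      exacts [hx w h, hy w h]
    · rw [map_add, hx' a h h', hy' a h h', add_zero]
  smul_mem' := by
    rintro r x ⟨hx, hx'⟩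
    refine ⟨fun w hw => hx w (support_smul hw), fun a h h' => ?_⟩
    rw [map_smul, hx' a h h', smul_zero]

/-- Some letter in row `a + 1` is smaller than some letter in row `a`. -/
def Descent (w : ℕ × Fin d →₀ ℕ) (a : ℕ) : Prop :=
  ∃ s t : Fin d, s < t ∧ 0 < w (a, t) ∧ 0 < w (a + 1, s)

theorem descent_of_mem_cycles {c l : ℕ} {z : RowPoly k d} (hz : z ∈ cycles k d n 0 c l)
    {w : ℕ × Fin d →₀ ℕ} (hw : w ∈ z.support)
    (hmin : ∀ v ∈ z.support, rowWeight w ≤ rowWeight v) {a : ℕ} (ha : a < l) : Descent w a := by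
  refine exists_descent (hz.2 a (Nat.zero_le a) ha) hw hmin fun v hv hvw => ?_
  obtain ⟨-, hs⟩ := hz.1 v hv
  obtain ⟨-, hs'⟩ := hz.1 w hw
  obtain ⟨h1, h2, h3⟩ := hs (by omega)
  obtain ⟨h1', h2', h3'⟩ := hs' (by omega)
  rcases Nat.eq_zero_or_pos a with rfl | ha0
  · have hr := congrArg (row 0) hvw
    simp only [row_mapDomain_merge, lt_self_iff_false, if_true, if_false] at hr
    rcases Nat.lt_or_ge 1 l with hl | hl
    · have := h2 1 one_pos hl
      have := h2' 1 one_pos hl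
      simp only [zero_add] at hr
      omega
    · obtain rfl : l = 1 := by omega
      have e1 : row 1 v ≡ row 1 w [MOD n] := by
        have e2 : row 0 v + c + row 1 v = row 0 w + c + row 1 w := by
          simp only [zero_add] at hr
          omega
        have e3 : row 0 v + c ≡ row 0 w + c [MOD n] :=
          ((Nat.modEq_zero_iff_dvd).2 h1).trans ((Nat.modEq_zero_iff_dvd).2 h1').symm
        exact Nat.ModEq.add_left_cancel e3 (e2 ▸ Nat.ModEq.refl _)
      have := Nat.ModEq.eq_of_lt_of_lt e1 h3 h3'
      simp only [zero_add] at hr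
      omega
  · rw [h2 a ha0 ha, h2' a ha0 ha]

theorem exists_max_letter {a : ℕ} {w : ℕ × Fin d →₀ ℕ} (h : 0 < row a w) :
    ∃ s, 0 < w (a, s) ∧ ∀ t, 0 < w (a, t) → t ≤ s := by
  obtain ⟨s₀, hs₀⟩ := exists_pos_of_row_pos h
  obtain ⟨s, hs, hmax⟩ := Finset.exists_max_image
    (Finset.univ.filter fun s => 0 < w (a, s)) id ⟨s₀, by simpa using hs₀⟩
  exact ⟨s, by simpa using hs, fun t ht => hmax t (by simpa using ht)⟩

theorem exists_add_single {σ : Type*} {w : σ →₀ ℕ} {x : σ} (h : 0 < w x) :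
    ∃ v, w = v + Finsupp.single x 1 :=
  ⟨w - Finsupp.single x 1, (tsub_add_cancel_of_le (Finsupp.single_le_iff.2 h)).symm⟩

/-- Removing the largest letter `s` of the last row preserves the descents, if another letter is
left in this row. -/
theorem Descent.remove {v w : ℕ × Fin d →₀ ℕ} {l : ℕ} {s : Fin d}
    (hmax : ∀ t, 0 < w (l, t) → t ≤ s) (hlt : ∀ b t, b < l → v (b, t) = w (b, t))
    (hne : ∀ t, t ≠ s → v (l, t) = w (l, t)) (hpos : 0 < row l v) {a : ℕ} (ha : a < l)
    (h : Descent w a) : Descent v a := by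
  obtain ⟨s₀, t₀, hst, ht, hs⟩ := h
  rcases Nat.lt_or_ge (a + 1) l with hal | hal
  · exact ⟨s₀, t₀, hst, by rwa [hlt a t₀ ha], by rwa [hlt _ s₀ hal]⟩
  · obtain rfl : l = a + 1 := by omega
    by_cases h0 : s₀ = s
    · obtain ⟨u, hu⟩ := exists_pos_of_row_pos hpos
      have hus : u ≤ s := by
        by_cases hu' : u = s
        · exact hu'.le
        · exact hmax u (by rwa [← hne u hu'])
      exact ⟨u, t₀, (h0 ▸ hus).trans_lt hst, by rwa [hlt a t₀ ha], hu⟩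
    · exact ⟨s₀, t₀, hst, by rwa [hlt a t₀ ha], by rwa [hne s₀ h0]⟩

/-- A monomial with descents between any two consecutive rows is, up to a monomial in row zero,
the leading monomial of a path. The last arrow of the path has the largest letter of the last row
(or the only letter of the last row and the largest letter of the row before). -/
theorem exists_leadingMon (i : QVertex d n) (l : ℕ) (j : QVertex d n) (w : ℕ × Fin d →₀ ℕ) (e : ℕ)
    (hij : l = 0 → i.1 ≤ j.1)
    (hrow : ∀ a, row a w + (if a = 0 then i.1 else 0) =
      (if a < l then n else if a = l then j.1 else 0) + (if a = 0 then e else 0))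
    (hdesc : ∀ a < l, Descent w a) :
    ∃ (p : Quiver.Path i j) (α : Fin d →₀ ℕ), crossings p = l ∧
      w = Finsupp.mapDomain (Prod.mk 0) α + leadingMon p := by
  classical
  induction hN : l * n + j.1 using Nat.strong_induction_on generalizing l j w with
  | _ N ih =>
  have hi := i.pos
  have hin := i.lt
  have hj := j.pos
  have hjn := j.lt
  have hrl := hrow l
  simp only [lt_irrefl, if_true, if_false] at hrl
  rcases Nat.lt_or_ge (if l = 0 then i.1 else 1) j.1 with hlast | hlast
  -- the last arrow is a variable
  · have hpos : 0 < row l w := by split_ifs at * <;> omega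
    obtain ⟨s, hs, hmax⟩ := exists_max_letter hpos
    obtain ⟨v, rfl⟩ := exists_add_single hs
    have hj2 : 2 ≤ j.1 := by split_ifs at hlast <;> omega
    let b : QVertex d n := ⟨j.1 - 1, Finset.mem_Ico.2 ⟨by omega, by omega⟩⟩
    have hb : b.1 = j.1 - 1 := rfl
    obtain ⟨p, α, hp, hv⟩ := ih (l * n + b.1) (by omega) l b v
      (fun h => by rw [if_pos h] at hlast; omega)
      (fun a => by
        have := hrow a
        rw [map_add, row_single] at this
        rw [hb]
        clear ih hdesc hmax hs hrow hpos hij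
        clear_value b
        clear hrl
        grind)
      (fun a ha => by
        refine Descent.remove hmax (fun c t hc => ?_) (fun t ht => ?_) ?_ ha (hdesc a ha)
        · simp [hc.ne']
        · simp [ht.symm]
        · rw [map_add, row_single, if_pos rfl] at hrl
          have hl : l ≠ 0 := by omega
          rw [if_neg hl, if_neg hl] at hrl
          omega) rfl
    refine ⟨p.cons (QArrow.x (by omega) s), α, by rw [crossings, hp]; rfl, ?_⟩
    rw [leadingMon, QArrow.leadingMon, hp, hv, add_assoc]
  · by_cases hl : l = 0
    -- the path is trivial
    · subst hl
      have hij' : i = j := Subtype.ext (le_antisymm (hij rfl) (by simpa using hlast))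
      subst hij'
      refine ⟨.nil, Finsupp.onFinset Finset.univ (fun s => w (0, s)) (by simp), rfl, ?_⟩
      rw [leadingMon, add_zero]
      ext ⟨a, s⟩
      by_cases ha : a = 0
      · subst ha
        rw [Finsupp.mapDomain_apply (Prod.mk_right_injective 0)]
        rfl
      · rw [Finsupp.mapDomain_of_notMem_range _ _ (by simp [Ne.symm ha])]
        have h1 := hrow a
        have h2 := apply_le_row a s w
        simp [ha] at h1
        omega
    -- the last arrow is a minor
    · rw [if_neg hl] at hlast
      obtain ⟨m, rfl⟩ := Nat.exists_eq_succ_of_ne_zero hl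
      rw [Nat.succ_eq_add_one] at *
      have hj1 : j.1 = 1 := by omega
      have hrm := hrow m
      have hpos : 0 < row m w := by
        split_ifs at hrm <;> omega
      obtain ⟨t, ht, hmax⟩ := exists_max_letter hpos
      obtain ⟨s₀, t₀, hst, ht₀, hs₀⟩ := hdesc m (Nat.lt_succ_self m)
      have hst' : s₀ < t := hst.trans_le (hmax t₀ ht₀)
      obtain ⟨v, rfl⟩ := exists_add_single ht
      obtain ⟨v', rfl⟩ : ∃ v', v = v' + Finsupp.single (m + 1, s₀) 1 :=
        exists_add_single (by simpa [Finsupp.single_apply] using hs₀)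
      let b : QVertex d n := ⟨n - 1, Finset.mem_Ico.2 ⟨by omega, by omega⟩⟩
      have hb : b.1 = n - 1 := rfl
      have hrow' : ∀ a, row a v' + (if a = 0 then i.1 else 0) =
          (if a < m then n else if a = m then b.1 else 0) + (if a = 0 then e else 0) := by
        intro a
        have := hrow a
        rw [map_add, map_add, row_single, row_single] at this
        rw [hb]
        clear hrm hrl ih
        split_ifs at * <;> omega
      obtain ⟨p, α, hp, hv⟩ := ih (m * n + b.1) (by rw [← hN, add_mul]; omega) m b v'
        (fun h => by omega) hrow'
        (fun a ha => by
          refine Descent.remove hmax (fun c t hc => ?_) (fun t ht => ?_) ?_ ha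
            (hdesc a (by omega))
          · rw [Finsupp.add_apply, Finsupp.add_apply, Finsupp.single_apply, Finsupp.single_apply,
              if_neg (by simp; omega), if_neg (by simp; omega)]
            rfl
          · simp [ht.symm]
          · have := hrow' m
            rw [if_neg (by omega : ¬ m = 0)] at this
            simp at this
            omega) rfl
      refine ⟨p.cons (QArrow.xx (by omega) hj1 s₀ t hst'), α, by rw [crossings, hp]; rfl, ?_⟩
      rw [leadingMon, QArrow.leadingMon, hp, hv]
      abel

theorem eq_sum_single {l : ℕ} {w : ℕ × Fin d →₀ ℕ} (h : ∀ a, l < a → row a w = 0) :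
    w = ∑ a ∈ Finset.range (l + 1), ∑ s, Finsupp.single (a, s) (w (a, s)) := by
  classical
  ext ⟨b, s⟩
  simp only [Finsupp.finsetSum_apply, Finsupp.single_apply, Prod.mk.injEq, ite_and]
  rw [Finset.sum_eq_ite b (fun a _ ha => by simp [ha])]
  by_cases hb : b ∈ Finset.range (l + 1)
  · simp [hb]
  · have h1 := apply_le_row b s w
    rw [h b (by simpa using hb)] at h1
    rw [if_neg hb]
    omega

theorem degree_eq_sum_row {l : ℕ} {w : ℕ × Fin d →₀ ℕ} (h : ∀ a, l < a → row a w = 0) :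
    w.degree = ∑ a ∈ Finset.range (l + 1), row a w := by
  conv_lhs => rw [eq_sum_single h]
  simp only [map_sum, Finsupp.degree_single, row_apply]

/-- In the shape of a syzygy, the last row determines the total degree modulo `n`. -/
theorem Shape.degree_modEq {l : ℕ} (hl : 0 < l) {w : ℕ × Fin d →₀ ℕ} (h : Shape n 0 l w) :
    w.degree ≡ row l w [MOD n] := by
  obtain ⟨h1, h2, -⟩ := h.2 hl
  rw [degree_eq_sum_row h.1, Finset.sum_range_succ]
  have h0 : n ∣ ∑ a ∈ Finset.range l, row a w := by
    refine Finset.dvd_sum fun a ha => ?_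
    rcases Nat.eq_zero_or_pos a with rfl | ha'
    · exact h1
    · rw [h2 a ha' (Finset.mem_range.1 ha)]
  simpa using (Nat.modEq_zero_iff_dvd.2 h0).add_right (row l w)

theorem Shape.rowWeight_le {c l : ℕ} (hl : 0 < l) {w : ℕ × Fin d →₀ ℕ} (h : Shape n c l w) :
    rowWeight w ≤ ∑ a ∈ Finset.range (l + 1), n * (a * d) := by
  conv_lhs => rw [eq_sum_single h.1]
  rw [map_sum]
  refine Finset.sum_le_sum fun a ha => ?_
  rw [map_sum]
  calc ∑ s, rowWeight (Finsupp.single (a, s) (w (a, s)))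
      ≤ ∑ s, w (a, s) * (a * d) := Finset.sum_le_sum fun s _ => by
        rw [rowWeight_single]
        exact Nat.mul_le_mul le_rfl (Nat.mul_le_mul le_rfl s.2.le)
    _ = row a w * (a * d) := by rw [row_apply, Finset.sum_mul]
    _ ≤ n * (a * d) := by
        rcases Nat.eq_zero_or_pos a with rfl | ha0
        · simp
        refine Nat.mul_le_mul ?_ le_rfl
        obtain ⟨-, h2, h3⟩ := h.2 hl
        rcases lt_or_eq_of_le (Nat.le_of_lt_succ (Finset.mem_range.1 ha)) with h' | rfl
        · exact (h2 a ha0 h').le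
        · exact h3.le

variable (k) in
/-- The products of the polynomials of paths from `i` with `l` crossings and monomials in row zero,
where the degree in row zero is congruent to `-c`. -/
def pathMultiples (i : QVertex d n) (c l : ℕ) : Set (RowPoly k d) :=
  {y | ∃ (j : QVertex d n) (p : Quiver.Path i j) (α : Fin d →₀ ℕ), crossings p = l ∧
    n ∣ α.degree + (n - i.1) + c ∧ toRowZero (monomial α 1) * pathPoly k p = y}

theorem toRowZero_monomial (α : Fin d →₀ ℕ) (r : k) :
    toRowZero (monomial α r) = monomial (Finsupp.mapDomain (Prod.mk 0) α) r := by
  rw [toRowZero, rename_monomial]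

/-- A monomial of the given shape with descents is the leading monomial of an element of
`pathMultiples`. -/
theorem exists_pathMultiple {i : QVertex d n} {c l : ℕ} (hl : 0 < l) (hc : c ≤ i.1)
    {w : ℕ × Fin d →₀ ℕ} (hw : Shape n c l w) (hdesc : ∀ a < l, Descent w a) :
    ∃ y ∈ pathMultiples k i c l, HasLeading y w ∧ y ∈ cycles k d n 0 c l := by
  classical
  have hi := i.pos
  have hin := i.lt
  have rowpos : ∀ {a : ℕ} {s : Fin d}, 0 < w (a, s) → 0 < row a w := fun h =>
    h.trans_le (apply_le_row _ _ w)
  obtain ⟨h1, h2, h3⟩ := hw.2 hl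
  have hposl : 0 < row l w := by
    obtain ⟨s, t, -, -, h⟩ := hdesc (l - 1) (by omega)
    rw [Nat.sub_add_cancel hl] at h
    exact rowpos h
  have hpos0 : 0 < row 0 w := by
    obtain ⟨s, t, -, h, -⟩ := hdesc 0 hl
    exact rowpos h
  have hge : n ≤ row 0 w + c := Nat.le_of_dvd (by omega) h1
  let j : QVertex d n := ⟨row l w, Finset.mem_Ico.2 ⟨hposl, h3⟩⟩
  have hj : j.1 = row l w := rfl
  obtain ⟨p, α, hp, hwp⟩ := exists_leadingMon i l j w (row 0 w + i.1 - n) (by omega)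
    (fun a => by
      rw [hj]
      rcases Nat.eq_zero_or_pos a with rfl | ha
      · rw [if_pos rfl, if_pos hl, if_pos rfl]
        omega
      · rw [if_neg ha.ne', if_neg ha.ne', add_zero, add_zero]
        split_ifs with h h'
        · exact h2 a ha h
        · rw [h']
        · exact hw.1 a (by omega)) hdesc
  have hlead : HasLeading (toRowZero (monomial α 1) * pathPoly k p) w := by
    rw [hwp, toRowZero_monomial]
    exact (hasLeading_monomial _).mul (hasLeading_pathPoly p)
  have hrows : ∀ v ∈ (toRowZero (monomial α 1) * pathPoly k p).support, ∀ a,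
      row a v = row a w := by
    rw [toRowZero_monomial]
    refine forall_mem_support_mul (A := fun v => v = Finsupp.mapDomain (Prod.mk 0) α)
      (fun v hv => Finset.mem_singleton.1 (support_monomial_subset hv))
      (row_of_mem_support_pathPoly k p) ?_
    rintro _ v rfl hv a
    rw [map_add, hv, hwp, map_add]
  refine ⟨_, ⟨j, p, α, hp, ?_, rfl⟩, hlead, fun v hv => hw.of_row_eq (hrows v hv),
    fun a _ ha => ?_⟩
  · have e1 := row_leadingMon p 0
    have e2 := congrArg (row 0) hwp
    rw [map_add, row_mapDomain_zero] at e2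
    rw [hp] at e1
    simp only [if_true, if_pos hl] at e1 e2
    rw [e2] at h1
    convert h1 using 1
    omega
  · rw [map_mul, mergeRows_pathPoly k p (hp ▸ ha), mul_zero]

/-- The cycles are spanned by the polynomials of paths, up to factors in row zero. -/
theorem cycles_le_span {i : QVertex d n} {c l : ℕ} (hl : 0 < l) (hc : c ≤ i.1) :
    cycles k d n 0 c l ≤ Submodule.span k (pathMultiples k i c l) := by
  classical
  -- monomials of weight `C` are removed step by step; the weight of the shape is bounded
  have key : ∀ B C : ℕ, ∑ a ∈ Finset.range (l + 1), n * (a * d) < C + B →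
      ∀ z ∈ cycles k d n 0 c l, (∀ w ∈ z.support, C ≤ rowWeight w) →
      z ∈ Submodule.span k (pathMultiples k i c l) := by
    intro B
    induction B with
    | zero =>
      intro C hC z hz hw
      have : z = 0 := by
        rw [← support_eq_empty, Finset.eq_empty_iff_forall_notMem]
        intro w hw'
        have := (hz.1 w hw').rowWeight_le hl
        have := hw w hw'
        omega
      rw [this]
      exact zero_mem _
    | succ B ih =>
      intro C hC z hz hw
      have hex : ∀ w : ℕ × Fin d →₀ ℕ, ∃ y : RowPoly k d,
          w ∈ z.support.filter (fun w => rowWeight w = C) →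
          y ∈ pathMultiples k i c l ∧ HasLeading y w ∧ y ∈ cycles k d n 0 c l := by
        intro w
        by_cases h : w ∈ z.support.filter (fun w => rowWeight w = C)
        · obtain ⟨h1, h2⟩ := Finset.mem_filter.1 h
          obtain ⟨y, hy⟩ := exists_pathMultiple (k := k) hl hc (hz.1 w h1)
            (fun a ha => descent_of_mem_cycles hz h1 (fun v hv => h2 ▸ hw v hv) ha)
          exact ⟨y, fun _ => hy⟩
        · exact ⟨0, fun h' => absurd h' h⟩
      choose y hy using hex
      have hsum : ∑ w ∈ z.support.filter (fun w => rowWeight w = C), coeff w z • y w ∈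
          Submodule.span k (pathMultiples k i c l) :=
        Submodule.sum_mem _ fun w h => Submodule.smul_mem _ _ (Submodule.subset_span (hy w h).1)
      rw [← sub_add_cancel z
        (∑ w ∈ z.support.filter (fun w => rowWeight w = C), coeff w z • y w)]
      refine add_mem (ih (C + 1) (by omega) _ ?_ ?_) hsum
      · exact sub_mem hz (Submodule.sum_mem _ fun w h => Submodule.smul_mem _ _ (hy w h).2.2)
      · intro v hv
        by_contra hlt
        apply mem_support_iff.1 hv
        have hvC : rowWeight v ≤ C := by omega
        rw [coeff_sub, coeff_sum, sub_eq_zero]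
        have e : ∀ w ∈ z.support.filter (fun w => rowWeight w = C),
            coeff v (coeff w z • y w) = if w = v then coeff v z else 0 := by
          intro w h
          rw [coeff_smul, (hy w h).2.1.coeff_eq (hvC.trans (Finset.mem_filter.1 h).2.ge)]
          split_ifs with h' <;> simp [h']
        rw [Finset.sum_congr rfl e, Finset.sum_ite_eq']
        split_ifs with h'
        · rfl
        · by_contra hne
          have hv' := mem_support_iff.2 hne
          exact h' (Finset.mem_filter.2 ⟨hv', le_antisymm hvC (hw v hv')⟩)
  exact fun z hz => key (∑ a ∈ Finset.range (l + 1), n * (a * d) + 1) 0 (by omega) z hz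
    fun _ _ => Nat.zero_le _

end Cycles

/-! ### Comparison of a resolution with the chosen syzygies -/

section Resolutions

variable {R : Type u} [CommRing R]

/-- A presentation of `X` by a projective module, with kernel `K`. -/
structure Presentation (X K : ModuleCat.{u} R) where
  P : ModuleCat.{u} R
  π : P →ₗ[R] X
  ι : K →ₗ[R] P
  projective : Module.Projective R P
  surjective : Function.Surjective π
  injective : Function.Injective ι
  exact : LinearMap.range ι = LinearMap.ker π

/-- The chosen presentation of a module. -/
def ProjectivePresentations.presentation (p : ProjectivePresentations R) (X : ModuleCat.{u} R) :
    Presentation X (p.Ω X) where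
  P := p.P X
  π := p.π X
  ι := p.ι X
  projective := p.projective X
  surjective := p.surjective X
  injective := ProjectivePresentations.ι_injective X
  exact := Submodule.range_subtype _

namespace Presentation

variable {X K X' K' X'' K'' : ModuleCat.{u} R}

/-- The map `h` of kernels is induced by a lift of `f` to the projective modules. -/
def IsLift (A : Presentation X K) (B : Presentation X' K') (f : X →ₗ[R] X') (h : K →ₗ[R] K') :
    Prop :=
  ∃ g : A.P →ₗ[R] B.P, B.π ∘ₗ g = f ∘ₗ A.π ∧ B.ι ∘ₗ h = g ∘ₗ A.ι

theorem π_ι (A : Presentation X K) (x : K) : A.π (A.ι x) = 0 := by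
  have : A.ι x ∈ LinearMap.ker A.π := A.exact ▸ ⟨x, rfl⟩
  exact this

theorem exists_restrict (A : Presentation X K) {Z : ModuleCat.{u} R} (g : Z →ₗ[R] A.P)
    (hg : ∀ z, A.π (g z) = 0) : ∃ h : Z →ₗ[R] K, A.ι ∘ₗ h = g := by
  have hr : ∀ z, g z ∈ LinearMap.range A.ι := fun z => A.exact ▸ hg z
  refine ⟨(LinearEquiv.ofInjective A.ι A.injective).symm.toLinearMap ∘ₗ
    LinearMap.codRestrict _ g hr, LinearMap.ext fun z => ?_⟩
  have := LinearEquiv.apply_symm_apply (LinearEquiv.ofInjective A.ι A.injective)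
    (LinearMap.codRestrict _ g hr z)
  exact congrArg Subtype.val this

theorem exists_isLift (A : Presentation X K) (B : Presentation X' K') (f : X →ₗ[R] X') :
    ∃ h, IsLift A B f h := by
  have := A.projective
  obtain ⟨g, hg⟩ := Module.projective_lifting_property B.π (f ∘ₗ A.π) B.surjective
  obtain ⟨h, hh⟩ := B.exists_restrict (g ∘ₗ A.ι) (fun x => by
    have := LinearMap.congr_fun hg (A.ι x)
    simpa [A.π_ι] using this)
  exact ⟨h, g, hg, hh⟩

theorem IsLift.comp {A : Presentation X K} {B : Presentation X' K'} {C : Presentation X'' K''}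
    {f f' h h'} (H' : IsLift B C f' h') (H : IsLift A B f h) :
    IsLift A C (f' ∘ₗ f) (h' ∘ₗ h) := by
  obtain ⟨g, h1, h2⟩ := H
  obtain ⟨g', h1', h2'⟩ := H'
  refine ⟨g' ∘ₗ g, ?_, ?_⟩
  · rw [← LinearMap.comp_assoc, h1', LinearMap.comp_assoc, h1, LinearMap.comp_assoc]
  · rw [← LinearMap.comp_assoc, h2', LinearMap.comp_assoc, h2, LinearMap.comp_assoc]

theorem IsLift.id (A : Presentation X K) : IsLift A A LinearMap.id LinearMap.id :=
  ⟨LinearMap.id, rfl, rfl⟩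

/-- The stable class of the map of kernels depends only on the stable class of the given map. -/
theorem IsLift.mk_eq {A : Presentation X K} {B : Presentation X' K'} {f f' h h'}
    (H : IsLift A B f h) (H' : IsLift A B f' h')
    (hf : StableHom.mk f = StableHom.mk f') : StableHom.mk h = StableHom.mk h' := by
  obtain ⟨g, h1, h2⟩ := H
  obtain ⟨g', h1', h2'⟩ := H'
  obtain ⟨Q, hQ, a, b, hab⟩ := StableHom.mk_eq.1 hf
  obtain ⟨b', hb'⟩ := Module.projective_lifting_property B.π b B.surjective
  obtain ⟨s, hs⟩ := B.exists_restrict (g - g' - b' ∘ₗ a ∘ₗ A.π) (fun x => by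
    have e1 := LinearMap.congr_fun h1 x
    have e1' := LinearMap.congr_fun h1' x
    have e2 := LinearMap.congr_fun hb' (a (A.π x))
    have e3 := LinearMap.congr_fun hab (A.π x)
    simp only [LinearMap.comp_apply, LinearMap.sub_apply] at e1 e1' e2 e3
    simp only [LinearMap.comp_apply, LinearMap.sub_apply, map_sub]
    rw [e1, e1', e2, e3, sub_self])
  refine StableHom.mk_eq.2 ⟨A.P, A.projective, A.ι, s, LinearMap.ext fun x => B.injective ?_⟩
  have e1 := LinearMap.congr_fun h2 x
  have e1' := LinearMap.congr_fun h2' x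
  have e2 := LinearMap.congr_fun hs (A.ι x)
  simp only [LinearMap.comp_apply, LinearMap.sub_apply] at e1 e1' e2
  rw [LinearMap.comp_apply, LinearMap.sub_apply, map_sub, e1, e1', e2, A.π_ι, map_zero, map_zero,
    sub_zero]

end Presentation

open ProjectivePresentations

variable {X : ModuleCat.{u} R} {Y : ℕ → ModuleCat.{u} R} (p : ProjectivePresentations R)
  (res : ∀ l, Presentation (Y l) (Y (l + 1))) (e : Y 0 ≃ₗ[R] X)

/-- A map is a stable isomorphism if it has an inverse in the stable category. -/
def IsStableIso {M N : ModuleCat.{u} R} (f : M →ₗ[R] N) : Prop :=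
  ∃ g : N →ₗ[R] M, StableHom.mk (f ∘ₗ g) = StableHom.id N ∧
    StableHom.mk (g ∘ₗ f) = StableHom.id M

theorem isStableIso_toLinearMap {M N : ModuleCat.{u} R} (e : M ≃ₗ[R] N) :
    IsStableIso e.toLinearMap :=
  ⟨e.symm.toLinearMap, by rw [LinearEquiv.comp_symm]; rfl, by rw [LinearEquiv.symm_comp]; rfl⟩

/-- The syzygies of stably isomorphic modules are stably isomorphic. -/
theorem Presentation.IsLift.isStableIso {X K X' K' : ModuleCat.{u} R} {A : Presentation X K}
    {B : Presentation X' K'} {f h} (H : Presentation.IsLift A B f h) (hf : IsStableIso f) :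
    IsStableIso h := by
  obtain ⟨g, h1, h2⟩ := hf
  obtain ⟨h', H'⟩ := Presentation.exists_isLift B A g
  exact ⟨h', (H.comp H').mk_eq (IsLift.id B) h1, (H'.comp H).mk_eq (IsLift.id A) h2⟩

/-- The comparison of a resolution of `X` with the iterated syzygies of `X`. -/
noncomputable def comparison : ∀ l, {c : Y l →ₗ[R] p.Ωpow X l // IsStableIso c}
  | 0 => ⟨e.toLinearMap, isStableIso_toLinearMap e⟩
  | l + 1 =>
    ⟨(Presentation.exists_isLift (res l) (p.presentation (p.Ωpow X l)) (comparison l).1).choose,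
      (Presentation.exists_isLift (res l) (p.presentation (p.Ωpow X l))
        (comparison l).1).choose_spec.isStableIso (comparison l).2⟩

theorem comparison_isLift (l : ℕ) : Presentation.IsLift (res l) (p.presentation (p.Ωpow X l))
    (comparison p res e l).1 (comparison p res e (l + 1)).1 :=
  (Presentation.exists_isLift (res l) (p.presentation (p.Ωpow X l))
    (comparison p res e l).1).choose_spec

/-- The element of `⨁ StableHom(X, Ω^i X)` given by a map from `X` to a term of a resolution. -/
noncomputable def resolutionClass (l : ℕ) (f : X →ₗ[R] Y l) : p.SyzygyAlgebra X :=
  DirectSum.of (p.Component X) l (StableHom.mk ((comparison p res e l).1 ∘ₗ f))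

variable {p res e}

theorem resolutionClass_add (l : ℕ) (f g : X →ₗ[R] Y l) :
    resolutionClass p res e l (f + g) =
      resolutionClass p res e l f + resolutionClass p res e l g := by
  rw [resolutionClass, LinearMap.comp_add, StableHom.mk_add, map_add]
  rfl

theorem resolutionClass_eq_smul {l : ℕ} {r : R} {f g : X →ₗ[R] Y l} (h : ∀ x, g x = r • f x) :
    resolutionClass p res e l g = r • resolutionClass p res e l f := by
  obtain rfl : g = r • f := LinearMap.ext h
  rw [resolutionClass, LinearMap.comp_smul, StableHom.mk_smul]
  exact DirectSum.of_smul R l r _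

/-- A map to a term of the resolution vanishes in the stable category of the iterated syzygies only
if it already factors through a projective module. -/
theorem mk_comparison_comp_eq_zero_iff {l : ℕ} {f : X →ₗ[R] Y l} :
    (StableHom.mk ((comparison p res e l).1 ∘ₗ f) : p.Component X l) = 0 ↔
      f ∈ projectiveMaps X (Y l) := by
  obtain ⟨u, h1, h2⟩ := (comparison p res e l).2
  have hz : ∀ {M N : ModuleCat.{u} R} (f : M →ₗ[R] N), StableHom.mk f = 0 ↔
      f ∈ projectiveMaps M N := fun f => Submodule.Quotient.mk_eq_zero _
  rw [← hz f]
  constructor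
  · intro h
    have e1 : StableHom.mk f = StableHom.comp (StableHom.mk u)
        (StableHom.mk ((comparison p res e l).1 ∘ₗ f)) := by
      rw [StableHom.comp_mk, ← LinearMap.comp_assoc, ← StableHom.comp_mk, h2, StableHom.id_comp]
    rw [e1, h, map_zero]
  · intro h
    rw [← StableHom.comp_mk, h, map_zero]

theorem resolutionClass_eq_zero {l : ℕ} {f : X →ₗ[R] Y l} (hf : f ∈ projectiveMaps X (Y l)) :
    resolutionClass p res e l f = 0 := by
  rw [resolutionClass, mk_comparison_comp_eq_zero_iff.2 hf, map_zero]

theorem exists_resolutionClass (l : ℕ) (x : p.Component X l) :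
    ∃ f : X →ₗ[R] Y l, resolutionClass p res e l f = DirectSum.of (p.Component X) l x := by
  obtain ⟨h, rfl⟩ := StableHom.mk_surjective x
  obtain ⟨u, h1, h2⟩ := (comparison p res e l).2
  refine ⟨u ∘ₗ h, congrArg (DirectSum.of (p.Component X) l) ?_⟩
  rw [← LinearMap.comp_assoc, ← StableHom.comp_mk, h1, StableHom.id_comp]

/-- The comparison intertwines a chain map with the iterated syzygies of its degree zero part. -/
theorem ΩpowMap_comp_comparison {j : ℕ} (g : ∀ m, Y m →ₗ[R] Y (j + m))
    (hg : ∀ m, Presentation.IsLift (res m) (res (j + m)) (g m) (g (m + 1))) (m : ℕ) :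
    StableHom.comp (p.ΩpowMap m
      (StableHom.mk ((comparison p res e j).1 ∘ₗ g 0 ∘ₗ e.symm.toLinearMap)))
      (StableHom.mk (comparison p res e m).1) =
      StableHom.mk ((comparison p res e (j + m)).1 ∘ₗ g m) := by
  induction m with
  | zero =>
    refine congrArg StableHom.mk (LinearMap.ext fun y => ?_)
    exact congrArg (fun y => (comparison p res e j).1 (g 0 y)) (e.symm_apply_apply y)
  | succ m ih =>
    obtain ⟨h, hh⟩ := StableHom.mk_surjective (p.ΩpowMap m
      (StableHom.mk ((comparison p res e j).1 ∘ₗ g 0 ∘ₗ e.symm.toLinearMap)))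
    rw [← hh, StableHom.comp_mk] at ih
    obtain ⟨h', H'⟩ := exists_isSyzygyMap (p := p) h
    have e1 : p.ΩpowMap (m + 1)
        (StableHom.mk ((comparison p res e j).1 ∘ₗ g 0 ∘ₗ e.symm.toLinearMap)) =
        StableHom.mk h' := by
      rw [← ΩMap_mk H', hh]
      rfl
    rw [e1]
    have H : Presentation.IsLift (p.presentation (p.Ωpow X m))
        (p.presentation (p.Ωpow X (j + m))) h h' := H'
    exact (H.comp (comparison_isLift p res e m)).mk_eq
      ((comparison_isLift p res e (j + m)).comp (hg m)) ih

/-- Multiplication from the left by an element of degree `j` is composition with a chain map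
which lifts it to the resolution. -/
theorem resolutionClass_mul {j : ℕ} (g : ∀ m, Y m →ₗ[R] Y (j + m))
    (hg : ∀ m, Presentation.IsLift (res m) (res (j + m)) (g m) (g (m + 1))) {m : ℕ}
    (f : X →ₗ[R] Y m) :
    resolutionClass p res e j (g 0 ∘ₗ e.symm.toLinearMap) * resolutionClass p res e m f =
      resolutionClass p res e (j + m) (g m ∘ₗ f) := by
  rw [resolutionClass, resolutionClass, DirectSum.of_mul_of]
  refine congrArg (DirectSum.of (p.Component X) (j + m)) ?_
  exact (StableHom.comp_assoc _ (StableHom.mk (comparison p res e m).1)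
    (StableHom.mk f)).symm.trans (congrArg (fun x => StableHom.comp x (StableHom.mk f))
      (ΩpowMap_comp_comparison g hg m))

end Resolutions

/-! ### The concrete syzygies -/

section ConcreteResolution

variable {k : Type u} [Field k] {d n : ℕ}

/-- The Veronese subring acts on the polynomials in rows through row zero. -/
noncomputable instance rowPolyModule : Module (veronese k d n) (RowPoly k d) :=
  Module.compHom (RowPoly k d)
    ((toRowZero (k := k) (d := d)).comp (veronese k d n).val).toRingHom

theorem weight_degMod (α : Fin d →₀ ℕ) : Finsupp.weight (degMod d n) α = (α.degree : ZMod n) := by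
  rw [Finsupp.weight_apply, Finsupp.degree_apply, Nat.cast_sum, Finsupp.sum]
  refine Finset.sum_congr rfl fun s _ => ?_
  rw [degMod, nsmul_eq_mul, mul_one]

theorem dvd_degree_of_mem_support (r : veronese k d n) {α : Fin d →₀ ℕ} (h : α ∈ r.1.support) :
    n ∣ α.degree := by
  have := r.2 (mem_support_iff.1 h)
  rwa [weight_degMod, ZMod.natCast_eq_zero_iff] at this

theorem monomial_mem_veronese {α : Fin d →₀ ℕ} (h : n ∣ α.degree) (c : k) :
    monomial α c ∈ veronese k d n := by
  change IsWeightedHomogeneous _ _ _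
  refine isWeightedHomogeneous_monomial _ _ _ ?_
  rwa [weight_degMod, ZMod.natCast_eq_zero_iff]

theorem exists_of_mem_support_toRowZero {f : MvPolynomial (Fin d) k} {w : ℕ × Fin d →₀ ℕ}
    (h : w ∈ (toRowZero f).support) :
    ∃ α ∈ f.support, Finsupp.mapDomain (Prod.mk 0) α = w :=
  exists_of_mem_support_rename h

theorem toRowZero_mul_mem_cycles {a₀ c c' l : ℕ} {f : MvPolynomial (Fin d) k}
    (hf : ∀ α ∈ f.support, α.degree + c' ≡ c [MOD n]) {z : RowPoly k d}
    (hz : z ∈ cycles k d n a₀ c l) : toRowZero f * z ∈ cycles k d n a₀ c' l := by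
  refine ⟨forall_mem_support_mul (fun w hw => exists_of_mem_support_toRowZero hw) hz.1 ?_,
    fun a h h' => by rw [map_mul, hz.2 a h h', mul_zero]⟩
  rintro _ w ⟨α, hα, rfl⟩ ⟨h1, h2⟩
  have hrow : ∀ a, a ≠ 0 → row a (Finsupp.mapDomain (Prod.mk 0) α + w) = row a w := fun a ha => by
    rw [map_add, row_mapDomain_zero, if_neg ha, zero_add]
  refine ⟨fun a ha => by rw [hrow a (by omega), h1 a ha], fun hl => ?_⟩
  obtain ⟨h3, h4, h5⟩ := h2 hl
  refine ⟨?_, fun a ha hal => by rw [hrow a ha.ne', h4 a ha hal], by rwa [hrow l hl.ne']⟩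
  rw [map_add, row_mapDomain_zero, if_pos rfl]
  rw [← Nat.modEq_zero_iff_dvd] at h3 ⊢
  have : α.degree + row 0 w + c' = α.degree + c' + row 0 w := by ring
  rw [this]
  refine ((hf α hα).add_right (row 0 w)).trans ?_
  rwa [add_comm]

theorem veronese_smul_mem_cycles {a₀ c l : ℕ} (r : veronese k d n) {z : RowPoly k d}
    (hz : z ∈ cycles k d n a₀ c l) : r • z ∈ cycles k d n a₀ c l :=
  toRowZero_mul_mem_cycles (fun α hα => by
    have := (Nat.modEq_zero_iff_dvd.2 (dvd_degree_of_mem_support r hα)).add_right c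
    rwa [zero_add] at this) hz

variable (k d) in
/-- The cycles whose degree in row zero is divisible by `n`, as a module over the Veronese subring.
For `a₀ = 0` this is the `l`-th syzygy of `S`, and for `a₀ = 1` it is the projective module which
covers the syzygy before. -/
def syzygy (n a₀ l : ℕ) : Submodule (veronese k d n) (RowPoly k d) where
  carrier := cycles k d n a₀ 0 l
  zero_mem' := zero_mem _
  add_mem' := add_mem
  smul_mem' r _ hz := veronese_smul_mem_cycles r hz

-- Shortcut instances: the general search for them is slow.
noncomputable instance (a₀ l : ℕ) : AddCommGroup (syzygy k d n a₀ l) :=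
  Submodule.addCommGroup _

noncomputable instance (a₀ l : ℕ) : Module (veronese k d n) (syzygy k d n a₀ l) :=
  Submodule.module _

noncomputable instance (a₀ l : ℕ) : SMul (veronese k d n) (syzygy k d n a₀ l) :=
  (inferInstance : Module (veronese k d n) (syzygy k d n a₀ l)).toSMul

theorem mergeRows_zero_mem {l : ℕ} {z : RowPoly k d} (hz : z ∈ cycles k d n 1 0 (l + 1)) :
    mergeRows 0 z ∈ cycles k d n 0 0 l := by
  refine ⟨fun w hw => ?_, fun a _ ha => ?_⟩
  · obtain ⟨v, hv, rfl⟩ := exists_of_mem_support_rename hw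
    obtain ⟨h1, h2⟩ := hz.1 v hv
    obtain ⟨h3, h4, h5⟩ := h2 (Nat.succ_pos l)
    refine ⟨fun a ha => ?_, fun hl => ⟨?_, fun a ha hal => ?_, ?_⟩⟩
    · rw [row_mapDomain_merge, if_neg (by omega), if_neg (by omega), h1 _ (by omega)]
    · rw [row_mapDomain_merge, if_neg (by omega), if_pos rfl, h4 (0 + 1) (by omega) (by omega)]
      rw [add_zero] at h3 ⊢
      exact dvd_add h3 dvd_rfl
    · rw [row_mapDomain_merge, if_neg (by omega), if_neg (by omega),
        h4 _ (by omega) (by omega)]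
    · rwa [row_mapDomain_merge, if_neg (by omega), if_neg (by omega)]
  · rw [mergeRows_mergeRows_zero, hz.2 (a + 1) (by omega) (by omega), map_zero]

variable (k d n) in
/-- The multiplication of the rows zero and one as a map from the projective module to the
syzygy which it covers. -/
noncomputable def syzygyπ (l : ℕ) : syzygy k d n 1 (l + 1) →ₗ[veronese k d n] syzygy k d n 0 l where
  toFun z := ⟨mergeRows 0 z.1, mergeRows_zero_mem z.2⟩
  map_add' x y := Subtype.ext (map_add (mergeRows 0) x.1 y.1)
  map_smul' r x := Subtype.ext (by
    change mergeRows 0 (toRowZero r.1 * x.1) = toRowZero r.1 * mergeRows 0 x.1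
    rw [map_mul, mergeRows_toRowZero])

theorem syzygy_succ_le (l : ℕ) : syzygy k d n 0 l ≤ syzygy k d n 1 l :=
  fun _ hz => ⟨hz.1, fun a _ ha => hz.2 a (Nat.zero_le a) ha⟩

variable (k d n) in
/-- The `k`-space of generators of the `l`-th syzygy: the part of lowest degree in row zero, which is
`n` for `l > 0`. For `l = 0` the generators are the polynomials of degree less than `n`. -/
def generators (l : ℕ) : Submodule k (RowPoly k d) where
  carrier := {z | z ∈ cycles k d n 0 0 l ∧
    ∀ w ∈ z.support, (0 < l → row 0 w = n) ∧ (l = 0 → row 0 w < n)}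
  zero_mem' := ⟨zero_mem _, by simp⟩
  add_mem' := by
    classical
    rintro x y ⟨hx, hx'⟩ ⟨hy, hy'⟩
    refine ⟨add_mem hx hy, fun w hw => ?_⟩
    rcases Finset.mem_union.1 (support_add hw) with h | h
    exacts [hx' w h, hy' w h]
  smul_mem' := by
    rintro r x ⟨hx, hx'⟩
    exact ⟨Submodule.smul_mem _ r hx, fun w hw => hx' w (support_smul hw)⟩

theorem shiftRows_mem {l : ℕ} {z : RowPoly k d} (hz : z ∈ generators k d n l) :
    shiftRows z ∈ cycles k d n 1 0 (l + 1) := by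
  refine ⟨fun w hw => ?_, fun a ha hal => ?_⟩
  · obtain ⟨v, hv, rfl⟩ := exists_of_mem_support_rename hw
    obtain ⟨h1, h2⟩ := hz.1.1 v hv
    obtain ⟨h3, h4⟩ := hz.2 v hv
    refine ⟨fun a ha => ?_, fun _ => ⟨?_, fun a ha hal => ?_, ?_⟩⟩
    · rw [row_mapDomain_succ, if_neg (by omega), h1 _ (by omega)]
    · rw [row_mapDomain_succ, if_pos rfl]
      exact dvd_zero n
    · rw [row_mapDomain_succ, if_neg (by omega)]
      rcases Nat.eq_or_lt_of_le (Nat.succ_le_of_lt ha) with rfl | ha'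
      · exact h3 (by omega)
      · exact (h2 (by omega)).2.1 _ (by omega) (by omega)
    · rw [row_mapDomain_succ, if_neg (by omega), Nat.add_sub_cancel]
      rcases Nat.eq_zero_or_pos l with rfl | hl
      · exact h4 rfl
      · exact (h2 hl).2.2
  · obtain ⟨b, rfl⟩ := Nat.exists_eq_add_of_le' ha
    rw [mergeRows_succ_shiftRows, hz.1.2 b (Nat.zero_le b) (by omega), map_zero]

theorem exists_add_of_le_degree {m : ℕ} (α : Fin d →₀ ℕ) (h : m ≤ α.degree) :
    ∃ β γ : Fin d →₀ ℕ, α = β + γ ∧ γ.degree = m := by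
  induction m with
  | zero => exact ⟨α, 0, by simp, by simp⟩
  | succ m ih =>
    obtain ⟨β, γ, rfl, hγ⟩ := ih (by omega)
    rw [map_add] at h
    have hβ : β ≠ 0 := by
      rintro rfl
      simp at h
      omega
    obtain ⟨s, hs⟩ := Finsupp.ne_iff.1 hβ
    obtain ⟨β', rfl⟩ := exists_add_single (Nat.pos_of_ne_zero hs)
    exact ⟨β', γ + Finsupp.single s 1, by rw [add_assoc, add_comm γ],
      by rw [map_add, Finsupp.degree_single, hγ]⟩

/-- A product of a generator and of a monomial whose degree is divisible by `n` is in the image of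
the projective module. -/
theorem exists_syzygyπ_eq {l : ℕ} {α : Fin d →₀ ℕ} (hα : n ∣ α.degree) {w : RowPoly k d}
    (hw : w ∈ generators k d n l) :
    ∃ z, ((syzygyπ k d n l z : syzygy k d n 0 l) : RowPoly k d) = toRowZero (monomial α 1) * w := by
  refine ⟨(⟨monomial α 1, monomial_mem_veronese hα 1⟩ : veronese k d n) • ⟨shiftRows w,
    shiftRows_mem hw⟩, ?_⟩
  change mergeRows 0 (toRowZero (monomial α 1) * shiftRows w) = _
  rw [map_mul, mergeRows_toRowZero, mergeRows_zero_shiftRows]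

theorem eq_mapDomain_of_row_eq_zero {w : ℕ × Fin d →₀ ℕ} (h : ∀ a, 0 < a → row a w = 0) :
    ∃ α : Fin d →₀ ℕ, w = Finsupp.mapDomain (Prod.mk 0) α := by
  classical
  refine ⟨Finsupp.onFinset Finset.univ (fun s => w (0, s)) (by simp), ?_⟩
  ext ⟨a, s⟩
  by_cases ha : a = 0
  · subst ha
    rw [Finsupp.mapDomain_apply (Prod.mk_right_injective 0)]
    rfl
  · rw [Finsupp.mapDomain_of_notMem_range _ _ (by simp [Ne.symm ha])]
    have h2 := apply_le_row a s w
    rw [h a (by omega)] at h2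
    omega

theorem pathPoly_mem_cycles {i j : QVertex d n} (p : Quiver.Path i j) :
    pathPoly k p ∈ cycles k d n 0 i.1 (crossings p) := by
  have hj := j.lt
  refine ⟨fun w hw => ?_, fun a _ ha => mergeRows_pathPoly k p ha⟩
  have hr := row_of_mem_support_pathPoly k p w hw
  have hl := row_leadingMon p
  refine ⟨fun a ha => ?_, fun hpos => ⟨?_, fun a ha hal => ?_, ?_⟩⟩
  · have := hl a
    rw [if_neg (by omega), if_neg (by omega), if_neg (by omega)] at this
    rw [hr, ← this, add_zero]
  · have := hl 0
    rw [if_pos rfl, if_pos hpos] at this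
    rw [hr, this]
  · have := hl a
    rw [if_neg (by omega), if_pos hal, add_zero] at this
    rw [hr, this]
  · have := hl (crossings p)
    rw [if_neg (by omega), if_neg (by omega), if_pos rfl, add_zero] at this
    rwa [hr, this]

/-- The product of the polynomial of a path from `i` and of a monomial of degree `i` in row zero
is a generator of a syzygy. -/
theorem toRowZero_mul_pathPoly_mem_generators {i j : QVertex d n} {p : Quiver.Path i j}
    (hp : 0 < crossings p) {γ : Fin d →₀ ℕ} (hγ : γ.degree = i.1) :
    toRowZero (monomial γ 1) * pathPoly k p ∈ generators k d n (crossings p) := by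
  refine ⟨toRowZero_mul_mem_cycles (fun α hα => ?_) (pathPoly_mem_cycles p), ?_⟩
  · rw [Finset.mem_singleton.1 (support_monomial_subset hα), hγ, add_zero]
  · refine forall_mem_support_mul (fun w hw => exists_of_mem_support_toRowZero hw)
      (row_of_mem_support_pathPoly k p) ?_
    rintro _ w ⟨α, hα, rfl⟩ h
    refine ⟨fun _ => ?_, fun h => absurd h hp.ne'⟩
    have := row_leadingMon p 0
    rw [if_pos rfl, if_pos hp] at this
    rw [map_add, row_mapDomain_zero, if_pos rfl, h,
      Finset.mem_singleton.1 (support_monomial_subset hα), hγ, add_comm, this]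

/-- By `cycles_le_span` for the vertex `1`, a syzygy is generated by multiples of polynomials of
paths by monomials; such a monomial contains a letter which makes the polynomial a generator. -/
theorem syzygyπ_surjective (hn : 2 ≤ n) (l : ℕ) : Function.Surjective (syzygyπ k d n l) := by
  -- it suffices to treat the products of generators and monomials in the Veronese subring
  have key : ∀ y ∈ cycles k d n 0 0 l, y ∈ Submodule.span k {y : RowPoly k d |
      ∃ α : Fin d →₀ ℕ, n ∣ α.degree ∧ ∃ w ∈ generators k d n l,
        y = toRowZero (monomial α 1) * w} := by
    intro y hy
    rcases Nat.eq_zero_or_pos l with rfl | hl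
    · rw [y.as_sum]
      refine Submodule.sum_mem _ fun w hw => ?_
      obtain ⟨α, rfl⟩ := eq_mapDomain_of_row_eq_zero (hy.1 w hw).1
      obtain ⟨β, γ, rfl, hγ⟩ := exists_add_of_le_degree α (Nat.mod_le α.degree n)
      have e : monomial (Finsupp.mapDomain (Prod.mk 0) (β + γ))
          (coeff (Finsupp.mapDomain (Prod.mk 0) (β + γ)) y) =
          coeff (Finsupp.mapDomain (Prod.mk 0) (β + γ)) y •
            (toRowZero (k := k) (monomial β 1) * toRowZero (monomial γ 1)) := by
        rw [← map_mul, monomial_mul, mul_one, toRowZero_monomial, smul_monomial, smul_eq_mul,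
          mul_one]
      rw [e]
      refine Submodule.smul_mem _ _ (Submodule.subset_span ⟨β, ?_, _, ?_, rfl⟩)
      · have : n ∣ (β + γ).degree - γ.degree := hγ ▸ Nat.dvd_sub_mod _
        rwa [map_add, Nat.add_sub_cancel] at this
      · have hs : ∀ v ∈ (toRowZero (monomial γ (1 : k))).support,
            v = Finsupp.mapDomain (Prod.mk 0) γ := fun v hv => by
          rw [toRowZero_monomial] at hv
          exact Finset.mem_singleton.1 (support_monomial_subset hv)
        refine ⟨⟨fun v hv => ⟨fun a ha => ?_, fun h => absurd h (lt_irrefl 0)⟩,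
          fun a _ ha => absurd ha (Nat.not_lt_zero a)⟩, fun v hv => ⟨fun h => absurd h
          (lt_irrefl 0), fun _ => ?_⟩⟩
        · rw [hs v hv, row_mapDomain_zero, if_neg (by omega)]
        · rw [hs v hv, row_mapDomain_zero, if_pos rfl, hγ]
          exact Nat.mod_lt _ (by omega)
    · let i : QVertex d n := ⟨1, Finset.mem_Ico.2 ⟨le_rfl, hn⟩⟩
      have hi : i.1 = 1 := rfl
      refine Submodule.span_le.2 ?_ (cycles_le_span (i := i) hl (Nat.zero_le _) hy)
      rintro _ ⟨j, p, α, rfl, hα, rfl⟩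
      rw [hi] at hα
      have h1 : 1 ≤ α.degree := by
        by_contra h0
        have := Nat.le_of_dvd (by omega) hα
        omega
      obtain ⟨β, γ, rfl, hγ⟩ := exists_add_of_le_degree α h1
      refine Submodule.subset_span ⟨β, ?_, _,
        toRowZero_mul_pathPoly_mem_generators hl (hγ.trans hi.symm), ?_⟩
      · rw [map_add, hγ, add_zero, add_assoc, Nat.add_sub_cancel' (by omega)] at hα
        exact (Nat.dvd_add_left dvd_rfl).1 hα
      · rw [← mul_assoc, ← map_mul, monomial_mul, mul_one]
  rintro ⟨y, hy⟩
  suffices h : ∃ z, ((syzygyπ k d n l z : syzygy k d n 0 l) : RowPoly k d) = y by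
    obtain ⟨z, hz⟩ := h
    exact ⟨z, Subtype.ext hz⟩
  refine Submodule.span_induction (p := fun y _ => ∃ z, ((syzygyπ k d n l z : syzygy k d n 0 l) :
    RowPoly k d) = y) ?_ ?_ ?_ ?_ (key y hy)
  · rintro _ ⟨α, hα, w, hw, rfl⟩
    exact exists_syzygyπ_eq hα hw
  · exact ⟨0, by rw [map_zero]; rfl⟩
  · rintro _ _ _ _ ⟨x, rfl⟩ ⟨y, rfl⟩
    exact ⟨x + y, by rw [map_add]; rfl⟩
  · rintro c _ _ ⟨x, rfl⟩
    refine ⟨algebraMap k (veronese k d n) c • x, ?_⟩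
    rw [map_smul]
    change toRowZero (algebraMap k (MvPolynomial (Fin d) k) c) * _ = _
    rw [AlgHom.commutes, Algebra.smul_def]

end ConcreteResolution

/-! ### The concrete resolution -/

section Freeness

variable {k : Type u} [Field k] {d n : ℕ}

variable (k d) in
/-- Polynomials in rows as polynomials in row zero whose coefficients are polynomials in the other
rows, shifted down by one. -/
noncomputable def splitRow : RowPoly k d →ₐ[k] MvPolynomial (Fin d) (RowPoly k d) :=
  aeval fun x : ℕ × Fin d => if x.1 = 0 then X x.2 else C (X (x.1 - 1, x.2))

theorem splitRow_toRowZero (f : MvPolynomial (Fin d) k) :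
    splitRow k d (toRowZero f) = map (algebraMap k (RowPoly k d)) f := by
  induction f using MvPolynomial.induction_on with
  | C r =>
    rw [← algebraMap_eq, AlgHom.commutes, AlgHom.commutes]
    exact (map_C (algebraMap k (RowPoly k d)) r).symm
  | add f g hf hg => rw [map_add, map_add, map_add, hf, hg]
  | mul_X f s hf =>
    rw [map_mul, map_mul, map_mul, hf, map_X, toRowZero, rename_X, splitRow, aeval_X, if_pos rfl]

theorem splitRow_shiftRows (z : RowPoly k d) : splitRow k d (shiftRows z) = C z := by
  induction z using MvPolynomial.induction_on with
  | C r =>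
    rw [← algebraMap_eq, AlgHom.commutes, AlgHom.commutes]
    rfl
  | add f g hf hg => rw [map_add, map_add, map_add, hf, hg]
  | mul_X f s hf =>
    rw [map_mul, map_mul, map_mul, hf, shiftRows, rename_X, splitRow, aeval_X, if_neg (by simp)]
    rfl

theorem splitRow_mergeRows (a : ℕ) (z : RowPoly k d) :
    splitRow k d (mergeRows (a + 1) z) =
      map ((mergeRows a : RowPoly k d →ₐ[k] RowPoly k d) : RowPoly k d →+* RowPoly k d)
        (splitRow k d z) := by
  induction z using MvPolynomial.induction_on with
  | C r =>
    rw [← algebraMap_eq, AlgHom.commutes, AlgHom.commutes, IsScalarTower.algebraMap_apply k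
      (RowPoly k d), algebraMap_eq, map_C]
    congr 1
    exact ((mergeRows a : RowPoly k d →ₐ[k] RowPoly k d).commutes r).symm
  | add f g hf hg => rw [map_add, map_add, map_add, map_add, hf, hg]
  | mul_X f x hf =>
    obtain ⟨b, s⟩ := x
    rw [map_mul, map_mul, map_mul, map_mul, hf, mergeRows_X, splitRow, aeval_X, aeval_X]
    congr 1
    by_cases hb : b = 0
    · subst hb
      simp [merge]
    · have h1 : merge (a + 1) b ≠ 0 := by rw [merge]; split_ifs <;> omega
      have h2 : merge (a + 1) b - 1 = merge a (b - 1) := by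
        simp only [merge]; split_ifs <;> omega
      rw [if_neg h1, if_neg hb, map_C, h2]
      congr 1
      exact (mergeRows_X a (b - 1) s).symm

theorem exists_eq_mapDomain_add (w : ℕ × Fin d →₀ ℕ) : ∃ (α : Fin d →₀ ℕ) (v : ℕ × Fin d →₀ ℕ),
    w = Finsupp.mapDomain (Prod.mk 0) α + Finsupp.mapDomain (Prod.map Nat.succ id) v := by
  induction w using Finsupp.induction_linear with
  | zero => exact ⟨0, 0, by simp⟩
  | add f g hf hg =>
    obtain ⟨α, v, rfl⟩ := hf
    obtain ⟨β, v', rfl⟩ := hg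
    refine ⟨α + β, v + v', ?_⟩
    rw [Finsupp.mapDomain_add, Finsupp.mapDomain_add]
    abel
  | single x m =>
    obtain ⟨_ | a, s⟩ := x
    · exact ⟨Finsupp.single s m, 0, by simp⟩
    · exact ⟨0, Finsupp.single (a, s) m, by simp⟩

theorem splitRow_monomial (α : Fin d →₀ ℕ) (v : ℕ × Fin d →₀ ℕ) (r : k) :
    splitRow k d (monomial (Finsupp.mapDomain (Prod.mk 0) α +
      Finsupp.mapDomain (Prod.map Nat.succ id) v) r) = monomial α (monomial v r) := by
  have : monomial (Finsupp.mapDomain (Prod.mk 0) α +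
      Finsupp.mapDomain (Prod.map Nat.succ id) v) r =
      toRowZero (monomial α 1) * shiftRows (monomial v r) := by
    rw [toRowZero_monomial, shiftRows, rename_monomial, monomial_mul, one_mul]
  rw [this, map_mul, splitRow_toRowZero, splitRow_shiftRows, map_monomial, map_one, mul_comm,
    C_mul_monomial, mul_one]

theorem mem_support_of_mem_support_coeff_splitRow {z : RowPoly k d} {α : Fin d →₀ ℕ}
    {v : ℕ × Fin d →₀ ℕ} (h : v ∈ (coeff α (splitRow k d z)).support) :
    Finsupp.mapDomain (Prod.mk 0) α + Finsupp.mapDomain (Prod.map Nat.succ id) v ∈ z.support := by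
  classical
  rw [mem_support_iff] at h
  rw [z.as_sum, map_sum, coeff_sum, coeff_sum] at h
  obtain ⟨w, hw, hne⟩ := Finset.exists_ne_zero_of_sum_ne_zero h
  obtain ⟨β, v', rfl⟩ := exists_eq_mapDomain_add w
  rw [splitRow_monomial, coeff_monomial] at hne
  split_ifs at hne with h1
  · rw [coeff_monomial] at hne
    split_ifs at hne with h2
    · rwa [← h1, ← h2]
    · exact absurd rfl hne
  · rw [coeff_zero] at hne
    exact absurd rfl hne

/-- A polynomial is recovered from its coefficients with respect to row zero. -/
theorem sum_splitRow (z : RowPoly k d) : ∑ α ∈ (splitRow k d z).support,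
    toRowZero (monomial α 1) * shiftRows (coeff α (splitRow k d z)) = z := by
  let Ψ : MvPolynomial (Fin d) (RowPoly k d) →+* RowPoly k d :=
    eval₂Hom (shiftRows (k := k) (d := d) : RowPoly k d →+* RowPoly k d) fun s => X (0, s)
  have h1 : ∀ z, Ψ (splitRow k d z) = z := by
    intro z
    induction z using MvPolynomial.induction_on with
    | C r =>
      rw [← algebraMap_eq, AlgHom.commutes, IsScalarTower.algebraMap_apply k
        (RowPoly k d), algebraMap_eq]
      change eval₂Hom _ _ (C _) = _
      rw [eval₂Hom_C]
      exact (shiftRows (k := k) (d := d)).commutes r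
    | add f g hf hg => rw [map_add, map_add, hf, hg]
    | mul_X f x hf =>
      obtain ⟨b, s⟩ := x
      rw [map_mul, map_mul, hf]
      congr 1
      rw [splitRow, aeval_X]
      by_cases hb : b = 0
      · subst hb
        simp [Ψ]
      · simp [Ψ, hb, shiftRows, Nat.sub_add_cancel (Nat.pos_of_ne_zero hb)]
  conv_rhs => rw [← h1 z]
  change _ = eval₂ _ _ _
  rw [eval₂_eq]
  refine Finset.sum_congr rfl fun α _ => ?_
  rw [mul_comm]
  congr 1
  rw [monomial_eq, map_mul, Finsupp.prod, map_prod, map_one, map_one, one_mul]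
  refine Finset.prod_congr rfl fun s _ => ?_
  rw [map_pow, toRowZero, rename_X]

theorem coeff_splitRow_mem {l : ℕ} {z : RowPoly k d} (hz : z ∈ cycles k d n 1 0 (l + 1))
    (α : Fin d →₀ ℕ) : coeff α (splitRow k d z) ∈ generators k d n l := by
  have hrow : ∀ v b, row (b + 1) (Finsupp.mapDomain (Prod.mk 0) α +
      Finsupp.mapDomain (Prod.map Nat.succ id) v) = row b v := by
    intro v b
    rw [map_add, row_mapDomain_zero, row_mapDomain_succ, if_neg (by omega), if_neg (by omega),
      zero_add, Nat.add_sub_cancel]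
  refine ⟨⟨fun v hv => ?_, fun a _ ha => ?_⟩, fun v hv => ?_⟩
  · obtain ⟨h1, h2⟩ := hz.1 _ (mem_support_of_mem_support_coeff_splitRow hv)
    obtain ⟨-, h4, h5⟩ := h2 (Nat.succ_pos l)
    refine ⟨fun a ha => ?_, fun hl => ⟨?_, fun a ha hal => ?_, ?_⟩⟩
    · rw [← hrow, h1 _ (by omega)]
    · rw [← hrow, h4 (0 + 1) (by omega) (by omega), add_zero]
    · rw [← hrow, h4 _ (by omega) (by omega)]
    · rwa [← hrow]
  · have := congrArg (coeff α) (splitRow_mergeRows a z)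
    rw [hz.2 (a + 1) (by omega) (by omega), map_zero, coeff_zero, coeff_map] at this
    exact this.symm
  · obtain ⟨h1, h2⟩ := hz.1 _ (mem_support_of_mem_support_coeff_splitRow hv)
    obtain ⟨-, h4, h5⟩ := h2 (Nat.succ_pos l)
    refine ⟨fun hl => ?_, fun hl => ?_⟩
    · rw [← hrow, h4 (0 + 1) (by omega) (by omega)]
    · subst hl
      rwa [← hrow]

theorem dvd_degree_of_mem_support_splitRow {l : ℕ} {z : RowPoly k d}
    (hz : z ∈ cycles k d n 1 0 (l + 1)) {α : Fin d →₀ ℕ} (hα : α ∈ (splitRow k d z).support) :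
    n ∣ α.degree := by
  obtain ⟨v, hv⟩ := support_nonempty.2 (mem_support_iff.1 hα)
  obtain ⟨-, h2⟩ := hz.1 _ (mem_support_of_mem_support_coeff_splitRow hv)
  obtain ⟨h3, -⟩ := h2 (Nat.succ_pos l)
  rwa [map_add, row_mapDomain_zero, row_mapDomain_succ, if_pos rfl, if_pos rfl] at h3

variable (k d n) in
/-- A generator of a syzygy as an element of the projective module which covers it. -/
noncomputable def shiftGenerator (l : ℕ) (w : generators k d n l) : syzygy k d n 1 (l + 1) :=
  ⟨shiftRows w.1, shiftRows_mem w.2⟩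

/-- The covering module is free: a `k`-basis of the space of generators of the syzygy, with its rows
shifted up, is a basis of it. -/
theorem syzygy_one_projective (l : ℕ) :
    Module.Projective (veronese k d n) (syzygy k d n 1 (l + 1)) := by
  let b := Module.Basis.ofVectorSpace k (generators k d n l)
  refine Module.Projective.of_basis (Module.Basis.mk
    (v := fun i => shiftGenerator k d n l (b i)) ?_ ?_)
  · rw [linearIndependent_iff']
    intro F g hg i hi
    have h0 : ∑ i ∈ F, toRowZero (g i).1 * shiftRows (b i).1 = 0 := by
      have := congrArg (syzygy k d n 1 (l + 1)).subtype hg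
      rw [map_sum, map_zero] at this
      exact this
    have h1 : ∀ α, ∑ i ∈ F, coeff α (g i).1 • (b i).1 = 0 := by
      intro α
      have := congrArg (fun z => coeff α (splitRow k d z)) h0
      simp only [map_sum, map_mul, map_zero, coeff_zero, coeff_sum, splitRow_toRowZero,
        splitRow_shiftRows] at this
      rw [← this]
      refine Finset.sum_congr rfl fun i _ => ?_
      rw [mul_comm, coeff_C_mul, coeff_map, mul_comm, Algebra.smul_def]
    refine Subtype.ext (MvPolynomial.ext _ _ fun α => ?_)
    have h2 : ∑ i ∈ F, coeff α (g i).1 • b i = 0 := by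
      refine Subtype.ext ?_
      rw [← Submodule.coe_subtype, map_sum]
      exact h1 α
    exact linearIndependent_iff'.1 b.linearIndependent F _ h2 i hi
  · rintro ⟨z, hz : z ∈ cycles k d n 1 0 (l + 1)⟩ -
    have hgen : ∀ w : generators k d n l, shiftGenerator k d n l w ∈
        Submodule.span (veronese k d n) (Set.range fun i => shiftGenerator k d n l (b i)) := by
      intro w
      have hw : w ∈ Submodule.span k (Set.range b) := b.span_eq ▸ Submodule.mem_top
      refine Submodule.span_induction (p := fun w _ => shiftGenerator k d n l w ∈
        Submodule.span (veronese k d n) (Set.range fun i => shiftGenerator k d n l (b i)))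
        ?_ ?_ ?_ ?_ hw
      · rintro _ ⟨i, rfl⟩
        exact Submodule.subset_span ⟨i, rfl⟩
      · have : shiftGenerator k d n l 0 = 0 := Subtype.ext (map_zero shiftRows)
        rw [this]
        exact zero_mem _
      · intro x y _ _ hx hy
        have : shiftGenerator k d n l (x + y) =
          shiftGenerator k d n l x + shiftGenerator k d n l y :=
          Subtype.ext (map_add shiftRows x.1 y.1)
        rw [this]
        exact add_mem hx hy
      · intro c x _ hx
        have : shiftGenerator k d n l (c • x) =
            algebraMap k (veronese k d n) c • shiftGenerator k d n l x := by
          refine Subtype.ext ?_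
          change shiftRows (c • x.1) =
            toRowZero (algebraMap k (MvPolynomial (Fin d) k) c) * shiftRows x.1
          rw [AlgHom.commutes, map_smul, Algebra.smul_def]
        rw [this]
        exact Submodule.smul_mem _ _ hx
    have hsum : (⟨z, hz⟩ : syzygy k d n 1 (l + 1)) = ∑ α ∈ (splitRow k d z).support.attach,
        (⟨monomial α.1 1, monomial_mem_veronese (dvd_degree_of_mem_support_splitRow hz α.2) 1⟩ :
          veronese k d n) • shiftGenerator k d n l ⟨_, coeff_splitRow_mem hz α.1⟩ := by
      refine Subtype.ext (Eq.trans ?_ (map_sum (syzygy k d n 1 (l + 1)).subtype _ _).symm)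
      exact ((Finset.sum_attach (splitRow k d z).support fun α =>
        toRowZero (monomial α 1) * shiftRows (coeff α (splitRow k d z))).trans
          (sum_splitRow z)).symm
    rw [hsum]
    exact Submodule.sum_mem _ fun α _ => Submodule.smul_mem _ _ (hgen _)

variable (k d) in
/-- The terms of the concrete resolution of `S`. -/
noncomputable abbrev syzygyModule (n l : ℕ) : ModuleCat.{u} (veronese k d n) :=
  ModuleCat.of (veronese k d n) (syzygy k d n 0 l)

variable (k d) in
/-- The concrete resolution of `S`. -/
noncomputable def syzygyPresentation (hn : 2 ≤ n) (l : ℕ) :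
    Presentation (syzygyModule k d n l) (syzygyModule k d n (l + 1)) where
  P := ModuleCat.of (veronese k d n) (syzygy k d n 1 (l + 1))
  π := syzygyπ k d n l
  ι := Submodule.inclusion (syzygy_succ_le (l + 1))
  projective := syzygy_one_projective l
  surjective := syzygyπ_surjective hn l
  injective := Submodule.inclusion_injective _
  exact := by
    ext ⟨z, hz⟩
    constructor
    · rintro ⟨y, hy⟩
      refine Subtype.ext ?_
      have : y.1 = z := congrArg Subtype.val hy
      change mergeRows 0 z = 0
      rw [← this]
      exact y.2.2 0 le_rfl (Nat.succ_pos l)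
    · intro h
      have h0 : mergeRows 0 z = 0 := congrArg Subtype.val (LinearMap.mem_ker.1 h)
      refine ⟨⟨z, hz.1, fun a _ ha => ?_⟩, rfl⟩
      rcases Nat.eq_zero_or_pos a with rfl | ha'
      · exact h0
      · exact hz.2 a ha' ha

theorem toRowZero_mem_syzygy (f : MvPolynomial (Fin d) k) :
    toRowZero f ∈ syzygy k d n 0 0 := by
  refine ⟨fun w hw => ⟨fun a ha => ?_, fun h => absurd h (lt_irrefl 0)⟩,
    fun a _ ha => absurd ha (Nat.not_lt_zero a)⟩
  obtain ⟨α, -, rfl⟩ := exists_of_mem_support_toRowZero hw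
  rw [row_mapDomain_zero, if_neg ha.ne']

variable (k d n) in
/-- The polynomial ring is the zeroth term of the concrete resolution. -/
noncomputable def syzygyZeroEquiv :
    syzygyModule k d n 0 ≃ₗ[veronese k d n] polyModule k d n :=
  LinearEquiv.symm (LinearEquiv.ofBijective
    { toFun := fun f => ⟨toRowZero f, toRowZero_mem_syzygy f⟩
      map_add' := fun f g => Subtype.ext (map_add toRowZero f g)
      map_smul' := fun r f => Subtype.ext (map_mul toRowZero r.1 f) }
    ⟨fun f g h => toRowZero_injective (congrArg Subtype.val h), fun z => by
      have : z.1 ∈ Set.range (toRowZero (k := k) (d := d)) := by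
        rw [z.1.as_sum]
        refine Subalgebra.sum_mem (AlgHom.range toRowZero) fun w hw => ?_
        obtain ⟨α, rfl⟩ := eq_mapDomain_of_row_eq_zero (z.2.1 w hw).1
        exact ⟨monomial α _, toRowZero_monomial _ _⟩
      obtain ⟨f, hf⟩ := this
      exact ⟨f, Subtype.ext hf⟩⟩)

end Freeness

/-! ### Multiplication by arrows as chain maps -/

section ChainMaps

variable {k : Type u} [Field k] {d n : ℕ}

/-- The part of a polynomial whose degree is congruent to `b` modulo `n`. -/
noncomputable def modComponent {σ : Type*} (n : ℕ) (b : ZMod n) :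
    MvPolynomial σ k →ₗ[k] MvPolynomial σ k :=
  weightedHomogeneousComponent (fun _ => (1 : ZMod n)) b

theorem weight_one_eq {σ : Type*} (w : σ →₀ ℕ) :
    Finsupp.weight (fun _ => (1 : ZMod n)) w = (w.degree : ZMod n) := by
  rw [Finsupp.weight_apply, Finsupp.degree_apply, Nat.cast_sum, Finsupp.sum]
  refine Finset.sum_congr rfl fun s _ => ?_
  rw [nsmul_eq_mul, mul_one]

theorem coeff_modComponent {σ : Type*} (b : ZMod n) (z : MvPolynomial σ k) (w : σ →₀ ℕ) :
    coeff w (modComponent n b z) = if (w.degree : ZMod n) = b then coeff w z else 0 := by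
  classical
  rw [modComponent, coeff_weightedHomogeneousComponent, weight_one_eq]

theorem modComponent_eq_zero {σ : Type*} {b : ZMod n} {z : MvPolynomial σ k}
    (h : ∀ w ∈ z.support, (w.degree : ZMod n) ≠ b) : modComponent n b z = 0 := by
  ext w
  rw [coeff_modComponent, coeff_zero]
  split_ifs with h'
  · by_contra hne
    exact h w (mem_support_iff.2 hne) h'
  · rfl

theorem modComponent_eq_self {σ : Type*} {b : ZMod n} {z : MvPolynomial σ k}
    (h : ∀ w ∈ z.support, (w.degree : ZMod n) = b) : modComponent n b z = z := by
  ext w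
  rw [coeff_modComponent]
  split_ifs with h'
  · rfl
  · by_contra hne
    exact h' (h w (mem_support_iff.2 (Ne.symm hne)))

theorem mem_support_of_mem_support_modComponent {σ : Type*} {b : ZMod n} {z : MvPolynomial σ k}
    {w : σ →₀ ℕ} (hw : w ∈ (modComponent n b z).support) :
    w ∈ z.support ∧ (w.degree : ZMod n) = b := by
  rw [mem_support_iff, coeff_modComponent] at hw
  split_ifs at hw with h
  · exact ⟨mem_support_iff.2 hw, h⟩
  · exact absurd rfl hw

theorem rename_modComponent {σ τ : Type*} (f : σ → τ) (b : ZMod n) (z : MvPolynomial σ k) :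
    rename f (modComponent n b z) = modComponent n b (rename f z) := by
  classical
  induction z using MvPolynomial.induction_on' with
  | add p q hp hq => simp only [map_add, hp, hq]
  | monomial w r =>
    rw [rename_monomial]
    have hdeg : (Finsupp.mapDomain f w).degree = w.degree := Finsupp.degree_mapDomain f w
    by_cases h : (w.degree : ZMod n) = b
    · rw [modComponent_eq_self, modComponent_eq_self, rename_monomial]
      · intro v hv
        rw [Finset.mem_singleton.1 (support_monomial_subset hv), hdeg, h]
      · intro v hv
        rw [Finset.mem_singleton.1 (support_monomial_subset hv), h]
    · rw [modComponent_eq_zero, modComponent_eq_zero, map_zero]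
      · intro v hv
        rwa [Finset.mem_singleton.1 (support_monomial_subset hv), hdeg]
      · intro v hv
        rwa [Finset.mem_singleton.1 (support_monomial_subset hv)]

theorem sum_modComponent {σ : Type*} (hn : 0 < n) (z : MvPolynomial σ k) :
    ∑ i ∈ Finset.range n, modComponent n (i : ZMod n) z = z := by
  classical
  ext w
  rw [coeff_sum]
  simp only [coeff_modComponent]
  rw [Finset.sum_eq_single (w.degree % n)]
  · rw [if_pos (ZMod.natCast_mod _ _).symm]
  · intro i hi hne
    rw [if_neg]
    intro h
    rw [ZMod.natCast_eq_natCast_iff'] at h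
    rw [Nat.mod_eq_of_lt (Finset.mem_range.1 hi)] at h
    exact hne h.symm
  · intro h
    exact absurd (Finset.mem_range.2 (Nat.mod_lt _ hn)) h

theorem degree_toRowZero_of_mem_support (r : veronese k d n) :
    ∀ w ∈ (toRowZero r.1 : RowPoly k d).support, (w.degree : ZMod n) = 0 := by
  intro w hw
  obtain ⟨α, hα, rfl⟩ := exists_of_mem_support_toRowZero hw
  rw [Finsupp.degree_mapDomain, ZMod.natCast_eq_zero_iff]
  exact dvd_degree_of_mem_support r hα

theorem modComponent_smul (b : ZMod n) (r : veronese k d n) (z : RowPoly k d) :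
    modComponent n b (toRowZero r.1 * z) = toRowZero r.1 * modComponent n b z := by
  classical
  have h1 : toRowZero r.1 * z = toRowZero r.1 * modComponent n b z +
      toRowZero r.1 * (z - modComponent n b z) := by ring
  have h2 : modComponent n b (toRowZero r.1 * (z - modComponent n b z)) = 0 := by
    refine modComponent_eq_zero ?_
    refine forall_mem_support_mul (B := fun w => (w.degree : ZMod n) ≠ b)
      (degree_toRowZero_of_mem_support r) (fun w hw => ?_) fun v w hv hw => ?_
    · intro h
      rw [mem_support_iff, coeff_sub, coeff_modComponent, if_pos h, sub_self] at hw
      exact hw rfl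
    · rwa [map_add, Nat.cast_add, hv, zero_add]
  rw [congrArg (modComponent n b) h1, map_add, h2, add_zero]
  refine modComponent_eq_self (forall_mem_support_mul (degree_toRowZero_of_mem_support r)
    (fun w hw => (mem_support_of_mem_support_modComponent hw).2) fun v w hv hw => ?_)
  rw [map_add, Nat.cast_add, hv, hw, zero_add]

theorem modComponent_mem_cycles {a₀ c l : ℕ} (b : ZMod n) {z : RowPoly k d}
    (hz : z ∈ cycles k d n a₀ c l) : modComponent n b z ∈ cycles k d n a₀ c l :=
  ⟨fun w hw => hz.1 w (mem_support_of_mem_support_modComponent hw).1, fun a h h' => by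
    rw [mergeRows, rename_modComponent, ← mergeRows, hz.2 a h h', map_zero]⟩

variable (k d) in
/-- A family of polynomials, one for each row, which by multiplication maps the parts of the
syzygies of degree congruent to `b` to the syzygies `c` steps further. -/
structure Multiplier (n b c : ℕ) where
  poly : ℕ → RowPoly k d
  mem : ∀ a₀ l, a₀ ≤ l → ∀ y ∈ cycles k d n a₀ 0 l, (∀ w ∈ y.support, (w.degree : ZMod n) = b) →
    poly l * y ∈ cycles k d n a₀ 0 (c + l)
  merge : ∀ l, mergeRows 0 (poly (l + 1)) = poly l

namespace Multiplier

variable {b c : ℕ} (μ : Multiplier k d n b c)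

/-- Multiplication of the part of degree congruent to `b` by the polynomial for row `l`. -/
noncomputable def map (a₀ l : ℕ) (h : a₀ ≤ l) :
    syzygy k d n a₀ l →ₗ[veronese k d n] syzygy k d n a₀ (c + l) where
  toFun y := ⟨μ.poly l * modComponent n (b : ZMod n) y.1,
    μ.mem a₀ l h _ (modComponent_mem_cycles _ y.2) fun _ hw =>
      (mem_support_of_mem_support_modComponent hw).2⟩
  map_add' x y := Subtype.ext (by
    change μ.poly l * modComponent n (b : ZMod n) (x.1 + y.1) = μ.poly l * _ + μ.poly l * _
    rw [map_add, mul_add])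
  map_smul' r x := Subtype.ext (by
    change μ.poly l * modComponent n (b : ZMod n) (toRowZero r.1 * x.1) =
      toRowZero r.1 * (μ.poly l * _)
    rw [modComponent_smul, mul_left_comm])

/-- Multiplication by the polynomials of a multiplier is a chain map of the concrete resolution. -/
theorem isLift (hn : 2 ≤ n) (m : ℕ) :
    Presentation.IsLift (syzygyPresentation k d hn m) (syzygyPresentation k d hn (c + m))
      (μ.map 0 m (Nat.zero_le m)) (μ.map 0 (m + 1) (Nat.zero_le _)) := by
  refine ⟨μ.map 1 (m + 1) (by omega), LinearMap.ext fun y => Subtype.ext ?_, rfl⟩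
  change mergeRows 0 (μ.poly (m + 1) * modComponent n (b : ZMod n) y.1) =
    μ.poly m * modComponent n (b : ZMod n) (mergeRows 0 y.1)
  rw [map_mul, μ.merge, mergeRows, rename_modComponent]

end Multiplier

variable (k d) in
/-- The idempotent of a vertex as a multiplier. -/
noncomputable def vertexMultiplier (n b : ℕ) : Multiplier k d n b 0 where
  poly _ := 1
  mem a₀ l _ y hy _ := by rwa [one_mul, zero_add]
  merge _ := map_one _

variable (k) in
/-- An arrow as a multiplier. The part of degree congruent to `i` has degree `i` in the last row, so
that multiplication by the polynomial of an arrow `x_{st}` completes this row to degree `n`. -/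
noncomputable def arrowMultiplier {i j : QVertex d n} (e : QArrow d n i j) :
    Multiplier k d n i.1 e.crossing where
  poly l := e.poly k l
  mem a₀ l hl y hy hdeg := by
    have hi := i.pos
    have hin := i.lt
    have hjn := j.lt
    refine ⟨?_, fun a ha hal => ?_⟩
    · refine forall_mem_support_mul (e.row_of_mem_support_poly k l)
        (fun w hw => And.intro (hy.1 w hw) (hdeg w hw)) ?_
      rintro v w hv ⟨hw, hwi⟩
      have hlast : 0 < l → row l w = i.1 := by
        intro hl
        have h1 := hw.degree_modEq hl
        rw [← ZMod.natCast_eq_natCast_iff, hwi, ZMod.natCast_eq_natCast_iff] at h1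
        exact (Nat.ModEq.eq_of_lt_of_lt h1 hin (hw.2 hl).2.2).symm
      have hrow : ∀ a, row a (v + w) = row a (e.leadingMon l) + row a w := fun a => by
        rw [map_add, hv]
      rcases e with ⟨h, s⟩ | ⟨h1, h2, s, t, hst⟩
      · simp only [QArrow.crossing, QArrow.leadingMon, row_single, zero_add] at hrow ⊢
        refine ⟨fun a ha => ?_, fun hl => ?_⟩
        · rw [hrow, if_neg (by omega), hw.1 a ha]
        · obtain ⟨h3, h4, h5⟩ := hw.2 hl
          refine ⟨?_, fun a ha hal => ?_, ?_⟩
          · rwa [hrow, if_neg (by omega), zero_add]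
          · rw [hrow, if_neg (by omega), h4 a ha hal, zero_add]
          · rw [hrow, if_pos rfl, hlast hl]
            omega
      · have hlead : ∀ a, row a (v + w) =
            ((if l = a then 1 else 0) + if l + 1 = a then 1 else 0) + row a w := fun a => by
          rw [hrow a, QArrow.leadingMon, map_add, row_single, row_single]
        clear hrow
        rename' hlead => hrow
        simp only [QArrow.crossing]
        refine ⟨fun a ha => ?_, fun _ => ⟨?_, fun a ha hal => ?_, ?_⟩⟩
        · rw [hrow, if_neg (by omega), if_neg (by omega), hw.1 a (by omega)]
        · rw [hrow, if_neg (by omega : ¬ l + 1 = 0), add_zero, add_zero]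
          rcases Nat.eq_zero_or_pos l with rfl | hl
          · have h3 : w.degree = row 0 w := by
              rw [degree_eq_sum_row hw.1, Finset.sum_range_one]
            rw [h3] at hwi
            rw [if_pos rfl, ← ZMod.natCast_eq_zero_iff, Nat.cast_add, hwi, ← Nat.cast_add,
              add_comm, h1, ZMod.natCast_self]
          · rw [if_neg (by omega), zero_add]
            exact (hw.2 hl).1
        · rw [hrow, if_neg (by omega : ¬ l + 1 = a), add_zero]
          rcases Nat.lt_or_ge a l with hal' | hal'
          · rw [if_neg (by omega), zero_add]
            exact (hw.2 (by omega)).2.1 a ha hal'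
          · obtain rfl : l = a := by omega
            rw [if_pos rfl, hlast ha]
            omega
        · rw [hrow, if_neg (by omega), if_pos (by omega), hw.1 _ (by omega)]
          omega
    · rw [map_mul]
      rcases e with ⟨h, s⟩ | ⟨h1, h2, s, t, hst⟩
      · simp only [QArrow.crossing, zero_add] at hal
        rw [hy.2 a ha hal, mul_zero]
      · simp only [QArrow.crossing] at hal
        rcases Nat.lt_or_ge a l with hal' | hal'
        · rw [hy.2 a ha hal', mul_zero]
        · obtain rfl : l = a := by omega
          rw [QArrow.poly, mergeRows_minor, zero_mul]
  merge l := by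
    have h1 : merge 0 (l + 1) = l := by simp [merge]
    have h2 : merge 0 (l + 1 + 1) = l + 1 := by simp [merge]
    rcases e with ⟨h, s⟩ | ⟨_, _, s, t, hst⟩ <;> simp [QArrow.poly, mergeRows_X, h1, h2]

theorem degree_of_mem_support_pathPoly {i j : QVertex d n} (p : Quiver.Path i j) :
    ∀ w ∈ (pathPoly k p).support, ((i.1 + w.degree : ℕ) : ZMod n) = (j.1 : ℕ) := by
  classical
  induction p with
  | nil =>
    intro w hw
    rw [pathPoly, support_one, Finset.mem_singleton] at hw
    rw [hw, map_zero, add_zero]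
  | @cons b c p e ih =>
    refine forall_mem_support_mul (B := fun w => ((b.1 + w.degree : ℕ) : ZMod n) = (c.1 : ℕ))
      ih ?_ fun v w hv hw => ?_
    · rcases e with ⟨h, s⟩ | ⟨h1, h2, s, t, hst⟩
      · intro w hw
        simp only [QArrow.poly, support_X, Finset.mem_singleton] at hw
        rw [hw, Finsupp.degree_single, h]
      · intro w hw
        simp only [QArrow.poly] at hw
        rw [X, X, X, X, monomial_mul, monomial_mul] at hw
        rcases Finset.mem_union.1 (support_sub _ _ _ hw) with h | h <;>
        · rw [Finset.mem_singleton.1 (support_monomial_subset h), map_add, Finsupp.degree_single,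
            Finsupp.degree_single, ← add_assoc, h1, h2, Nat.cast_add, ZMod.natCast_self, zero_add]
    · rw [map_add, ← add_assoc, Nat.cast_add, hv, ← Nat.cast_add, hw]

/-- The map from `S` to a syzygy which multiplies the part of degree congruent to `i` by a given
polynomial. -/
noncomputable def multMap (i l : ℕ) (z : cycles k d n 0 i l) :
    polyModule k d n →ₗ[veronese k d n] syzygyModule k d n l where
  toFun f := ⟨toRowZero (projM k d n i f) * z.1, toRowZero_mul_mem_cycles (fun α hα => by
    have : (α.degree : ZMod n) = i := (mem_support_of_mem_support_modComponent hα).2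
    rwa [add_zero, ← ZMod.natCast_eq_natCast_iff]) z.2⟩
  map_add' f g := Subtype.ext (by
    change toRowZero (projM k d n i (f + g)) * z.1 =
      toRowZero (projM k d n i f) * z.1 + toRowZero (projM k d n i g) * z.1
    rw [map_add, ← add_mul]
    congr 1
    exact map_add toRowZero _ _)
  map_smul' r f := Subtype.ext (by
    change toRowZero (projM k d n i (r • f)) * z.1 =
      toRowZero r.1 * (toRowZero (projM k d n i f) * z.1)
    rw [map_smul, ← mul_assoc, ← map_mul]
    rfl)

theorem multMap_apply (i l : ℕ) (z : cycles k d n 0 i l) (f : MvPolynomial (Fin d) k) :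
    (multMap i l z f).1 = toRowZero (modComponent n (i : ZMod n) f) * z.1 := rfl

end ChainMaps

/-! ### The images of paths -/

section AlgebraMap

variable {k : Type u} [Field k] {d n : ℕ} (hn : 2 ≤ n)
  (p : ProjectivePresentations (veronese k d n))

/-- The element of `Γ` given by a map from `S` to a term of the concrete resolution. -/
noncomputable def gammaClass (l : ℕ) (f : polyModule k d n →ₗ[veronese k d n] syzygyModule k d n l) :
    Gamma k d n p :=
  resolutionClass p (syzygyPresentation k d hn) (syzygyZeroEquiv k d n) l f

theorem gammaClass_congr {l l' : ℕ} (h : l = l')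
    {f : polyModule k d n →ₗ[veronese k d n] syzygyModule k d n l}
    {g : polyModule k d n →ₗ[veronese k d n] syzygyModule k d n l'}
    (hfg : ∀ s, (f s).1 = (g s).1) : gammaClass hn p l f = gammaClass hn p l' g := by
  subst h
  exact congrArg _ (LinearMap.ext fun s => Subtype.ext (hfg s))

/-- The element of `Γ` given by multiplication of the part of degree congruent to `i`. -/
noncomputable def gammaMap (i l : ℕ) : cycles k d n 0 i l →ₗ[k] Gamma k d n p where
  toFun z := gammaClass hn p l (multMap i l z)
  map_add' x y := by
    refine (congrArg (gammaClass hn p l) (LinearMap.ext fun f => Subtype.ext ?_)).trans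
      (resolutionClass_add l (multMap i l x) (multMap i l y))
    exact mul_add _ x.1 y.1
  map_smul' c x := by
    refine resolutionClass_eq_smul (r := algebraMap k (veronese k d n) c) fun f => Subtype.ext ?_
    change toRowZero (projM k d n i f) * (c • x.1) =
      toRowZero (algebraMap k (MvPolynomial (Fin d) k) c) * (toRowZero (projM k d n i f) * x.1)
    rw [AlgHom.commutes, mul_smul_comm, Algebra.smul_def]

/-- The element of `Γ` given by a multiplier. -/
noncomputable def multiplierClass {b c : ℕ} (μ : Multiplier k d n b c) : Gamma k d n p :=
  gammaClass hn p c (μ.map 0 0 le_rfl ∘ₗ (syzygyZeroEquiv k d n).symm.toLinearMap)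

theorem multiplierClass_mul {b c : ℕ} (μ : Multiplier k d n b c) {m : ℕ}
    (f : polyModule k d n →ₗ[veronese k d n] syzygyModule k d n m) :
    multiplierClass hn p μ * gammaClass hn p m f =
      gammaClass hn p (c + m) (μ.map 0 m (Nat.zero_le m) ∘ₗ f) :=
  resolutionClass_mul (Y := syzygyModule k d n) (res := syzygyPresentation k d hn)
    (fun m => μ.map 0 m (Nat.zero_le m)) (μ.isLift hn) f

theorem degree_toRowZero_modComponent {i : ℕ} {z : RowPoly k d} {b : ZMod n}
    (hdeg : ∀ w ∈ z.support, ((i + w.degree : ℕ) : ZMod n) = b) (f : MvPolynomial (Fin d) k) :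
    ∀ w ∈ (toRowZero (modComponent n (i : ZMod n) f) * z).support, (w.degree : ZMod n) = b := by
  refine forall_mem_support_mul (fun w hw => exists_of_mem_support_toRowZero hw) hdeg ?_
  rintro _ w ⟨α, hα, rfl⟩ hw
  rw [map_add, Finsupp.degree_mapDomain, Nat.cast_add,
    (mem_support_of_mem_support_modComponent hα).2, ← Nat.cast_add, hw]

theorem multiplierClass_mul_gammaMap {b c i l l' : ℕ} (μ : Multiplier k d n b c)
    (z : cycles k d n 0 i l) (hdeg : ∀ w ∈ z.1.support, ((i + w.degree : ℕ) : ZMod n) = (b : ℕ))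
    (hl : c + l = l') (z' : cycles k d n 0 i l') (hz : z'.1 = z.1 * μ.poly l) :
    multiplierClass hn p μ * gammaMap hn p i l z = gammaMap hn p i l' z' := by
  refine (multiplierClass_mul hn p μ _).trans (gammaClass_congr hn p hl fun f => ?_)
  change μ.poly l * modComponent n (b : ZMod n) (toRowZero (modComponent n (i : ZMod n) f) * z.1) =
    toRowZero (modComponent n (i : ZMod n) f) * z'.1
  rw [modComponent_eq_self (degree_toRowZero_modComponent hdeg f), hz]
  ring

theorem multiplierClass_mul_gammaMap_eq_zero {b c i l j : ℕ} (μ : Multiplier k d n b c)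
    (z : cycles k d n 0 i l) (hdeg : ∀ w ∈ z.1.support, ((i + w.degree : ℕ) : ZMod n) = (j : ℕ))
    (hb : (j : ZMod n) ≠ b) : multiplierClass hn p μ * gammaMap hn p i l z = 0 := by
  refine (multiplierClass_mul hn p μ _).trans ?_
  have : μ.map 0 l (Nat.zero_le l) ∘ₗ multMap i l z = 0 := by
    refine LinearMap.ext fun f => Subtype.ext ?_
    change μ.poly l * modComponent n (b : ZMod n)
      (toRowZero (modComponent n (i : ZMod n) f) * z.1) = 0
    rw [modComponent_eq_zero, mul_zero]
    intro w hw
    rwa [degree_toRowZero_modComponent hdeg f w hw]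
  exact (congrArg _ this).trans (resolutionClass_eq_zero (zero_mem _))

theorem ofEnd_eq_gammaClass (f : polyModule k d n →ₗ[veronese k d n] polyModule k d n)
    (g : polyModule k d n →ₗ[veronese k d n] syzygyModule k d n 0)
    (h : ∀ s : MvPolynomial (Fin d) k, toRowZero (f s : MvPolynomial (Fin d) k) = (g s).1) :
    Gamma.ofEnd p f = gammaClass hn p 0 g := by
  refine congrArg (fun f => Gamma.of p 0 (StableHom.mk f)) (LinearMap.ext fun s => ?_)
  refine ((LinearEquiv.symm_apply_eq (syzygyZeroEquiv k d n)).1 (Subtype.ext ?_))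
  exact h s

theorem multiplierClass_vertexMultiplier (b : ℕ) :
    multiplierClass hn p (vertexMultiplier k d n b) = Gamma.ofEnd p (projM k d n b) := by
  refine (ofEnd_eq_gammaClass hn p _ _ fun s => ?_).symm
  change toRowZero (modComponent n (b : ZMod n) s) =
    1 * modComponent n (b : ZMod n) (toRowZero s)
  rw [one_mul, toRowZero, rename_modComponent]

/-- The image of a path in `Γ`. -/
noncomputable def pathImage {i : QVertex d n} : ∀ {j : QVertex d n}, Quiver.Path i j → Gamma k d n p
  | _, .nil => Gamma.ofEnd p (projM k d n i.1)
  | _, .cons q e => multiplierClass hn p (arrowMultiplier k e) * pathImage q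

theorem pathImage_eq_gammaMap {i j : QVertex d n} (q : Quiver.Path i j) :
    pathImage hn p q = gammaMap hn p i.1 (crossings q) ⟨pathPoly k q, pathPoly_mem_cycles q⟩ := by
  induction q with
  | nil =>
    refine ofEnd_eq_gammaClass hn p _ _ fun s => ?_
    exact (mul_one _).symm
  | cons q e ih =>
    rw [pathImage, ih]
    exact multiplierClass_mul_gammaMap hn p _ _ (degree_of_mem_support_pathPoly q)
      (add_comm _ _) _ rfl

theorem natCast_vertex_injective {i j : QVertex d n} (h : (i.1 : ZMod n) = (j.1 : ZMod n)) :
    i = j := by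
  rw [ZMod.natCast_eq_natCast_iff] at h
  exact Subtype.ext (Nat.ModEq.eq_of_lt_of_lt h i.lt j.lt)

theorem ofEnd_mul_pathImage {i j : QVertex d n} (q : Quiver.Path i j) :
    Gamma.ofEnd p (projM k d n j.1) * pathImage hn p q = pathImage hn p q := by
  rw [pathImage_eq_gammaMap, ← multiplierClass_vertexMultiplier hn]
  exact multiplierClass_mul_gammaMap hn p _ _ (degree_of_mem_support_pathPoly q) (zero_add _) _
    (mul_one _).symm

theorem ofEnd_mul_pathImage_eq_zero {i j b : QVertex d n} (q : Quiver.Path i j) (hb : j ≠ b) :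
    Gamma.ofEnd p (projM k d n b.1) * pathImage hn p q = 0 := by
  rw [pathImage_eq_gammaMap, ← multiplierClass_vertexMultiplier hn]
  exact multiplierClass_mul_gammaMap_eq_zero hn p _ _ (degree_of_mem_support_pathPoly q)
    fun h => hb (natCast_vertex_injective h)

theorem pathImage_mul_ofEnd {i j : QVertex d n} (q : Quiver.Path i j) :
    pathImage hn p q * Gamma.ofEnd p (projM k d n i.1) = pathImage hn p q := by
  induction q with
  | nil => exact ofEnd_mul_pathImage hn p .nil
  | cons q e ih => rw [pathImage, mul_assoc, ih]

theorem pathImage_comp {i j l : QVertex d n} (q : Quiver.Path i j) (q' : Quiver.Path j l) :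
    pathImage hn p (q.comp q') = pathImage hn p q' * pathImage hn p q := by
  induction q' with
  | nil => exact (ofEnd_mul_pathImage hn p q).symm
  | cons q' e ih => rw [Quiver.Path.comp_cons, pathImage, pathImage, ih, mul_assoc]

theorem pathImage_mul_pathImage_eq_zero {i j i' j' : QVertex d n} (q : Quiver.Path i j)
    (q' : Quiver.Path i' j') (h : j ≠ i') : pathImage hn p q' * pathImage hn p q = 0 := by
  rw [← pathImage_mul_ofEnd hn p q', mul_assoc, ofEnd_mul_pathImage_eq_zero hn p q h, mul_zero]

theorem ofEnd_add (f g : polyModule k d n →ₗ[veronese k d n] polyModule k d n) :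
    Gamma.ofEnd p (f + g) = Gamma.ofEnd p f + Gamma.ofEnd p g := by
  exact (congrArg (Gamma.of p 0) (StableHom.mk_add f g)).trans (map_add (Gamma.of p 0) _ _)

theorem ofEnd_sum {ι : Type*} (F : Finset ι)
    (f : ι → (polyModule k d n →ₗ[veronese k d n] polyModule k d n)) :
    Gamma.ofEnd p (∑ i ∈ F, f i) = ∑ i ∈ F, Gamma.ofEnd p (f i) :=
  map_sum (AddMonoidHom.mk' (Gamma.ofEnd p) (ofEnd_add p)) f F

/-- The module `M_0` is the ring itself. -/
theorem projM_zero_mem_projectiveMaps :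
    projM k d n 0 ∈ projectiveMaps (polyModule k d n) (polyModule k d n) := by
  refine ⟨ModuleCat.of (veronese k d n) (veronese k d n),
    inferInstanceAs (Module.Projective (veronese k d n) (veronese k d n)),
    { toFun := fun s => ⟨projM k d n 0 s, ?_⟩
      map_add' := fun s t => Subtype.ext (map_add (projM k d n 0) s t)
      map_smul' := fun r s => Subtype.ext (map_smul (projM k d n 0) r s) },
    { toFun := fun r => (r.1 : MvPolynomial (Fin d) k)
      map_add' := fun _ _ => rfl
      map_smul' := fun _ _ => rfl }, rfl⟩
  have := weightedHomogeneousComponent_isWeightedHomogeneous (w := degMod d n) ((0 : ℕ) : ZMod n)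
    (s : MvPolynomial (Fin d) k)
  rw [Nat.cast_zero] at this
  change IsWeightedHomogeneous (degMod d n)
    (weightedHomogeneousComponent (degMod d n) ((0 : ℕ) : ZMod n) (s : MvPolynomial (Fin d) k)) 0
  rwa [Nat.cast_zero]

end AlgebraMap

/-! ### The homomorphism from the quiver algebra -/

section PathAlgebra

variable {k V A : Type*} [Field k] [Quiver V] [Fintype V] [Ring A] [Algebra k A]

/-- The algebra homomorphism prescribed on the basis of paths by a multiplicative function. -/
noncomputable def PathAlgebra.liftAlgHom (F : AnyPath V → A)
    (h1 : ∑ i : V, F ⟨i, i, .nil⟩ = 1)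
    (hmul : ∀ {i j l : V} (q : Quiver.Path i j) (q' : Quiver.Path j l),
      F ⟨i, l, q.comp q'⟩ = F ⟨j, l, q'⟩ * F ⟨i, j, q⟩)
    (hzero : ∀ {i j i' j' : V} (q : Quiver.Path i j) (q' : Quiver.Path i' j'), j ≠ i' →
      F ⟨i', j', q'⟩ * F ⟨i, j, q⟩ = 0) : PathAlgebra k V →ₐ[k] A :=
  AlgHom.ofLinearMap (PathAlgebra.lift F)
    (by
      rw [PathAlgebra.one_eq, map_sum, ← h1]
      exact Finset.sum_congr rfl fun i _ => PathAlgebra.lift_ofPath F _)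
    (by
      have key : PathAlgebra.mulₗ.compr₂ (PathAlgebra.lift (k := k) F) =
          (LinearMap.mul k A).compl₁₂ (PathAlgebra.lift F) (PathAlgebra.lift F) := by
        refine PathAlgebra.hom_ext fun q' => PathAlgebra.hom_ext fun q => ?_
        change PathAlgebra.lift F (PathAlgebra.ofPath q' * PathAlgebra.ofPath q) =
          PathAlgebra.lift F (PathAlgebra.ofPath q') * PathAlgebra.lift F (PathAlgebra.ofPath q)
        rw [PathAlgebra.lift_ofPath, PathAlgebra.lift_ofPath, PathAlgebra.ofPath_mul_ofPath]
        obtain ⟨b', c, q'⟩ := q'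
        obtain ⟨a, b, q⟩ := q
        by_cases h : b = b'
        · subst h
          rw [PathAlgebra.pathMul_comp, PathAlgebra.lift_ofPath, hmul]
        · rw [PathAlgebra.pathMul_ne h, map_zero, hzero q q' h]
      exact fun x y => LinearMap.congr_fun₂ key x y)

end PathAlgebra

section UnitDecomposition

variable {k : Type u} [Field k] {d n : ℕ} (p : ProjectivePresentations (veronese k d n))

/-- The vertices `1, …, n - 1` suffice for a decomposition of the unit, since `M_0` is
projective. -/
theorem sum_ofEnd_projM (hn : 2 ≤ n) : ∑ i : QVertex d n, Gamma.ofEnd p (projM k d n i.1) = 1 := by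
  have h1 : ∑ i : QVertex d n, Gamma.ofEnd p (projM k d n i.1) =
      ∑ i ∈ Finset.Ico 1 n, Gamma.ofEnd p (projM k d n i) :=
    Finset.sum_coe_sort (Finset.Ico 1 n) fun i => Gamma.ofEnd p (projM k d n i)
  have h0 : Gamma.ofEnd p (projM k d n 0) = 0 :=
    (congrArg (Gamma.of p 0) ((Submodule.Quotient.mk_eq_zero _).2
      projM_zero_mem_projectiveMaps)).trans (map_zero _)
  have h2 : ∑ i ∈ Finset.range n, Gamma.ofEnd p (projM k d n i) = 1 := by
    rw [← ofEnd_sum]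
    refine congrArg (fun f => Gamma.of p 0 (StableHom.mk f)) (LinearMap.ext fun s => ?_)
    rw [LinearMap.sum_apply]
    exact sum_modComponent (by omega) s
  rw [h1, ← h2, Finset.range_eq_Ico, Finset.sum_eq_sum_Ico_succ_bot (show 0 < n by omega), h0,
    zero_add]

end UnitDecomposition

section QuiverAlgHom

variable {k : Type u} [Field k] {d n : ℕ} (hn : 2 ≤ n)
  (p : ProjectivePresentations (veronese k d n))

/-- The algebra homomorphism from the path algebra to `Γ`. -/
noncomputable def pathAlgHom : PathAlgebra k (QVertex d n) →ₐ[k] Gamma k d n p :=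
  PathAlgebra.liftAlgHom (fun q => pathImage hn p q.2.2) (sum_ofEnd_projM p hn)
    (fun q q' => pathImage_comp hn p q q')
    (fun q q' h => pathImage_mul_pathImage_eq_zero hn p q q' h)

theorem pathAlgHom_ofPath (q : AnyPath (QVertex d n)) :
    pathAlgHom hn p (PathAlgebra.ofPath q) = pathImage hn p q.2.2 :=
  PathAlgebra.lift_ofPath _ q

/-- A product of two arrows acts through the product of their polynomials. -/
theorem pathAlgHom_arrow_mul_arrow {i j l : QVertex d n} (e : QArrow d n i j) (f : QArrow d n j l) :
    ∃ h, pathAlgHom hn p (PathAlgebra.arrow k (a := j) (b := l) f *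
      PathAlgebra.arrow k (a := i) (b := j) e) =
      gammaMap hn p i.1 (e.crossing + f.crossing)
        ⟨e.poly k 0 * f.poly k e.crossing, h⟩ := by
  let q : Quiver.Path i l := (Quiver.Path.nil.cons e).cons f
  have h0 : crossings q = e.crossing + f.crossing := by
    simp only [q, crossings, zero_add]
  have h1 : pathPoly k q = e.poly k 0 * f.poly k e.crossing := by
    simp only [q, pathPoly, crossings, zero_add, one_mul]
  refine ⟨h1 ▸ h0 ▸ pathPoly_mem_cycles q, ?_⟩
  rw [PathAlgebra.arrow, PathAlgebra.arrow, PathAlgebra.ofPath_mul_ofPath,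
    PathAlgebra.pathMul_comp, pathAlgHom_ofPath]
  refine (pathImage_eq_gammaMap hn p q).trans (gammaClass_congr hn p h0 fun s => ?_)
  rw [multMap_apply, multMap_apply]
  exact congrArg (toRowZero (modComponent n (i.1 : ZMod n) s) * ·) h1

/-- The relations hold in `Γ`, since they are identities between products of variables and minors:
commutativity, the expansions of a `3 × 3` determinant with a repeated row, and for `n = 2` a
linear relation between products of `2 × 2` minors of three rows. -/
theorem pathAlgHom_eq_of_rel {x y : PathAlgebra k (QVertex d n)} (h : QRel k x y) :
    pathAlgHom hn p x = pathAlgHom hn p y := by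
  have hz : ∀ {i l : ℕ} (z : cycles k d n 0 i l), z.1 = 0 → gammaMap hn p i l z = 0 :=
    fun z hz => by
      obtain rfl : z = 0 := Subtype.ext hz
      exact map_zero _
  cases h with
  | comm hij hjl hst =>
    rename_i s t
    obtain ⟨m1, e1⟩ := pathAlgHom_arrow_mul_arrow hn p (QArrow.x hij t) (QArrow.x hjl s)
    obtain ⟨m2, e2⟩ := pathAlgHom_arrow_mul_arrow hn p (QArrow.x hij s) (QArrow.x hjl t)
    simp only [arrowX]
    rw [e1, e2]
    refine congrArg _ (Subtype.ext ?_)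
    simp only [QArrow.poly, QArrow.crossing]
    ring
  | left hm hi hij hst htu =>
    rename_i s t u
    obtain ⟨m1, e1⟩ := pathAlgHom_arrow_mul_arrow hn p (QArrow.xx hm hi t u htu) (QArrow.x hij s)
    obtain ⟨m2, e2⟩ := pathAlgHom_arrow_mul_arrow hn p (QArrow.xx hm hi s u (hst.trans htu))
      (QArrow.x hij t)
    obtain ⟨m3, e3⟩ := pathAlgHom_arrow_mul_arrow hn p (QArrow.xx hm hi s t hst) (QArrow.x hij u)
    simp only [arrowX, arrowXX]
    rw [map_add, map_sub, e1, e2, e3, map_zero]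
    have := hz (⟨_, m1⟩ - ⟨_, m2⟩ + ⟨_, m3⟩) (by
      change _ * _ - _ * _ + _ * _ = (0 : RowPoly k d)
      simp only [QArrow.poly, QArrow.crossing]
      ring)
    rw [map_add, map_sub] at this
    exact this
  | right hlm hm hi hst htu =>
    rename_i s t u
    obtain ⟨m1, e1⟩ := pathAlgHom_arrow_mul_arrow hn p (QArrow.x hlm u) (QArrow.xx hm hi s t hst)
    obtain ⟨m2, e2⟩ := pathAlgHom_arrow_mul_arrow hn p (QArrow.x hlm t)
      (QArrow.xx hm hi s u (hst.trans htu))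
    obtain ⟨m3, e3⟩ := pathAlgHom_arrow_mul_arrow hn p (QArrow.x hlm s) (QArrow.xx hm hi t u htu)
    simp only [arrowX, arrowXX]
    rw [map_add, map_sub, e1, e2, e3, map_zero]
    have := hz (⟨_, m1⟩ - ⟨_, m2⟩ + ⟨_, m3⟩) (by
      change _ * _ - _ * _ + _ * _ = (0 : RowPoly k d)
      simp only [QArrow.poly, QArrow.crossing]
      ring)
    rw [map_add, map_sub] at this
    exact this
  | quad hn2 hm hi hst htu huv =>
    rename_i s t u v
    have pair : ∀ {s t u v : Fin d} (h : s < t) (h' : u < v), _ := fun {s t u v} h h' =>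
      pathAlgHom_arrow_mul_arrow hn p (QArrow.xx hm hi s t h) (QArrow.xx hm hi u v h')
    obtain ⟨m1, e1⟩ := pair hst huv
    obtain ⟨m2, e2⟩ := pair (hst.trans htu) (htu.trans huv)
    obtain ⟨m3, e3⟩ := pair (hst.trans (htu.trans huv)) htu
    obtain ⟨m4, e4⟩ := pair htu (hst.trans (htu.trans huv))
    obtain ⟨m5, e5⟩ := pair (htu.trans huv) (hst.trans htu)
    obtain ⟨m6, e6⟩ := pair huv hst
    simp only [arrowXX]
    rw [map_add, map_sub, map_add, map_add, map_sub, e1, e2, e3, e4, e5, e6, map_zero]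
    have := hz (⟨_, m1⟩ - ⟨_, m2⟩ + ⟨_, m3⟩ + ⟨_, m4⟩ - ⟨_, m5⟩ + ⟨_, m6⟩) (by
      change _ * _ - _ * _ + _ * _ + _ * _ - _ * _ + _ * _ = (0 : RowPoly k d)
      simp only [QArrow.poly, QArrow.crossing]
      ring)
    rw [map_add, map_sub, map_add, map_add, map_sub] at this
    exact this

/-- The algebra homomorphism from the quiver algebra with relations to `Γ`. -/
noncomputable def quiverAlgHom : QuiverAlgebra k d n →ₐ[k] Gamma k d n p :=
  RingQuot.liftAlgHom k ⟨pathAlgHom hn p, fun _ _ h => pathAlgHom_eq_of_rel hn p h⟩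

theorem quiverAlgHom_mk (x : PathAlgebra k (QVertex d n)) :
    quiverAlgHom hn p (QuiverAlgebra.mk k x) = pathAlgHom hn p x :=
  RingQuot.liftAlgHom_mkAlgHom_apply k _ _ x

theorem quiverAlgHom_pathClass {i j : QVertex d n} (q : Quiver.Path i j) :
    quiverAlgHom hn p (pathClass k q) = pathImage hn p q :=
  (quiverAlgHom_mk hn p _).trans (pathAlgHom_ofPath hn p _)

theorem quiverAlgHom_arrow {i j : QVertex d n} (e : QArrow d n i j) :
    quiverAlgHom hn p (QuiverAlgebra.mk k (PathAlgebra.arrow k (a := i) (b := j) e)) =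
      multiplierClass hn p (arrowMultiplier k e) := by
  rw [quiverAlgHom_mk, PathAlgebra.arrow, pathAlgHom_ofPath]
  change multiplierClass hn p (arrowMultiplier k e) * Gamma.ofEnd p (projM k d n i.1) = _
  rw [ofEnd_eq_gammaClass hn p (projM k d n i.1) (multMap i.1 0 ⟨1, pathPoly_mem_cycles .nil⟩)
    fun s => (mul_one _).symm]
  refine (multiplierClass_mul hn p _ _).trans (gammaClass_congr hn p rfl fun s => ?_)
  change e.poly k 0 * modComponent n (i.1 : ZMod n) (toRowZero (modComponent n (i.1 : ZMod n) s) * 1)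
    = e.poly k 0 * modComponent n (i.1 : ZMod n) (toRowZero s)
  rw [mul_one, toRowZero, rename_modComponent, modComponent_eq_self]
  exact fun w hw => (mem_support_of_mem_support_modComponent hw).2

end QuiverAlgHom

/-! ### Maps from S to the syzygies -/

section HomSpaces

variable {k : Type u} [Field k] {d n : ℕ}

/-- The polynomials whose monomials all lie in a given set. -/
def supportedOn {σ : Type*} (A : Set (σ →₀ ℕ)) : Submodule k (MvPolynomial σ k) where
  carrier := {z | ∀ w ∈ z.support, w ∈ A}
  zero_mem' := by simp
  add_mem' := by
    classical
    intro x y hx hy w hw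
    rcases Finset.mem_union.1 (support_add hw) with h | h
    exacts [hx w h, hy w h]
  smul_mem' r x hx w hw := hx w (support_smul hw)

theorem modComponent_monomial {i : ℕ} {α : Fin d →₀ ℕ} (hα : (α.degree : ZMod n) = i) (r : k) :
    modComponent n (i : ZMod n) (monomial α r) = monomial α r := by
  refine modComponent_eq_self fun w hw => ?_
  rw [Finset.mem_singleton.1 (support_monomial_subset hw), hα]

theorem modComponent_X_pow (i : ℕ) (s : Fin d) :
    modComponent n (i : ZMod n) (X s ^ i : MvPolynomial (Fin d) k) = X s ^ i := by
  rw [X_pow_eq_monomial, modComponent_monomial (by rw [Finsupp.degree_single])]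

theorem toRowZero_X_pow (i : ℕ) (s : Fin d) :
    toRowZero (X s ^ i : MvPolynomial (Fin d) k) = X (0, s) ^ i := by
  rw [map_pow, toRowZero, rename_X]

theorem degree_modComponent {i : ℕ} (f : MvPolynomial (Fin d) k) :
    ∀ α ∈ (modComponent n (i : ZMod n) f).support, (α.degree : ZMod n) = i :=
  fun _ hα => (mem_support_of_mem_support_modComponent hα).2

theorem mul_mem_veronese {i : ℕ} {γ : Fin d →₀ ℕ} (hγ : n ∣ γ.degree + i)
    (f : MvPolynomial (Fin d) k) :
    monomial γ 1 * modComponent n (i : ZMod n) f ∈ veronese k d n := by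
  rw [← ZMod.natCast_eq_zero_iff, Nat.cast_add] at hγ
  have h : ∀ α ∈ (monomial γ 1 * modComponent n (i : ZMod n) f).support,
      (α.degree : ZMod n) = 0 := by
    refine forall_mem_support_mul (A := fun α => α = γ) (fun α hα =>
      Finset.mem_singleton.1 (support_monomial_subset hα)) (degree_modComponent f) ?_
    rintro _ α rfl hα
    rw [map_add, Nat.cast_add, hα, hγ]
  intro α hα
  rw [weight_degMod]
  exact h α (mem_support_iff.2 hα)

/-- Linear maps on `M_i` commute with cross multiplication, since `M_i` has rank one. -/
theorem toRowZero_mul_apply_comm (hd : 0 < d) {i : ℕ} (hi : i ≤ n)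
    (F : polyModule k d n →ₗ[veronese k d n] RowPoly k d) (s t : MvPolynomial (Fin d) k) :
    toRowZero (modComponent n (i : ZMod n) s) * F (modComponent n (i : ZMod n) t) =
      toRowZero (modComponent n (i : ZMod n) t) * F (modComponent n (i : ZMod n) s) := by
  have hγ : n ∣ (Finsupp.single (⟨0, hd⟩ : Fin d) (n - i)).degree + i := by
    rw [Finsupp.degree_single, Nat.sub_add_cancel hi]
  set γ := Finsupp.single (⟨0, hd⟩ : Fin d) (n - i)
  have hne : (toRowZero (monomial γ 1) : RowPoly k d) ≠ 0 := by
    rw [toRowZero_monomial]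
    exact fun h => one_ne_zero (monomial_eq_zero.1 h)
  have key : ∀ s t : MvPolynomial (Fin d) k,
      toRowZero (monomial γ 1) * (toRowZero (modComponent n (i : ZMod n) s) *
        F (modComponent n (i : ZMod n) t)) =
      F (monomial γ 1 * (modComponent n (i : ZMod n) s * modComponent n (i : ZMod n) t)) := by
    intro s t
    rw [← mul_assoc, ← map_mul, ← mul_assoc]
    exact (F.map_smul ⟨_, mul_mem_veronese hγ s⟩ (modComponent n (i : ZMod n) t)).symm
  refine mul_left_cancel₀ hne ?_
  rw [key, key, mul_comm (modComponent n (i : ZMod n) s)]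

/-- Linear maps on `M_i` are multiplications: the value at `x_s ^ i` is divisible by `x_s ^ i`,
because `x_s` and `x_t` are coprime. -/
theorem exists_eq_mul (hd : 2 ≤ d) {i : ℕ} (hi : i ≤ n)
    (F : polyModule k d n →ₗ[veronese k d n] RowPoly k d) :
    ∃ z : RowPoly k d, ∀ s : MvPolynomial (Fin d) k,
      F (modComponent n (i : ZMod n) s) = toRowZero (modComponent n (i : ZMod n) s) * z := by
  let s₀ : Fin d := ⟨0, by omega⟩
  let s₁ : Fin d := ⟨1, by omega⟩
  have h1 := toRowZero_mul_apply_comm (by omega) hi F (X s₀ ^ i) (X s₁ ^ i)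
  rw [modComponent_X_pow, modComponent_X_pow, toRowZero_X_pow, toRowZero_X_pow] at h1
  have hp : Prime (X (0, s₀) : RowPoly k d) := X_prime
  have hdvd : (X (0, s₀) : RowPoly k d) ^ i ∣ F (X s₀ ^ i : MvPolynomial (Fin d) k) := by
    refine hp.pow_dvd_of_dvd_mul_left i (fun h => ?_) (Dvd.intro _ h1)
    have := X_dvd_X.1 (hp.dvd_of_dvd_pow h)
    simp [s₀, s₁] at this
  obtain ⟨z, hz⟩ := hdvd
  refine ⟨z, fun s => mul_left_cancel₀ (pow_ne_zero i hp.ne_zero) ?_⟩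
  have h2 := toRowZero_mul_apply_comm (by omega) hi F (X s₀ ^ i) s
  rw [modComponent_X_pow, toRowZero_X_pow, hz] at h2
  rw [h2, mul_left_comm]

theorem mem_cycles_of_X_pow_mul_mem {i l : ℕ} {s : Fin d} {z : RowPoly k d}
    (hz : X (0, s) ^ i * z ∈ cycles k d n 0 0 l) : z ∈ cycles k d n 0 i l := by
  refine ⟨fun w hw => ?_, fun a h h' => ?_⟩
  · have hw' : Finsupp.single (0, s) i + w ∈ (X (0, s) ^ i * z).support := by
      rw [mem_support_iff, X_pow_eq_monomial, coeff_monomial_mul, one_mul]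
      exact mem_support_iff.1 hw
    obtain ⟨h1, h2⟩ := hz.1 _ hw'
    simp only [map_add, row_single] at h1 h2
    refine ⟨fun a ha => ?_, fun hl => ?_⟩
    · have := h1 a ha
      omega
    · obtain ⟨h3, h4, h5⟩ := h2 hl
      rw [if_pos trivial, add_zero, add_comm] at h3
      refine ⟨h3, fun a ha hal => ?_, ?_⟩
      · have := h4 a ha hal
        rwa [if_neg (by omega), zero_add] at this
      · rwa [if_neg (by omega), zero_add] at h5
  · have := hz.2 a h h'
    rw [map_mul, map_pow] at this
    refine (mul_eq_zero.1 this).resolve_left (pow_ne_zero i ?_)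
    rw [mergeRows_X]
    exact X_ne_zero _

/-- The maps from `M_i` to a syzygy are the multiplications by cycles. -/
theorem exists_comp_projM_eq (hd : 2 ≤ d) {i : ℕ} (hi : i ≤ n) {l : ℕ}
    (f : polyModule k d n →ₗ[veronese k d n] syzygyModule k d n l) :
    ∃ z : cycles k d n 0 i l, ∀ s, f (projM k d n i s) = multMap i l z s := by
  obtain ⟨z, hz⟩ := exists_eq_mul hd hi ((syzygy k d n 0 l).subtype ∘ₗ f)
  have hmem : z ∈ cycles k d n 0 i l := by
    let s₀ : Fin d := ⟨0, by omega⟩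
    have h := hz (X s₀ ^ i)
    rw [modComponent_X_pow, toRowZero_X_pow] at h
    refine mem_cycles_of_X_pow_mul_mem (s := s₀) ?_
    rw [← h]
    exact (f (X s₀ ^ i : MvPolynomial (Fin d) k)).2
  exact ⟨⟨z, hmem⟩, fun s => Subtype.ext (hz s)⟩

/-! ### Surjectivity -/

variable (hn : 2 ≤ n) (p : ProjectivePresentations (veronese k d n))

/-- Multiplication of `M_i` by a multiple of a monomial of degree `n - i` factors through the
ring. -/
theorem gammaMap_eq_zero {i l : ℕ} {γ : Fin d →₀ ℕ} (hγ : n ∣ γ.degree + i) {y : RowPoly k d}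
    (hy : y ∈ cycles k d n 0 0 l) (z : cycles k d n 0 i l)
    (hz : z.1 = toRowZero (monomial γ 1) * y) : gammaMap hn p i l z = 0 := by
  refine resolutionClass_eq_zero ⟨ModuleCat.of (veronese k d n) (veronese k d n),
    inferInstanceAs (Module.Projective (veronese k d n) (veronese k d n)),
    { toFun := fun s => ⟨monomial γ 1 * modComponent n (i : ZMod n) s, mul_mem_veronese hγ s⟩
      map_add' := fun s t => Subtype.ext ?_
      map_smul' := fun r s => Subtype.ext ?_ },
    { toFun := fun r => (⟨toRowZero r.1 * y, veronese_smul_mem_cycles r hy⟩ : syzygy k d n 0 l)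
      map_add' := fun r s => Subtype.ext ?_
      map_smul' := fun r s => Subtype.ext ?_ }, LinearMap.ext fun s => Subtype.ext ?_⟩
  · exact (congrArg (monomial γ 1 * ·) (map_add (modComponent n (i : ZMod n)) _ _)).trans
      (mul_add _ _ _)
  · exact (congrArg (monomial γ 1 * ·)
      (weightedHomogeneousComponent_veronese_mul (i : ZMod n) r s)).trans (mul_left_comm _ _ _)
  · exact (congrArg (· * y) (map_add toRowZero r.1 s.1)).trans (add_mul _ _ _)
  · exact (congrArg (· * y) (map_mul toRowZero r.1 s.1)).trans (mul_assoc _ _ _)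
  · change toRowZero (modComponent n (i : ZMod n) s) * z.1 =
      toRowZero (monomial γ 1 * modComponent n (i : ZMod n) s) * y
    rw [hz, map_mul]
    ring

/-- The path along the letters of a monomial. -/
theorem exists_path_of_degree (i : QVertex d n) (α : Fin d →₀ ℕ) (h : i.1 + α.degree < n) :
    ∃ (j : QVertex d n) (q : Quiver.Path i j), j.1 = i.1 + α.degree ∧ crossings q = 0 ∧
      pathPoly k q = toRowZero (monomial α 1) := by
  induction hm : α.degree generalizing α with
  | zero =>
    rw [(Finsupp.degree_eq_zero_iff α).1 hm]
    exact ⟨i, .nil, rfl, rfl, (map_one toRowZero).symm⟩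
  | succ m ih =>
    obtain ⟨β, γ, rfl, hγ⟩ := exists_add_of_le_degree (m := 1) α (by omega)
    rw [map_add] at h hm
    obtain ⟨j, q, hj, hq, hpoly⟩ := ih β (by omega) (by omega)
    obtain ⟨s, rfl⟩ : ∃ s, γ = Finsupp.single s 1 := by
      have hne : γ ≠ 0 := by
        rintro rfl
        simp at hγ
      obtain ⟨s, hs⟩ := Finsupp.ne_iff.1 hne
      obtain ⟨γ', rfl⟩ := exists_add_single (Nat.pos_of_ne_zero hs)
      rw [map_add, Finsupp.degree_single] at hγ
      rw [(Finsupp.degree_eq_zero_iff γ').1 (by omega), zero_add]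
      exact ⟨s, rfl⟩
    have hi := i.pos
    refine ⟨⟨i.1 + (m + 1), Finset.mem_Ico.2 ⟨by omega, by omega⟩⟩,
      q.cons (QArrow.x (show _ = j.1 + 1 by rw [hj]; change i.1 + (m + 1) = _; omega) s), rfl,
      ?_, ?_⟩
    · exact hq
    · change pathPoly k q * X (crossings q, s) = _
      have e : monomial (β + Finsupp.single s 1) (1 : k) = monomial β 1 * X s := by
        rw [X, monomial_mul, mul_one]
      rw [hpoly, hq, e, map_mul]
      exact congrArg _ (rename_X _ _).symm

/-- The multiplications by cycles are in the image: they are combinations of paths, up to maps which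
factor through the ring. -/
theorem gammaMap_mem_range (i : QVertex d n) (l : ℕ) (z : cycles k d n 0 i.1 l) :
    gammaMap hn p i.1 l z ∈ (quiverAlgHom hn p).range := by
  have hi := i.pos
  have hin := i.lt
  set T : Submodule k (RowPoly k d) := ((Subalgebra.toSubmodule (quiverAlgHom hn p).range).comap
    (gammaMap hn p i.1 l)).map (cycles k d n 0 i.1 l).subtype with hT
  suffices h : z.1 ∈ T by
    obtain ⟨z', h, h'⟩ := h
    obtain rfl : z' = z := Subtype.ext h'
    exact h
  have hpath : ∀ {j : QVertex d n} (q : Quiver.Path i j), crossings q = l → pathPoly k q ∈ T := by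
    rintro j q rfl
    exact ⟨⟨_, pathPoly_mem_cycles q⟩, ⟨pathClass k q, (quiverAlgHom_pathClass hn p q).trans
      (pathImage_eq_gammaMap hn p q)⟩, rfl⟩
  have hzero : ∀ (γ : Fin d →₀ ℕ) (y : RowPoly k d), γ.degree = n - i.1 →
      y ∈ cycles k d n 0 0 l → toRowZero (monomial γ 1) * y ∈ T := by
    intro γ y hγ hy
    have hmem : toRowZero (monomial γ 1) * y ∈ cycles k d n 0 i.1 l := by
      refine toRowZero_mul_mem_cycles (fun α hα => ?_) hy
      rw [Finset.mem_singleton.1 (support_monomial_subset hα), hγ, Nat.sub_add_cancel hin.le]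
      exact Nat.modEq_zero_iff_dvd.2 dvd_rfl
    refine ⟨⟨_, hmem⟩, ?_, rfl⟩
    have h0 := gammaMap_eq_zero hn p (γ := γ) (by rw [hγ, Nat.sub_add_cancel hin.le]) hy
      ⟨_, hmem⟩ rfl
    change gammaMap hn p i.1 l ⟨_, hmem⟩ ∈ (quiverAlgHom hn p).range
    exact h0 ▸ zero_mem _
  rcases Nat.eq_zero_or_pos l with rfl | hl
  · rw [z.1.as_sum]
    refine Submodule.sum_mem _ fun w hw => ?_
    obtain ⟨α, rfl⟩ := eq_mapDomain_of_row_eq_zero (z.2.1 w hw).1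
    rw [← toRowZero_monomial, ← mul_one (coeff _ _), ← smul_eq_mul, ← smul_monomial, map_smul]
    refine Submodule.smul_mem _ _ ?_
    rcases Nat.lt_or_ge (i.1 + α.degree) n with h | h
    · obtain ⟨j, q, -, hq, hpoly⟩ := exists_path_of_degree (k := k) i α h
      exact hpoly ▸ hpath q hq
    · obtain ⟨β, γ, rfl, hγ⟩ := exists_add_of_le_degree (m := n - i.1) α (by omega)
      rw [add_comm, ← mul_one (1 : k), ← monomial_mul, map_mul]
      exact hzero γ _ hγ (toRowZero_mem_syzygy _)
  · refine Submodule.span_le.2 ?_ (cycles_le_span hl le_rfl z.2)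
    rintro _ ⟨j, q, α, hq, hα, rfl⟩
    rw [add_assoc, Nat.sub_add_cancel hin.le] at hα
    replace hα : n ∣ α.degree := (Nat.dvd_add_left dvd_rfl).1 hα
    rcases Nat.eq_zero_or_pos α.degree with h | h
    · rw [(Finsupp.degree_eq_zero_iff α).1 h]
      have : (toRowZero (monomial 0 1) : RowPoly k d) = 1 := map_one toRowZero
      rw [this, one_mul]
      exact hpath q hq
    · have hle := Nat.le_of_dvd h hα
      obtain ⟨β, γ, rfl, hγ⟩ := exists_add_of_le_degree (m := n - i.1) α (by omega)
      rw [add_comm, ← mul_one (1 : k), ← monomial_mul, map_mul, mul_assoc]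
      refine hzero γ _ hγ ?_
      subst hq
      refine toRowZero_mul_mem_cycles (fun δ hδ => ?_) (pathPoly_mem_cycles q)
      rw [Finset.mem_singleton.1 (support_monomial_subset hδ), add_zero]
      rw [map_add, hγ] at hα
      have h1 : β.degree + (n - i.1) ≡ i.1 + (n - i.1) [MOD n] := by
        rw [Nat.add_sub_cancel' hin.le]
        exact (Nat.modEq_zero_iff_dvd.2 hα).trans (Nat.modEq_zero_iff_dvd.2 dvd_rfl).symm
      exact Nat.ModEq.add_right_cancel' _ h1

theorem gammaClass_sum {ι : Type*} (l : ℕ) (F : Finset ι)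
    (f : ι → (polyModule k d n →ₗ[veronese k d n] syzygyModule k d n l)) :
    gammaClass hn p l (∑ i ∈ F, f i) = ∑ i ∈ F, gammaClass hn p l (f i) :=
  map_sum (AddMonoidHom.mk' (gammaClass hn p l) (resolutionClass_add l)) f F

theorem quiverAlgHom_surjective (hd : 2 ≤ d) : Function.Surjective (quiverAlgHom hn p) := by
  intro x
  change x ∈ (quiverAlgHom hn p).range
  induction x using DirectSum.induction_on with
  | zero => exact zero_mem _
  | add x y hx hy => exact add_mem hx hy
  | of l x =>
    obtain ⟨f, hf⟩ := exists_resolutionClass (p := p) (res := syzygyPresentation k d hn)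
      (e := syzygyZeroEquiv k d n) l x
    rw [← hf]
    change gammaClass hn p l f ∈ _
    have hf' : f = ∑ i ∈ Finset.range n, f ∘ₗ projM k d n i := by
      refine LinearMap.ext fun s => ?_
      rw [LinearMap.sum_apply]
      refine Eq.trans ?_ (map_sum f (fun i => projM k d n i s) _)
      exact congrArg f (sum_modComponent (by omega) s).symm
    rw [hf', gammaClass_sum]
    refine sum_mem fun i hi => ?_
    have hin := Finset.mem_range.1 hi
    obtain ⟨z, hz⟩ := exists_comp_projM_eq hd hin.le f
    have hz' : f ∘ₗ projM k d n i = multMap i l z := LinearMap.ext hz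
    rw [hz']
    change gammaMap hn p i l z ∈ _
    rcases Nat.eq_zero_or_pos i with rfl | hi0
    · have h0 := gammaMap_eq_zero hn p (γ := 0) (by simp) z.2 z
        ((one_mul z.1).symm.trans (congrArg (· * z.1) (map_one toRowZero).symm))
      exact h0 ▸ zero_mem (quiverAlgHom hn p).range
    · exact gammaMap_mem_range hn p ⟨i, Finset.mem_Ico.2 ⟨hi0, hin⟩⟩ l z

end HomSpaces

/-! ### Injectivity -/

section Injectivity

variable {k : Type u} [Field k] {d n : ℕ}

/-- The row zero of a monomial of a cycle cannot be empty, hence it has degree at least `n`. -/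
theorem le_row_zero_of_mem_cycles (hn : 2 ≤ n) {l : ℕ} (hl : 0 < l) {y : RowPoly k d}
    (hy : y ∈ cycles k d n 0 0 l) : ∀ w ∈ y.support, n ≤ row 0 w := by
  let i : QVertex d n := ⟨1, Finset.mem_Ico.2 ⟨le_rfl, hn⟩⟩
  have hi : i.1 = 1 := rfl
  suffices h : Submodule.span k (pathMultiples k i 0 l) ≤ supportedOn {w | n ≤ row 0 w} from
    h (cycles_le_span hl (Nat.zero_le _) hy)
  refine Submodule.span_le.2 ?_
  rintro _ ⟨j, q, α, rfl, hα, rfl⟩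
  refine forall_mem_support_mul (fun w hw => exists_of_mem_support_toRowZero hw)
    (row_of_mem_support_pathPoly k q) ?_
  rintro _ w ⟨β, hβ, rfl⟩ hw
  have hrow := row_leadingMon q 0
  rw [if_pos rfl, if_pos hl] at hrow
  change n ≤ row 0 _
  rw [map_add, row_mapDomain_zero, if_pos rfl, hw, Finset.mem_singleton.1
    (support_monomial_subset hβ)]
  have := Nat.le_of_dvd (by omega) hα
  omega

/-- The values at `x_s ^ i` of a functional on `S` have no constant term. -/
theorem le_degree_of_functional (hd : 2 ≤ d) {i : ℕ} (hi : 0 < i) (hin : i ≤ n)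
    (a : polyModule k d n →ₗ[veronese k d n] veronese k d n) (s : Fin d) :
    ∀ w ∈ (toRowZero (a (X s ^ i : MvPolynomial (Fin d) k)).1 : RowPoly k d).support,
      n ≤ row 0 w := by
  let j : veronese k d n →ₗ[veronese k d n] RowPoly k d :=
    { toFun := fun r => toRowZero r.1
      map_add' := fun r s => map_add toRowZero r.1 s.1
      map_smul' := fun r s => map_mul toRowZero r.1 s.1 }
  obtain ⟨z, hz⟩ := exists_eq_mul hd hin (j ∘ₗ a)
  have h1 : toRowZero (a (X s ^ i : MvPolynomial (Fin d) k)).1 = X (0, s) ^ i * z := by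
    have := hz (X s ^ i)
    rwa [modComponent_X_pow, toRowZero_X_pow] at this
  have hpos : ∀ w ∈ (X (0, s) ^ i * z).support, i ≤ row 0 w := by
    refine forall_mem_support_mul (A := fun w => w = Finsupp.single (0, s) i) (fun w hw => ?_)
      (fun w hw => hw) ?_
    · rw [X_pow_eq_monomial] at hw
      exact Finset.mem_singleton.1 (support_monomial_subset hw)
    · rintro _ w rfl -
      rw [map_add, row_single, if_pos rfl]
      exact Nat.le_add_right _ _
  intro w hw
  have h2 := hpos w (h1 ▸ hw)
  obtain ⟨α, hα, rfl⟩ := exists_of_mem_support_toRowZero hw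
  rw [row_mapDomain_zero, if_pos rfl] at h2 ⊢
  exact Nat.le_of_dvd (by omega) (dvd_degree_of_mem_support _ hα)

/-- A map which factors through a projective module sends `x_s ^ i` to multiples of polynomials of
degree at least `n` in row zero. -/
theorem le_row_zero_of_mem_projectiveMaps (hd : 2 ≤ d) {l N : ℕ}
    (hN : ∀ y ∈ cycles k d n 0 0 l, ∀ w ∈ y.support, N ≤ row 0 w)
    {f : polyModule k d n →ₗ[veronese k d n] syzygyModule k d n l}
    (hf : f ∈ projectiveMaps (polyModule k d n) (syzygyModule k d n l)) {i : ℕ} (hi : 0 < i)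
    (hin : i ≤ n) (s : Fin d) :
    ∀ w ∈ (f (X s ^ i : MvPolynomial (Fin d) k)).1.support, n + N ≤ row 0 w := by
  obtain ⟨P, hP, a, b, rfl⟩ := hf
  obtain ⟨e, he⟩ := hP.out
  have key : (b ∘ₗ a) (X s ^ i : MvPolynomial (Fin d) k) =
      ∑ t ∈ (e (a (X s ^ i : MvPolynomial (Fin d) k))).support,
        (e (a (X s ^ i : MvPolynomial (Fin d) k)) t) • b t := by
    have := he (a (X s ^ i : MvPolynomial (Fin d) k))
    rw [Finsupp.linearCombination_apply, Finsupp.sum] at this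
    refine (congrArg b this.symm).trans ((map_sum b _ _).trans ?_)
    exact Finset.sum_congr rfl fun t _ => map_smul b _ _
  have key' := (congrArg Subtype.val key).trans (map_sum (syzygy k d n 0 l).subtype _ _)
  suffices h : ((b ∘ₗ a) (X s ^ i : MvPolynomial (Fin d) k)).1 ∈
      (supportedOn {w | n + N ≤ row 0 w} : Submodule k (RowPoly k d)) from h
  rw [key']
  refine Submodule.sum_mem _ fun t _ => ?_
  refine forall_mem_support_mul
    (le_degree_of_functional hd hi hin (Finsupp.lapply t ∘ₗ e ∘ₗ a) s) (hN _ (b t).2) ?_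
  intro v w hv hw
  change n + N ≤ row 0 (v + w)
  rw [map_add]
  exact add_le_add hv hw

/-- The combination `∑ c_q q` of paths, restricted to the paths from `i` with `l` crossings, as a
cycle. -/
noncomputable def pathCycle (c : AnyPath (QVertex d n) →₀ k) (i l : ℕ) : cycles k d n 0 i l :=
  open scoped Classical in
  ∑ q ∈ c.support, if h : q.1.1 = i ∧ crossings q.2.2 = l then
    c q • ⟨pathPoly k q.2.2, h.1 ▸ h.2 ▸ pathPoly_mem_cycles q.2.2⟩ else 0

theorem row_zero_of_mem_support_pathCycle (c : AnyPath (QVertex d n) →₀ k) (i l : ℕ) :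
    ∀ w ∈ (pathCycle c i l).1.support, i + row 0 w < n + if l = 0 then 0 else n := by
  classical
  suffices h : (pathCycle c i l).1 ∈
      (supportedOn {w | i + row 0 w < n + if l = 0 then 0 else n} : Submodule k (RowPoly k d))
    from h
  change (cycles k d n 0 i l).subtype _ ∈ _
  rw [pathCycle, map_sum]
  refine Submodule.sum_mem _ fun q _ => ?_
  by_cases h : q.1.1 = i ∧ crossings q.2.2 = l
  · rw [dif_pos h]
    obtain ⟨rfl, rfl⟩ := h
    refine Submodule.smul_mem _ _ fun w hw => ?_
    have h1 := row_leadingMon q.2.2 0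
    rw [← row_of_mem_support_pathPoly k q.2.2 w hw, if_pos rfl] at h1
    have h2 := q.2.1.lt
    change _ + row 0 w < _
    split_ifs at h1 ⊢ <;> omega
  · rw [dif_neg h]
    exact zero_mem _

theorem sum_pathCycle (c : AnyPath (QVertex d n) →₀ k) (i L : ℕ)
    (hL : ∀ q ∈ c.support, crossings q.2.2 < L) [DecidableEq (QVertex d n)] :
    ∑ l ∈ Finset.range L, (pathCycle c i l).1 =
      ∑ q ∈ c.support with q.1.1 = i, c q • pathPoly k q.2.2 := by
  classical
  have h1 : ∀ l, (pathCycle c i l).1 = ∑ q ∈ c.support,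
      if crossings q.2.2 = l then (if q.1.1 = i then c q • pathPoly k q.2.2 else 0) else 0 := by
    intro l
    change (cycles k d n 0 i l).subtype _ = _
    rw [pathCycle, map_sum]
    refine Finset.sum_congr rfl fun q _ => ?_
    split_ifs with h h' h'' h' h'' <;> first | rfl | (exfalso; tauto)
  rw [Finset.sum_congr rfl fun l _ => h1 l, Finset.sum_comm, Finset.sum_filter]
  refine Finset.sum_congr rfl fun q hq => ?_
  rw [Finset.sum_ite_eq, if_pos (Finset.mem_range.2 (hL q hq))]

theorem directSum_eq_zero_of_sum_of_eq_zero {β : ℕ → Type*} [∀ l, AddCommGroup (β l)]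
    (F : Finset ℕ) (g : ∀ l, β l) (h : ∑ l ∈ F, DirectSum.of β l (g l) = 0) :
    ∀ l ∈ F, g l = 0 := by
  intro l hl
  have := congrArg (fun x => x l) h
  change (∑ l ∈ F, DirectSum.of β l (g l)) l = 0 at this
  rw [DirectSum.sum_apply, Finset.sum_eq_single l] at this
  · rwa [DirectSum.of_eq_same] at this
  · exact fun j _ hj => DirectSum.of_eq_of_ne _ _ _ hj.symm
  · exact fun h => absurd hl h

variable (hn : 2 ≤ n) (p : ProjectivePresentations (veronese k d n))

theorem sum_gammaMap_pathCycle (c : AnyPath (QVertex d n) →₀ k) (L : ℕ)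
    (hL : ∀ q ∈ c.support, crossings q.2.2 < L) :
    ∑ l ∈ Finset.range L, ∑ i ∈ Finset.range n, gammaMap hn p i l (pathCycle c i l) =
      ∑ q ∈ c.support, c q • pathImage hn p q.2.2 := by
  classical
  have h1 : ∀ i l, gammaMap hn p i l (pathCycle c i l) = ∑ q ∈ c.support,
      if crossings q.2.2 = l then (if q.1.1 = i then c q • pathImage hn p q.2.2 else 0) else 0 := by
    intro i l
    rw [pathCycle, map_sum]
    refine Finset.sum_congr rfl fun q _ => ?_
    by_cases h : q.1.1 = i ∧ crossings q.2.2 = l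
    · obtain ⟨rfl, rfl⟩ := h
      rw [dif_pos ⟨rfl, rfl⟩, if_pos rfl, if_pos rfl]
      exact (map_smul _ _ _).trans (congrArg _ (pathImage_eq_gammaMap hn p q.2.2).symm)
    · rw [dif_neg h, map_zero]
      split_ifs with h' h'' <;> first | rfl | (exfalso; tauto)
  simp only [h1]
  rw [Finset.sum_congr rfl fun l _ => Finset.sum_comm, Finset.sum_comm]
  refine Finset.sum_congr rfl fun q hq => ?_
  rw [Finset.sum_comm, Finset.sum_eq_single q.1.1]
  · rw [Finset.sum_ite_eq, if_pos (Finset.mem_range.2 (hL q hq)), if_pos rfl]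
  · intro i _ hi
    simp [Ne.symm hi]
  · exact fun h => absurd (Finset.mem_range.2 q.1.lt) h

/-- If a combination of paths vanishes in `Γ`, then so do the polynomials of its parts. Compare the
degrees in row zero of the values at `x_s ^ i`: for a combination of paths they are `n`, or less
than `n` if there are no crossings, and for a map which factors through a projective module they are
at least `2 n`, or `n`. -/
theorem pathCycle_eq_zero (hd : 2 ≤ d) (c : AnyPath (QVertex d n) →₀ k)
    (h : ∑ q ∈ c.support, c q • pathImage hn p q.2.2 = 0) (L : ℕ)
    (hL : ∀ q ∈ c.support, crossings q.2.2 < L) {i l : ℕ} (hi : 0 < i) (hin : i < n)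
    (hl : l < L) : (pathCycle c i l).1 = 0 := by
  rw [← sum_gammaMap_pathCycle hn p c L hL] at h
  set f : ∀ l, polyModule k d n →ₗ[veronese k d n] syzygyModule k d n l :=
    fun l => ∑ i ∈ Finset.range n, multMap i l (pathCycle c i l) with hfdef
  have h1 : ∑ l ∈ Finset.range L, gammaClass hn p l (f l) = 0 := by
    rw [← h]
    exact Finset.sum_congr rfl fun l _ => gammaClass_sum hn p l _ _
  have h2 := directSum_eq_zero_of_sum_of_eq_zero (Finset.range L) _ h1 l (Finset.mem_range.2 hl)
  have h3 : f l ∈ projectiveMaps _ _ := mk_comparison_comp_eq_zero_iff.1 h2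
  let s : Fin d := ⟨0, by omega⟩
  have hN : ∀ y ∈ cycles k d n 0 0 l, ∀ w ∈ y.support, (if l = 0 then 0 else n) ≤ row 0 w := by
    intro y hy w hw
    split_ifs with h0
    · exact Nat.zero_le _
    · exact le_row_zero_of_mem_cycles hn (Nat.pos_of_ne_zero h0) hy w hw
  have h4 := le_row_zero_of_mem_projectiveMaps hd hN h3 hi hin.le s
  have h5 : (f l (X s ^ i : MvPolynomial (Fin d) k)).1 = X (0, s) ^ i * (pathCycle c i l).1 := by
    have e1 : (f l (X s ^ i : MvPolynomial (Fin d) k)).1 = ∑ j ∈ Finset.range n,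
        toRowZero (modComponent n (j : ZMod n) (X s ^ i)) * (pathCycle c j l).1 := by
      refine (congrArg Subtype.val (LinearMap.sum_apply _ _ _)).trans ?_
      exact map_sum (syzygy k d n 0 l).subtype _ _
    rw [e1, Finset.sum_eq_single i]
    · rw [modComponent_X_pow, toRowZero_X_pow]
    · intro j hj hji
      rw [modComponent_eq_zero, map_zero, zero_mul]
      intro w hw hwj
      rw [X_pow_eq_monomial] at hw
      rw [Finset.mem_singleton.1 (support_monomial_subset hw), Finsupp.degree_single,
        ZMod.natCast_eq_natCast_iff] at hwj
      exact hji (Nat.ModEq.eq_of_lt_of_lt hwj hin (Finset.mem_range.1 hj)).symm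
    · exact fun h => absurd (Finset.mem_range.2 hin) h
  rw [h5] at h4
  rw [← support_eq_empty, Finset.eq_empty_iff_forall_notMem]
  intro w hw
  have h6 := row_zero_of_mem_support_pathCycle c i l w hw
  have h7 := h4 (Finsupp.single (0, s) i + w) (by
    rw [mem_support_iff, X_pow_eq_monomial, coeff_monomial_mul, one_mul]
    exact mem_support_iff.1 hw)
  rw [map_add, row_single, if_pos rfl] at h7
  omega

theorem exists_eq_linearCombination_standard (x : QuiverAlgebra k d n) :
    ∃ c : AnyPath (QVertex d n) →₀ k, (∀ q ∈ c.support, Standard q.2.2) ∧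
      ∑ q ∈ c.support, c q • pathClass k q.2.2 = x := by
  suffices h : x ∈ Submodule.span k
      ((fun q : AnyPath (QVertex d n) => pathClass k q.2.2) '' {q | Standard q.2.2}) by
    obtain ⟨c, hc, h⟩ := (Finsupp.mem_span_image_iff_linearCombination k).1 h
    exact ⟨c, fun q hq => hc hq, h⟩
  obtain ⟨y, rfl⟩ := RingQuot.mkAlgHom_surjective k _ x
  obtain ⟨F, c, hy⟩ : ∃ (F : Finset (AnyPath (QVertex d n))) (c : AnyPath (QVertex d n) → k),
      y = ∑ q ∈ F, c q • PathAlgebra.ofPath q := by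
    let y' : AnyPath (QVertex d n) →₀ k := y
    refine ⟨y'.support, y', Eq.trans ?_ (Finsupp.linearCombination_apply k y')⟩
    exact LinearMap.congr_fun (f := LinearMap.id) (g := PathAlgebra.lift fun q =>
      PathAlgebra.ofPath q) (PathAlgebra.hom_ext fun q => by
        rw [PathAlgebra.lift_ofPath, LinearMap.id_apply]) y
  rw [hy, map_sum]
  refine Submodule.sum_mem _ fun q _ => ?_
  rw [map_smul]
  refine Submodule.smul_mem _ _ (Submodule.span_mono ?_ (pathClass_mem_span_standard q.2.2))
  rintro _ ⟨q', hq', rfl⟩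
  exact ⟨⟨_, _, q'⟩, hq', rfl⟩

theorem quiverAlgHom_injective (hd : 2 ≤ d) : Function.Injective (quiverAlgHom hn p) := by
  classical
  refine (injective_iff_map_eq_zero _).2 fun x hx => ?_
  obtain ⟨c, hc, rfl⟩ := exists_eq_linearCombination_standard x
  have h : ∑ q ∈ c.support, c q • pathImage hn p q.2.2 = 0 := by
    rw [← hx, map_sum]
    refine Finset.sum_congr rfl fun q _ => ?_
    rw [map_smul, quiverAlgHom_pathClass]
  refine Finset.sum_eq_zero fun q hq => ?_
  have hL : ∀ q' ∈ c.support, crossings q'.2.2 <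
      c.support.sup (fun q => crossings q.2.2) + 1 := fun q' hq' =>
    Nat.lt_succ_of_le (Finset.le_sup (f := fun q : AnyPath (QVertex d n) => crossings q.2.2) hq')
  have h1 := sum_pathCycle c q.1.1 _ hL
  rw [Finset.sum_eq_zero fun l hl => pathCycle_eq_zero hn p hd c h _ hL q.1.pos q.1.lt
    (Finset.mem_range.1 hl)] at h1
  have h2 := eq_zero_of_sum_pathPoly_eq_zero q.1 _ c (fun q' hq' =>
    ⟨Subtype.ext (Finset.mem_filter.1 hq').2, hc q' (Finset.mem_filter.1 hq').1⟩) h1.symm q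
    (Finset.mem_filter.2 ⟨hq, rfl⟩)
  rw [h2, zero_smul]

end Injectivity

theorem theorem4p16 (k : Type u) [Field k] (a n d : ℕ) (ha : 1 ≤ a) (hn : 2 ≤ n) (hd : d = a * n)
    (p : ProjectivePresentations (veronese k d n)) :
    ∃ φ : QuiverAlgebra k d n ≃ₐ[k] Gamma k d n p,
      (∀ i : QVertex d n,
        φ (QuiverAlgebra.mk k (PathAlgebra.vertex k i)) = Gamma.ofEnd p (projM k d n i.1)) ∧
      (∀ (i j : QVertex d n) (h : j.1 = i.1 + 1) (s : Fin d),
        φ (QuiverAlgebra.mk k (arrowX k h s)) = Gamma.ofEnd p (mulXM k d n i.1 s)) ∧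
      (∀ (i j : QVertex d n) (hi : i.1 + 1 = n) (hj : j.1 = 1) (s t : Fin d) (hst : s < t),
        ∃ g : p.Component (polyModule k d n) 1,
          φ (QuiverAlgebra.mk k (arrowXX k hi hj hst)) = Gamma.of p 1 g) := by
  have hd2 : 2 ≤ d := hd ▸ hn.trans (Nat.le_mul_of_pos_left n ha)
  refine ⟨AlgEquiv.ofBijective (quiverAlgHom hn p)
    ⟨quiverAlgHom_injective hn p hd2, quiverAlgHom_surjective hn p hd2⟩, fun i => ?_,
    fun i j h s => ?_, fun i j hi hj s t hst => ?_⟩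
  · exact quiverAlgHom_pathClass hn p (.nil : Quiver.Path i i)
  · refine (quiverAlgHom_arrow hn p (QArrow.x h s)).trans
      (ofEnd_eq_gammaClass hn p _ _ fun f => ?_).symm
    change toRowZero (X s * modComponent n (i.1 : ZMod n) f) =
      X (0, s) * modComponent n (i.1 : ZMod n) (toRowZero f)
    rw [map_mul, toRowZero, rename_X, rename_modComponent]
  · exact ⟨_, quiverAlgHom_arrow hn p (QArrow.xx hi hj s t hst)⟩
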